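/- Let $V\in L^1_{\rm loc}(\mathbb R)$ be real-valued, let $-\infty<a_-<a_+<\infty$, and put $I=[a_-,a_+]$, $I_-=(-\infty,a_-]$, $I_+=[a_+,\infty)$, $\mathcal A=-\frac{d^2}{dx^2}+V$. For an interval $J$, the maximal operator of $\mathcal A$ in $L^2(J)$ is $f\mapsto \mathcal A f$ on the set of all $f\in L^2(J)$ such that $f,f'$ are locally absolutely continuous on $J$ and $\mathcal Af\in L^2(J)$; the minimal operator is the closure of its restriction to functions with compact support in the interior of $J$. Let $A_\pm$ be the minimal operators in $L^2(I_\pm)$, so that $A_\pm^*$ are the maximal ones, and let $H$ be the maximal operator in $L^2(\mathbb R)$, with resolvent set $\rho(H)$. Put $\widehat\rho(A_\pm)=\{\lambda\in\mathbb C:\ \operatorname{ran}(A_\pm-\lambda)\text{ is closed}\}$ and $\Omega=\widehat\rho(A_-)\cap\widehat\rho(A_+)$. Assume that $\mathcal A$ is in the limit point case at $+\infty$ and at $-\infty$, i.e. $\dim\ker(A_\pm^*-i)=\dim\ker(A_\pm^*+i)=1$ for both $A_+$ and $A_-$. The Weyl–Titchmarsh coefficient $m_\pm$ of $A_\pm$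 is the function such that, for every non-real $\lambda$, $c_\pm(\lambda,\cdot)\pm m_\pm(\lambda)s_\pm(\lambda,\cdot)\in L^2(I_\pm)$, where $c_\pm,s_\pm$ are the solutions of $\mathcal Af=\lambda f$ on $I_\pm$ with $c_\pm(\lambda,a_\pm)=s_\pm'(\lambda,a_\pm)=1$, $c_\pm'(\lambda,a_\pm)=s_\pm(\lambda,a_\pm)=0$, extended meromorphically to $\widehat\rho(A_\pm)$. A Herglotz–Nevanlinna function is a function $\tau$ holomorphic on $\mathbb C\setminus\mathbb R$ with $\tau(\overline\lambda)=\overline{\tau(\lambda)}$ and $\operatorname{Im}\tau(\lambda)\ge0$ for $\operatorname{Im}\lambda>0$. Let $\tau_-,\tau_+$ be Herglotz–Nevanlinna functions that are meromorphic on $\Omega$. For $\lambda\in\Omega$ and $g\in L^2(I)$, the interval problem asks for $\varphi\in L^2(I)$ with $\varphi,\varphi'$ absolutely continuous on $I$ and $$(\mathcal A-\lambda)\varphi=g\ \text{ a.e. on } I,\qquad \varphi'(a_-)+\tau_-(\lambda)\varphi(a_-)=0,\qquad \varphi'(a_+)-\tau_+(\lambda)\varphi(a_+)=0,$$ where the condition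 at $a_\pm$ is read as $\varphi(a_\pm)=0$ if $\lambda$ is a pole of $\tau_\pm$. A point $\lambda\in\Omega$ is a regular point of the interval problem if for every $g\in L^2(I)$ it has exactly one solution. The boundary conditions given by $\tau_-,\tau_+$ are called transparent for $\mathcal A$ on $I$ if: 1. for all $\lambda\in\Omega$ and $g\in L^2(I)$, with $\widetilde g$ the extension of $g$ by zero to $\mathbb R$, every $\psi\in\operatorname{dom}H$ with $(H-\lambda)\psi=\widetilde g$ restricts on $I$ to a solution of the interval problem; 2. for all $\lambda\in\Omega$ and $g\in L^2(I)$, every solution $\varphi$ of the interval problem is the restriction to $I$ of some $\psi\in\operatorname{dom}H$ with $(H-\lambda)\psi=\widetilde g$; 3. the set of regular points of the interval problem is equal to $\rho(H)$. Then the Weyl–Titchmarsh coefficients $m_-$ and $m_+$ exist, and they give the unique pair of transparent boundary conditions on $I$: they are Herglotz–Nevanlinna functions meromorphic on $\Omega$; the conditions $$\varphi'(a_-)+m_-(\lambda)\varphi(a_-)=0,\qquad \varphi'(a_+)-m_+(\lambda)\varphi(a_+)=0\qquad(\lambda\in\Omega)$$ are transparent for $\mathcal A$ on $I$; and if $\tau_-,\tau_+$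 is any pair whose boundary conditions are transparent for $\mathcal A$ on $I$, then $\tau_-=m_-$ and $\tau_+=m_+$ on $\Omega$. -/

import Mathlib

open MeasureTheory Set Filter Topology
open scoped ENNReal

namespace TransparentBC

/-- `f` is locally absolutely continuous on the interval `J`: it is absolutely continuous
on every compact interval contained in `J`. -/
def LocAC (J : Set ℝ) (f : ℝ → ℂ) : Prop :=
  ∀ c d : ℝ, c ≤ d → Icc c d ⊆ J → AbsolutelyContinuousOnInterval f c d

/-- `f` and `f'` are locally absolutely continuous on the interval `J`; the derivative is
one-sided at end points of `J` that belong to `J`. -/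
structure Regular (J : Set ℝ) (f : ℝ → ℂ) : Prop where
  differentiableOn : DifferentiableOn ℝ f J
  locAC : LocAC J f
  locAC_deriv : LocAC J (derivWithin f J)

/-- The differential expression `-f'' + V f` on `J` (meaningful almost everywhere on `J` when
`f` and `f'` are locally absolutely continuous). -/
noncomputable def expr (V : ℝ → ℝ) (J : Set ℝ) (f : ℝ → ℂ) (x : ℝ) : ℂ :=
  -derivWithin (derivWithin f J) J x + (V x : ℂ) * f x

/-- The Hilbert space `L²(J)`. -/
noncomputable abbrev L2 (J : Set ℝ) := Lp ℂ 2 (volume.restrict J)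

/-! Closure properties needed to see that the operators below are linear. -/

theorem LocAC.add {J : Set ℝ} {f g : ℝ → ℂ} (hf : LocAC J f) (hg : LocAC J g) :
    LocAC J (f + g) :=
  fun c d hcd h => (hf c d hcd h).add (hg c d hcd h)

theorem LocAC.const_smul {J : Set ℝ} {f : ℝ → ℂ} (k : ℂ) (hf : LocAC J f) :
    LocAC J (k • f) :=
  fun c d hcd h => (hf c d hcd h).const_smul k

theorem LocAC.congr {J : Set ℝ} {f g : ℝ → ℂ} (hf : LocAC J f) (h : EqOn f g J) :
    LocAC J g := by
  intro c d hcd hJ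
  have hf' := hf c d hcd hJ
  rw [absolutelyContinuousOnInterval_iff] at hf' ⊢
  intro ε hε
  obtain ⟨δ, hδ, H⟩ := hf' ε hε
  refine ⟨δ, hδ, fun E hE hlt => ?_⟩
  have := H E hE hlt
  convert this using 2 with i hi
  have hm := hE.1 i (by simpa using hi)
  rw [uIcc_of_le hcd] at hm
  rw [h (hJ hm.1), h (hJ hm.2)]

theorem LocAC.ae_differentiable {J : Set ℝ} [hJ : J.OrdConnected] {f : ℝ → ℂ}
    (hf : LocAC J f) : ∀ᵐ x ∂(volume.restrict J), DifferentiableWithinAt ℝ f J x := by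
  have hbv : LocallyBoundedVariationOn f J := by
    intro a b ha hb
    rcases le_or_gt a b with hab | hab
    · have h := (hf a b hab (hJ.out ha hb)).boundedVariationOn
      rw [uIcc_of_le hab] at h
      exact h.mono inter_subset_right
    · rw [Icc_eq_empty (not_le.mpr hab), inter_empty]
      simp [BoundedVariationOn]
  exact hbv.ae_differentiableWithinAt hJ.measurableSet

theorem Regular.derivWithin_add {J : Set ℝ} {f g : ℝ → ℂ} (hf : Regular J f)
    (hg : Regular J g) :
    EqOn (derivWithin f J + derivWithin g J) (derivWithin (f + g) J) J := fun x hx =>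
  (_root_.derivWithin_add (hf.differentiableOn x hx) (hg.differentiableOn x hx)).symm

theorem Regular.derivWithin_smul {J : Set ℝ} {f : ℝ → ℂ} (k : ℂ) (hf : Regular J f) :
    EqOn (k • derivWithin f J) (derivWithin (k • f) J) J := fun x hx =>
  (derivWithin_const_smul k (hf.differentiableOn x hx)).symm

theorem Regular.add {J : Set ℝ} {f g : ℝ → ℂ} (hf : Regular J f) (hg : Regular J g) :
    Regular J (f + g) :=
  ⟨hf.1.add hg.1, hf.2.add hg.2, (hf.3.add hg.3).congr (hf.derivWithin_add hg)⟩

theorem Regular.const_smul {J : Set ℝ} {f : ℝ → ℂ} (k : ℂ) (hf : Regular J f) :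
    Regular J (k • f) :=
  ⟨hf.1.const_smul k, hf.2.const_smul k, (hf.3.const_smul k).congr (hf.derivWithin_smul k)⟩

theorem regular_zero (J : Set ℝ) : Regular J 0 := by
  have h : derivWithin (0 : ℝ → ℂ) J = 0 := by
    funext x
    exact congrFun (derivWithin_const (s := J) (c := (0 : ℂ))) x
  have h0 : LocAC J 0 := by
    intro c d _ _
    rw [absolutelyContinuousOnInterval_iff]
    intro ε hε
    exact ⟨1, one_pos, fun E _ _ => by simpa using hε⟩
  exact ⟨differentiableOn_const (0 : ℂ), h0, by rw [h]; exact h0⟩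

theorem expr_zero (V : ℝ → ℝ) (J : Set ℝ) : expr V J 0 = 0 := by
  have h : derivWithin (0 : ℝ → ℂ) J = 0 := by
    funext x
    exact congrFun (derivWithin_const (s := J) (c := (0 : ℂ))) x
  funext x
  simp [expr, h]

theorem expr_add (V : ℝ → ℝ) {J : Set ℝ} [hJ : J.OrdConnected] {f g : ℝ → ℂ}
    (hf : Regular J f) (hg : Regular J g) :
    expr V J (f + g) =ᵐ[volume.restrict J] expr V J f + expr V J g := by
  filter_upwards [hf.3.ae_differentiable, hg.3.ae_differentiable,
    ae_restrict_mem hJ.measurableSet] with x h1 h2 hx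
  have h := derivWithin_congr (hf.derivWithin_add hg).symm ((hf.derivWithin_add hg).symm hx)
  simp only [expr, Pi.add_apply]
  rw [h, _root_.derivWithin_add h1 h2]
  ring

theorem expr_smul (V : ℝ → ℝ) {J : Set ℝ} [hJ : J.OrdConnected] (k : ℂ) {f : ℝ → ℂ}
    (hf : Regular J f) :
    expr V J (k • f) =ᵐ[volume.restrict J] k • expr V J f := by
  filter_upwards [hf.3.ae_differentiable, ae_restrict_mem hJ.measurableSet] with x h1 hx
  have h := derivWithin_congr (hf.derivWithin_smul k).symm ((hf.derivWithin_smul k).symm hx)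
  simp only [expr, Pi.smul_apply, smul_eq_mul]
  rw [h, derivWithin_const_smul k h1, smul_eq_mul]
  ring

/-! ### Operators, given by their graphs in `L²(J) × L²(J)` -/

/-- The graph of the maximal operator: all pairs `(f, -f'' + V f)` in `L²(J) × L²(J)` such that
`f` and `f'` are locally absolutely continuous on `J`. -/
def maxOp (V : ℝ → ℝ) (J : Set ℝ) [J.OrdConnected] : Submodule ℂ (L2 J × L2 J) where
  carrier := {p | ∃ f : ℝ → ℂ, Regular J f ∧
    p.1 =ᵐ[volume.restrict J] f ∧ p.2 =ᵐ[volume.restrict J] expr V J f}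
  zero_mem' := ⟨0, regular_zero J, Lp.coeFn_zero _ _ _, by
    rw [expr_zero]; exact Lp.coeFn_zero _ _ _⟩
  add_mem' := by
    rintro p q ⟨f, hf, hf1, hf2⟩ ⟨g, hg, hg1, hg2⟩
    refine ⟨f + g, hf.add hg, ?_, ?_⟩
    · exact (Lp.coeFn_add _ _).trans (hf1.add hg1)
    · exact (Lp.coeFn_add _ _).trans ((hf2.add hg2).trans (expr_add V hf hg).symm)
  smul_mem' := by
    rintro k p ⟨f, hf, hf1, hf2⟩
    refine ⟨k • f, hf.const_smul k, ?_, ?_⟩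
    · exact (Lp.coeFn_smul _ _).trans (hf1.const_smul k)
    · exact (Lp.coeFn_smul _ _).trans ((hf2.const_smul k).trans (expr_smul V k hf).symm)

/-- The graph of the preminimal operator: the restriction of the maximal operator to the
functions with compact support in the interior of `J`. -/
def preMinOp (V : ℝ → ℝ) (J : Set ℝ) [J.OrdConnected] : Submodule ℂ (L2 J × L2 J) where
  carrier := {p | ∃ f : ℝ → ℂ, (Regular J f ∧ HasCompactSupport f ∧ tsupport f ⊆ interior J) ∧
    p.1 =ᵐ[volume.restrict J] f ∧ p.2 =ᵐ[volume.restrict J] expr V J f}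
  zero_mem' := ⟨0, ⟨regular_zero J, HasCompactSupport.zero, by simp [tsupport]⟩,
    Lp.coeFn_zero _ _ _, by rw [expr_zero]; exact Lp.coeFn_zero _ _ _⟩
  add_mem' := by
    rintro p q ⟨f, ⟨hf, hfc, hfs⟩, hf1, hf2⟩ ⟨g, ⟨hg, hgc, hgs⟩, hg1, hg2⟩
    refine ⟨f + g, ⟨hf.add hg, hfc.add hgc,
      (tsupport_add f g).trans (union_subset hfs hgs)⟩, ?_, ?_⟩
    · exact (Lp.coeFn_add _ _).trans (hf1.add hg1)
    · exact (Lp.coeFn_add _ _).trans ((hf2.add hg2).trans (expr_add V hf hg).symm)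
  smul_mem' := by
    rintro k p ⟨f, ⟨hf, hfc, hfs⟩, hf1, hf2⟩
    have hs : tsupport (k • f) ⊆ tsupport f :=
      closure_mono (Function.support_const_smul_subset k f)
    refine ⟨k • f, ⟨hf.const_smul k, hfc.mono (Function.support_const_smul_subset k f),
      hs.trans hfs⟩, ?_, ?_⟩
    · exact (Lp.coeFn_smul _ _).trans (hf1.const_smul k)
    · exact (Lp.coeFn_smul _ _).trans ((hf2.const_smul k).trans (expr_smul V k hf).symm)

/-- The graph of the minimal operator: the closure of the preminimal operator. -/
noncomputable def minOp (V : ℝ → ℝ) (J : Set ℝ) [J.OrdConnected] :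
    Submodule ℂ (L2 J × L2 J) :=
  (preMinOp V J).topologicalClosure

/-- The points of regular type of the minimal operator `A` on `J`: those `z` for which the range
of `A - z` is closed. -/
def regularType (V : ℝ → ℝ) (J : Set ℝ) [J.OrdConnected] : Set ℂ :=
  {z | IsClosed {h : L2 J | ∃ p ∈ minOp V J, h = p.2 - z • p.1}}

/-- The defect subspace `ker (A* - z)`, where `A*` is the maximal operator on `J`. -/
noncomputable def defect (V : ℝ → ℝ) (J : Set ℝ) [J.OrdConnected] (z : ℂ) :
    Submodule ℂ (L2 J) :=
  (maxOp V J).comap (LinearMap.prod LinearMap.id (z • LinearMap.id))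

/-- The limit point case for a half-line `J`: both defect numbers are `1`. -/
def LimitPoint (V : ℝ → ℝ) (J : Set ℝ) [J.OrdConnected] : Prop :=
  Module.finrank ℂ (defect V J Complex.I) = 1 ∧
    Module.finrank ℂ (defect V J (-Complex.I)) = 1

/-- The resolvent set `ρ(H)` of the operator `H` generated by `-d²/dx² + V` in `L²(ℝ)` on its
maximal domain: `z` belongs to it when `H - z` has a bounded everywhere defined inverse `R`. -/
def resolventH (V : ℝ → ℝ) : Set ℂ :=
  {z | ∃ R : L2 univ →L[ℂ] L2 univ,
    (∀ h : L2 univ, (R h, h + z • R h) ∈ maxOp V univ) ∧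
    ∀ p ∈ maxOp V univ, R (p.2 - z • p.1) = p.1}

/-! ### Herglotz-Nevanlinna functions and Weyl-Titchmarsh coefficients -/

/-- Herglotz-Nevanlinna functions that are meromorphic on `Ω`. Meromorphic functions are taken in
normal form, that is, removable singularities are removed, and at a pole (recognised by its
negative order) the value is the conventional `0`. -/
structure HerglotzOn (Ω : Set ℂ) (τ : ℂ → ℂ) : Prop where
  holomorphic : DifferentiableOn ℂ τ {z | z.im ≠ 0}
  conj : ∀ z : ℂ, z.im ≠ 0 → τ (starRingEnd ℂ z) = starRingEnd ℂ (τ z)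
  im_nonneg : ∀ z : ℂ, 0 < z.im → 0 ≤ (τ z).im
  meromorphic : MeromorphicNFOn τ Ω

/-- `f` solves `-f'' + V f = z f` on `J` with `f a = u` and `f' a = v`. -/
structure SolvesIVP (V : ℝ → ℝ) (J : Set ℝ) (a : ℝ) (z u v : ℂ) (f : ℝ → ℂ) : Prop where
  regular : Regular J f
  eqn : ∀ᵐ x ∂(volume.restrict J), expr V J f x = z * f x
  value : f a = u
  deriv_value : derivWithin f J a = v

/-- `m` is the Weyl-Titchmarsh coefficient of the minimal operator on the half-line `J` with end
point `a`; here `σ = 1` for `J = [a, ∞)` and `σ = -1` for `J = (-∞, a]`. For non-real `z`, the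
solution `c + σ m(z) s` is square integrable, where `c` and `s` are the solutions with
`c a = s' a = 1`, `c' a = s a = 0`. The function `m` is extended meromorphically to the points
of regular type. -/
structure IsWeylTitchmarsh (V : ℝ → ℝ) (J : Set ℝ) [J.OrdConnected] (a : ℝ) (σ : ℂ)
    (m : ℂ → ℂ) : Prop where
  weyl : ∀ z : ℂ, z.im ≠ 0 → ∃ c s : ℝ → ℂ,
    SolvesIVP V J a z 1 0 c ∧ SolvesIVP V J a z 0 1 s ∧
      MemLp (fun x => c x + σ * m z * s x) 2 (volume.restrict J)
  meromorphic : MeromorphicNFOn m (regularType V J)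

/-! ### The interval problem and transparent boundary conditions -/

/-- Common points of regular type of the minimal operators on `(-∞, a]` and `[b, ∞)`. -/
def commonRegularType (V : ℝ → ℝ) (a b : ℝ) : Set ℂ :=
  regularType V (Iic a) ∩ regularType V (Ici b)

/-- `ψ` lies in the domain of `H` and `(H - z) ψ = h` in `L²(ℝ)`. -/
structure SolvesLine (V : ℝ → ℝ) (z : ℂ) (h ψ : ℝ → ℂ) : Prop where
  regular : Regular univ ψ
  memLp : MemLp ψ 2 volume
  memLp_expr : MemLp (expr V univ ψ) 2 volume
  eqn : ∀ᵐ x, expr V univ ψ x - z * ψ x = h x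

/-- `φ` solves `-φ'' + V φ - z φ = g` on `[a, b]` with `φ'(a) + τ₋(z) φ(a) = 0` and
`φ'(b) - τ₊(z) φ(b) = 0`; at a pole of `τ₋` or `τ₊` the corresponding condition is the
Dirichlet condition. -/
structure SolvesInterval (V : ℝ → ℝ) (a b : ℝ) (τm τp : ℂ → ℂ) (z : ℂ) (g φ : ℝ → ℂ) :
    Prop where
  regular : Regular (Icc a b) φ
  memLp : MemLp φ 2 (volume.restrict (Icc a b))
  eqn : ∀ᵐ x ∂(volume.restrict (Icc a b)), expr V (Icc a b) φ x - z * φ x = g x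
  left : 0 ≤ meromorphicOrderAt τm z → derivWithin φ (Icc a b) a + τm z * φ a = 0
  left_pole : meromorphicOrderAt τm z < 0 → φ a = 0
  right : 0 ≤ meromorphicOrderAt τp z → derivWithin φ (Icc a b) b - τp z * φ b = 0
  right_pole : meromorphicOrderAt τp z < 0 → φ b = 0

/-- The regular points of the interval problem: the common points `z` of regular type such that
for every `g ∈ L²(a, b)` there is one and only one solution. -/
def regularPoints (V : ℝ → ℝ) (a b : ℝ) (τm τp : ℂ → ℂ) : Set ℂ :=
  {z | z ∈ commonRegularType V a b ∧
    ∀ g : ℝ → ℂ, MemLp g 2 (volume.restrict (Icc a b)) →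
      ∃ φ, SolvesInterval V a b τm τp z g φ ∧
        ∀ χ, SolvesInterval V a b τm τp z g χ → EqOn χ φ (Icc a b)}

/-- The Herglotz-Nevanlinna pair `τ₋`, `τ₊` defines transparent boundary conditions for
`-d²/dx² + V` on the interval with end points `a` and `b`. -/
structure Transparent (V : ℝ → ℝ) (a b : ℝ) (τm τp : ℂ → ℂ) : Prop where
  herglotz_left : HerglotzOn (commonRegularType V a b) τm
  herglotz_right : HerglotzOn (commonRegularType V a b) τp
  restrict : ∀ z ∈ commonRegularType V a b, ∀ g : ℝ → ℂ,
    MemLp g 2 (volume.restrict (Icc a b)) → ∀ ψ : ℝ → ℂ,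
      SolvesLine V z ((Icc a b).indicator g) ψ → SolvesInterval V a b τm τp z g ψ
  extend : ∀ z ∈ commonRegularType V a b, ∀ g : ℝ → ℂ,
    MemLp g 2 (volume.restrict (Icc a b)) → ∀ φ : ℝ → ℂ,
      SolvesInterval V a b τm τp z g φ →
        ∃ ψ : ℝ → ℂ, SolvesLine V z ((Icc a b).indicator g) ψ ∧ EqOn ψ φ (Icc a b)
  regular_eq : regularPoints V a b τm τp = resolventH V

end TransparentBC

/-! For `z` of regular type on a half-line, the square integrable solutions of `-f'' + V f = z f`
form a one-dimensional space. Their Cauchy data at the end point therefore fill a line in `ℂ²`. The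
Weyl quotient `σ f'(a) / f(a)` is the slope of this line, and a pole means that the line is the
Dirichlet one. So the boundary conditions with `m₋`, `m₊` say precisely that a solution continued
beyond the interval with zero right-hand side is square integrable at both ends
(`boundaryCondition_iff`). Restriction and extension follow at once. One-dimensionality rests on
operator theory. The adjoint of the preminimal operator is the maximal one (`mem_maxOp_of_adjoint`),
so `A* - z` is onto at points of regular type. Its kernel then depends analytically on `z`
(`exists_analytic_ker`) and has locally constant dimension, which carries the value 1 from `±i` to
every point of regular type. The analytic family also makes the Weyl quotient meromorphic. In the
limit point case zero Cauchy data characterise the minimal operator (`mem_minOp`), hence Green's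
formula has no term at infinity, and this yields the Herglotz property. For the resolvent set,
regularity on the interval excludes square integrable homogeneous solutions on the line. The two
Weyl solutions are then independent and correct half-line solutions into one on the line. For
uniqueness, let `z` be non-real. Some `g` admits a solution with data `(1, -τ₋(z))` and `(1, τ₊(z))`
at the end points. Its extension is square integrable, so the same data satisfy the Weyl conditions,
and the coefficients agree at `z`. Meromorphic normal forms propagate the equality to the real
points. Throughout, regular functions on an interval are replaced by solutions on the whole line in
integrated form (`IsSol`), which removes one-sided derivatives from the calculations. -/

open scoped ContDiff

namespace TransparentBC

section

/-! ### Absolutely continuous functions and exponential weights. -/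

section Calculus

variable {E : Type*} [NormedAddCommGroup E]

theorem _root_.MeasureTheory.LocallyIntegrable.intervalIntegrable' {f : ℝ → E}
    (hf : LocallyIntegrable f volume) (x y : ℝ) : IntervalIntegrable f volume x y :=
  (hf.integrableOn_isCompact isCompact_uIcc).intervalIntegrable

variable [NormedSpace ℝ E]

/-- The defining sums for `f` are at most `C` times those for `g`. This handles primitives, compared
with the primitive of the norm, and Lipschitz images such as exponentials. -/
theorem _root_.AbsolutelyContinuousOnInterval.of_dist_le {X Y : Type*} [PseudoMetricSpace X]
    [PseudoMetricSpace Y] {f : ℝ → X} {g : ℝ → Y} {a b C : ℝ}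
    (hg : AbsolutelyContinuousOnInterval g a b)
    (h : ∀ x ∈ uIcc a b, ∀ y ∈ uIcc a b, dist (f x) (f y) ≤ C * dist (g x) (g y)) :
    AbsolutelyContinuousOnInterval f a b := by
  unfold AbsolutelyContinuousOnInterval at hg ⊢
  refine squeeze_zero' (.of_forall fun _ => Finset.sum_nonneg fun _ _ => dist_nonneg) ?_
    (by simpa using Filter.Tendsto.const_mul C hg)
  rw [eventually_inf_principal]
  filter_upwards with E hE
  rw [Finset.mul_sum]
  refine Finset.sum_le_sum fun i hi => ?_
  have := hE.1 i hi
  exact h _ this.1 _ this.2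

theorem dist_integral_le_dist_integral_norm {f : ℝ → E} (hf : LocallyIntegrable f volume)
    (c x y : ℝ) :
    dist (∫ t in c..x, f t) (∫ t in c..y, f t) ≤
      dist (∫ t in c..x, ‖f t‖) (∫ t in c..y, ‖f t‖) := by
  have h := fun x y => hf.intervalIntegrable' x y
  rw [dist_eq_norm, dist_eq_norm, intervalIntegral.integral_interval_sub_left (h _ _) (h _ _),
    intervalIntegral.integral_interval_sub_left (h _ _).norm (h _ _).norm]
  exact intervalIntegral.norm_integral_le_abs_integral_norm

theorem absolutelyContinuousOnInterval_integral {f : ℝ → E} (hf : LocallyIntegrable f volume)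
    (c a b : ℝ) : AbsolutelyContinuousOnInterval (fun x => ∫ t in c..x, f t) a b := by
  have h1 : AbsolutelyContinuousOnInterval (fun x => ∫ t in a..x, ‖f t‖) a b :=
    (hf.intervalIntegrable' a b).norm.absolutelyContinuousOnInterval_intervalIntegral (by simp)
  refine h1.of_dist_le (C := 1) fun x _ y _ => ?_
  have h := fun x y => hf.intervalIntegrable' x y
  rw [one_mul, ← intervalIntegral.integral_add_adjacent_intervals (h c a) (h a x),
    ← intervalIntegral.integral_add_adjacent_intervals (h c a) (h a y), dist_add_left]
  exact dist_integral_le_dist_integral_norm hf a x y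

/-- The fundamental theorem of calculus for absolutely continuous functions. -/
theorem _root_.AbsolutelyContinuousOnInterval.integral_eq_sub_of_ae [CompleteSpace E] {f g : ℝ → E}
    {a b : ℝ} (hf : AbsolutelyContinuousOnInterval f a b) (hg : LocallyIntegrable g volume)
    (h : ∀ᵐ x, x ∈ uIcc a b → HasDerivAt f (g x) x) :
    ∫ x in a..b, g x = f b - f a := by
  -- The difference of `f` and the primitive of `g` is absolutely continuous with derivative zero
  -- almost everywhere, hence constant.
  obtain ⟨C, hC⟩ := (hf.sub (absolutelyContinuousOnInterval_integral hg a a b)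
    ).const_of_ae_hasDerivAt_zero (by
      filter_upwards [h, LocallyIntegrable.ae_hasDerivAt_integral hg] with x h1 h2 hx
      simpa using (h1 hx).sub (h2 a))
  have h1 := hC a left_mem_uIcc
  have h2 := hC b right_mem_uIcc
  simp only [Pi.sub_apply, intervalIntegral.integral_same, sub_zero] at h1 h2
  rw [h1, ← h2]; abel

/-- An antiderivative of the integrand is `exp (s P) / s`, where `P` is the primitive of `k`. As `P`
is merely absolutely continuous, the fundamental theorem applies because the exponential is
Lipschitz on the bounded range of `P`. -/
theorem integral_mul_exp_primitive {k : ℝ → ℝ} (hk : LocallyIntegrable k volume) {s : ℝ}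
    (hs : s ≠ 0) (a x : ℝ) :
    ∫ t in a..x, k t * Real.exp (s * ∫ u in a..t, k u) =
      (Real.exp (s * ∫ u in a..x, k u) - 1) / s := by
  set P : ℝ → ℝ := fun t => ∫ u in a..t, k u with hP
  have hPc : Continuous P := intervalIntegral.continuous_primitive hk.intervalIntegrable' a
  have hPac : AbsolutelyContinuousOnInterval P a x := absolutelyContinuousOnInterval_integral hk _ _ _
  obtain ⟨R, hR⟩ := hPac.exists_bound
  have hlip : ∃ C, LipschitzOnWith C (fun y => Real.exp (s * y) / s) (Metric.closedBall 0 R) :=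
    ContDiffOn.exists_lipschitzOnWith (n := 1) (by fun_prop) one_ne_zero
      (convex_closedBall _ _) (isCompact_closedBall _ _)
  obtain ⟨C, hC⟩ := hlip
  have hac : AbsolutelyContinuousOnInterval (fun t => Real.exp (s * P t) / s) a x :=
    hPac.of_dist_le (C := C) fun y hy z hz =>
      hC.dist_le_mul _ (by simpa using hR y hy) _ (by simpa using hR z hz)
  have hint : LocallyIntegrable (fun t => k t * Real.exp (s * P t)) volume :=
    hk.mul_continuous (by fun_prop)
  rw [hac.integral_eq_sub_of_ae hint]
  · simp only [hP, intervalIntegral.integral_same, mul_zero, Real.exp_zero]; ring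
  · filter_upwards [LocallyIntegrable.ae_hasDerivAt_integral hk] with y hy _
    have := (((hy a).const_mul s).exp).div_const s
    convert! this using 1
    field_simp
    ring

/-- Domination by an exponential weight is reproduced, with a factor `1 / 2`, by integration. -/
theorem abs_integral_mul_weight_le {k : ℝ → ℝ} (hk : LocallyIntegrable k volume)
    (hk0 : ∀ t, 0 ≤ k t) (a x : ℝ) :
    |∫ t in a..x, k t * Real.exp (2 * |∫ u in a..t, k u|)| ≤
      (Real.exp (2 * |∫ u in a..x, k u|) - 1) / 2 := by
  rcases le_total a x with hax | hax
  · have h1 : ∀ t ∈ uIcc a x, |∫ u in a..t, k u| = ∫ u in a..t, k u := fun t ht => by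
      rw [uIcc_of_le hax] at ht
      exact abs_of_nonneg (intervalIntegral.integral_nonneg ht.1 fun u _ => hk0 u)
    rw [intervalIntegral.integral_congr (g := fun t => k t * Real.exp (2 * ∫ u in a..t, k u))
      (fun t ht => by simp only [h1 t ht]), integral_mul_exp_primitive hk two_ne_zero,
      h1 x right_mem_uIcc, abs_of_nonneg]
    have : 0 ≤ ∫ u in a..x, k u := intervalIntegral.integral_nonneg hax fun u _ => hk0 u
    have := Real.one_le_exp (x := 2 * ∫ u in a..x, k u) (by positivity)
    linarith
  · have h0 : ∀ t ≤ a, ∫ u in a..t, k u ≤ 0 := fun t ht => by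
      rw [intervalIntegral.integral_symm]
      simpa using intervalIntegral.integral_nonneg ht fun u _ => hk0 u
    -- To the left of `a` the primitive is nonpositive, so the same formula is used with `s = -2`.
    have h1 : ∀ t ∈ uIcc a x, 2 * |∫ u in a..t, k u| = (-2) * ∫ u in a..t, k u := fun t ht => by
      rw [uIcc_of_ge hax] at ht
      rw [abs_of_nonpos (h0 t ht.2)]; ring
    rw [intervalIntegral.integral_congr (g := fun t => k t * Real.exp ((-2) * ∫ u in a..t, k u))
      (fun t ht => by simp only [h1 t ht]), integral_mul_exp_primitive hk (by norm_num),
      h1 x right_mem_uIcc, abs_of_nonpos]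
    · linarith
    · have := Real.one_le_exp (x := (-2) * ∫ u in a..x, k u) (by nlinarith [h0 x hax])
      linarith

end Calculus

end

/-! ### Existence and uniqueness for the initial value problem. -/

section

/-- Here `S` plays the role of a supremum norm weighted by `exp (2 |∫ k|)`. The gain of `1 / 2`
drives both the uniqueness argument and the contraction in the existence proof. -/
theorem norm_integral_le_weight {E : Type*} [NormedAddCommGroup E] [NormedSpace ℝ E]
    {k : ℝ → ℝ} (hk : LocallyIntegrable k volume) (hk0 : ∀ t, 0 ≤ k t) {f : ℝ → E} {S : ℝ}
    (hS : 0 ≤ S) {a x : ℝ}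
    (hf : ∀ t ∈ uIcc a x, ‖f t‖ ≤ k t * Real.exp (2 * |∫ u in a..t, k u|) * S) :
    ‖∫ t in a..x, f t‖ ≤ Real.exp (2 * |∫ u in a..x, k u|) / 2 * S := by
  have hc : Continuous fun t => ∫ u in a..t, k u :=
    intervalIntegral.continuous_primitive hk.intervalIntegrable' a
  have hint : LocallyIntegrable (fun t => k t * Real.exp (2 * |∫ u in a..t, k u|)) volume :=
    hk.mul_continuous (by fun_prop)
  calc ‖∫ t in a..x, f t‖
      ≤ |∫ t in a..x, k t * Real.exp (2 * |∫ u in a..t, k u|) * S| :=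
        intervalIntegral.norm_integral_le_abs_of_norm_le
          ((ae_restrict_iff' measurableSet_uIoc).2 (.of_forall fun t ht => hf t (uIoc_subset_uIcc ht)))
          ((hint.intervalIntegrable' a x).mul_const S)
    _ = |∫ t in a..x, k t * Real.exp (2 * |∫ u in a..t, k u|)| * S := by
        rw [intervalIntegral.integral_mul_const, abs_mul, abs_of_nonneg hS]
    _ ≤ _ := by
        have := abs_integral_mul_weight_le hk hk0 a x
        gcongr
        linarith

/-- `F` is a solution of `-F'' + q F = h` on the real line, with derivative `G`. -/
structure IsSol (q h F G : ℝ → ℂ) : Prop where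
  pot : LocallyIntegrable q volume
  rhs : LocallyIntegrable h volume
  hasDerivAt : ∀ x, HasDerivAt F (G x) x
  integral : ∀ x y, ∫ t in x..y, (q t * F t - h t) = G y - G x

/-- Uniqueness for the initial value problem with zero data, in integrated form. -/
theorem eq_zero_of_integral_eq {q F G : ℝ → ℂ} (hq : LocallyIntegrable q volume) {a b : ℝ}
    (hF : ContinuousOn F (uIcc a b)) (hG : ContinuousOn G (uIcc a b))
    (hFi : ∀ x ∈ uIcc a b, F x = ∫ t in a..x, G t)
    (hGi : ∀ x ∈ uIcc a b, G x = ∫ t in a..x, q t * F t) {x : ℝ} (hx : x ∈ uIcc a b) :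
    F x = 0 ∧ G x = 0 := by
  set k : ℝ → ℝ := fun t => 1 + ‖q t‖ with hkdef
  have hk0 : ∀ t, 0 ≤ k t := fun t => by positivity
  have hk : LocallyIntegrable k volume := by
    refine (locallyIntegrable_const 1).add (hq.mono hq.aestronglyMeasurable.norm ?_)
    exact .of_forall fun t => by simp
  set W : ℝ → ℝ := fun x => Real.exp (2 * |∫ u in a..x, k u|) with hW
  have hWc : Continuous W := by
    have : Continuous fun t => ∫ u in a..t, k u :=
      intervalIntegral.continuous_primitive hk.intervalIntegrable' a
    fun_prop
  have hW0 : ∀ t, 0 < W t := fun t => Real.exp_pos _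
  -- At a maximum point of the weighted norm, the integral equations bound the maximum by half of
  -- itself, so it is zero.
  obtain ⟨x₀, hx₀, hmax⟩ := isCompact_uIcc.exists_isMaxOn (s := uIcc a b) ⟨x, hx⟩
    (f := fun t => ‖(F t, G t)‖ / W t)
    ((hF.prodMk hG).norm.div hWc.continuousOn fun t _ => (hW0 t).ne')
  set S := ‖(F x₀, G x₀)‖ / W x₀ with hSdef
  have hS0 : 0 ≤ S := div_nonneg (norm_nonneg _) (hW0 _).le
  have hb : ∀ t ∈ uIcc a b, ‖(F t, G t)‖ ≤ W t * S := fun t ht => by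
    have := hmax ht
    simp only [mem_ofPred_eq] at this
    rw [mul_comm]
    exact (div_le_iff₀ (hW0 t)).1 this
  have hsub : uIcc a x₀ ⊆ uIcc a b := uIcc_subset_uIcc left_mem_uIcc hx₀
  have h1 : ‖F x₀‖ ≤ W x₀ / 2 * S := by
    rw [hFi x₀ hx₀]
    refine norm_integral_le_weight hk hk0 hS0 fun t ht => ?_
    refine (norm_snd_le (F t, G t)).trans ((hb t (hsub ht)).trans ?_)
    rw [mul_assoc]
    refine le_mul_of_one_le_left (mul_nonneg (hW0 t).le hS0) ?_
    simp [hkdef]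
  have h2 : ‖G x₀‖ ≤ W x₀ / 2 * S := by
    rw [hGi x₀ hx₀]
    refine norm_integral_le_weight hk hk0 hS0 fun t ht => ?_
    rw [norm_mul, mul_assoc]
    refine mul_le_mul (by simp [hkdef]) ((norm_fst_le (F t, G t)).trans (hb t (hsub ht)))
      (norm_nonneg _) (hk0 t)
  have h3 : S = 0 := by
    have : ‖(F x₀, G x₀)‖ ≤ W x₀ / 2 * S := by
      rw [Prod.norm_def]; exact max_le h1 h2
    have h4 : ‖(F x₀, G x₀)‖ = W x₀ * S := by rw [hSdef]; field_simp [(hW0 x₀).ne']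
    rw [h4] at this
    have := hW0 x₀
    nlinarith
  have h5 : (F x, G x) = 0 := by
    have := hb x hx
    rw [h3, mul_zero] at this
    exact norm_le_zero_iff.1 this
  exact Prod.mk_eq_zero.1 h5

/-- Picard iteration on the whole line at once: the unknown pair is written as `W • φ` with `φ`
bounded and continuous, and the weight `W` makes the integral operator a contraction with constant
`1 / 2`. -/
theorem exists_isSol {q h : ℝ → ℂ} (hq : LocallyIntegrable q volume)
    (hh : LocallyIntegrable h volume) (a : ℝ) (u v : ℂ) :
    ∃ F G, IsSol q h F G ∧ F a = u ∧ G a = v := by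
  -- The three terms dominate the equation `F' = G`, the potential and the inhomogeneity; the last
  -- is needed to keep the iterates bounded relative to the weight.
  set k : ℝ → ℝ := fun t => 1 + ‖q t‖ + ‖h t‖ with hkdef
  have hk0 : ∀ t, 0 ≤ k t := fun t => by positivity
  have hk : LocallyIntegrable k volume := by
    refine ((locallyIntegrable_const 1).add (hq.mono hq.aestronglyMeasurable.norm ?_)).add
      (hh.mono hh.aestronglyMeasurable.norm ?_)
    all_goals exact .of_forall fun t => by simp
  set W : ℝ → ℝ := fun x => Real.exp (2 * |∫ u in a..x, k u|) with hW
  have hWc : Continuous W := by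
    have : Continuous fun t => ∫ u in a..t, k u :=
      intervalIntegral.continuous_primitive hk.intervalIntegrable' a
    fun_prop
  have hW0 : ∀ t, 0 < W t := fun t => Real.exp_pos _
  have hW1 : ∀ t, 1 ≤ W t := fun t => Real.one_le_exp (by positivity)
  have i1 : ∀ φ : BoundedContinuousFunction ℝ (ℂ × ℂ),
      LocallyIntegrable (fun t => (W t : ℂ) * (φ t).2) volume := fun φ =>
    Continuous.locallyIntegrable (by fun_prop)
  have i2 : ∀ φ : BoundedContinuousFunction ℝ (ℂ × ℂ),
      LocallyIntegrable (fun t => q t * ((W t : ℂ) * (φ t).1) - h t) volume := fun φ =>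
    (hq.mul_continuous (by fun_prop)).sub hh
  have nW : ∀ t, ‖(W t : ℂ)‖ = W t := fun t => by simp [(hW0 t).le]
  set P : BoundedContinuousFunction ℝ (ℂ × ℂ) → ℝ → ℂ × ℂ := fun φ x =>
    (u + ∫ t in a..x, (W t : ℂ) * (φ t).2,
      v + ∫ t in a..x, (q t * ((W t : ℂ) * (φ t).1) - h t)) with hP
  have Pc : ∀ φ, Continuous (P φ) := fun φ =>
    (continuous_const.add
      (intervalIntegral.continuous_primitive (i1 φ).intervalIntegrable' a)).prodMk
    (continuous_const.add
      (intervalIntegral.continuous_primitive (i2 φ).intervalIntegrable' a))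
  have Pb : ∀ φ x, ‖((W x)⁻¹ : ℝ) • P φ x‖ ≤ ‖u‖ + ‖v‖ + (‖φ‖ + 1) / 2 := fun φ x => by
    rw [norm_smul, norm_inv, Real.norm_of_nonneg (hW0 x).le, inv_mul_le_iff₀ (hW0 x),
      Prod.norm_def]
    have b1 : ‖∫ t in a..x, (W t : ℂ) * (φ t).2‖ ≤ W x / 2 * (‖φ‖ + 1) := by
      refine norm_integral_le_weight hk hk0 (by positivity) fun t _ => ?_
      rw [norm_mul, nW]
      have h1 : ‖(φ t).2‖ ≤ ‖φ‖ + 1 :=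
        ((norm_snd_le _).trans (φ.norm_coe_le_norm t)).trans (by simp)
      refine mul_le_mul (le_mul_of_one_le_left (hW0 t).le ?_) h1 (norm_nonneg _)
        (mul_nonneg (hk0 t) (hW0 t).le)
      simp only [hkdef]; nlinarith [norm_nonneg (q t), norm_nonneg (h t)]
    have b2 : ‖∫ t in a..x, (q t * ((W t : ℂ) * (φ t).1) - h t)‖ ≤ W x / 2 * (‖φ‖ + 1) := by
      refine norm_integral_le_weight hk hk0 (by positivity) fun t _ => ?_
      refine (norm_sub_le _ _).trans ?_
      rw [norm_mul, norm_mul, nW]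
      have h1 : ‖(φ t).1‖ ≤ ‖φ‖ := (norm_fst_le _).trans (φ.norm_coe_le_norm t)
      have h2 : ‖q t‖ * (W t * ‖(φ t).1‖) ≤ k t * (W t * ‖φ‖) := by
        refine mul_le_mul ?_ (mul_le_mul_of_nonneg_left h1 (hW0 t).le)
          (mul_nonneg (hW0 t).le (norm_nonneg _)) (hk0 t)
        simp only [hkdef]; linarith [norm_nonneg (h t)]
      have h3 : ‖h t‖ ≤ k t * W t := by
        refine le_trans ?_ (le_mul_of_one_le_right (hk0 t) (hW1 t))
        simp only [hkdef]; linarith [norm_nonneg (q t)]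
      change _ ≤ k t * W t * (‖φ‖ + 1)
      nlinarith
    have hu : ‖u‖ ≤ W x * ‖u‖ := le_mul_of_one_le_left (norm_nonneg _) (hW1 x)
    have hv : ‖v‖ ≤ W x * ‖v‖ := le_mul_of_one_le_left (norm_nonneg _) (hW1 x)
    have hu0 : 0 ≤ W x * ‖u‖ := (norm_nonneg _).trans hu
    have hv0 : 0 ≤ W x * ‖v‖ := (norm_nonneg _).trans hv
    refine max_le ((norm_add_le _ _).trans ?_) ((norm_add_le _ _).trans ?_) <;>
    · simp only [mul_add]
      linarith
  set T : BoundedContinuousFunction ℝ (ℂ × ℂ) → BoundedContinuousFunction ℝ (ℂ × ℂ) := fun φ =>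
    BoundedContinuousFunction.ofNormedAddCommGroup (fun x => ((W x)⁻¹ : ℝ) • P φ x)
      ((hWc.inv₀ fun t => (hW0 t).ne').smul (Pc φ)) _ (Pb φ) with hT
  have hcontr : ContractingWith (1 / 2) T := by
    refine ⟨by rw [← NNReal.coe_lt_coe]; norm_num, LipschitzWith.of_dist_le_mul fun φ ψ => ?_⟩
    refine (BoundedContinuousFunction.dist_le (by positivity)).2 fun x => ?_
    change dist (((W x)⁻¹ : ℝ) • P φ x) (((W x)⁻¹ : ℝ) • P ψ x) ≤ _
    rw [dist_eq_norm, ← smul_sub, norm_smul, norm_inv, Real.norm_of_nonneg (hW0 x).le,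
      inv_mul_le_iff₀ (hW0 x)]
    have hd : ∀ t, ‖φ t - ψ t‖ ≤ dist φ ψ := fun t => by
      rw [← dist_eq_norm]; exact φ.dist_coe_le_dist t
    have e : P φ x - P ψ x = (∫ t in a..x, (W t : ℂ) * (φ t - ψ t).2,
        ∫ t in a..x, q t * ((W t : ℂ) * (φ t - ψ t).1)) := by
      simp only [hP, Prod.mk_sub_mk, add_sub_add_left_eq_sub]
      rw [← intervalIntegral.integral_sub ((i1 φ).intervalIntegrable' _ _)
          ((i1 ψ).intervalIntegrable' _ _),
        ← intervalIntegral.integral_sub ((i2 φ).intervalIntegrable' _ _)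
          ((i2 ψ).intervalIntegrable' _ _)]
      congr 2 <;> ext t <;> simp only [Prod.fst_sub, Prod.snd_sub] <;> ring
    rw [e, Prod.norm_def, show W x * (((1 / 2 : NNReal) : ℝ) * dist φ ψ) = W x / 2 * dist φ ψ by
      push_cast; ring]
    refine max_le ?_ ?_
    · refine norm_integral_le_weight hk hk0 dist_nonneg fun t _ => ?_
      rw [norm_mul, nW]
      refine mul_le_mul (le_mul_of_one_le_left (hW0 t).le ?_) ((norm_snd_le _).trans (hd t))
        (norm_nonneg _) (mul_nonneg (hk0 t) (hW0 t).le)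
      simp only [hkdef]; nlinarith [norm_nonneg (q t), norm_nonneg (h t)]
    · refine norm_integral_le_weight hk hk0 dist_nonneg fun t _ => ?_
      rw [norm_mul, norm_mul, nW, mul_assoc]
      refine mul_le_mul ?_ (mul_le_mul_of_nonneg_left ((norm_fst_le _).trans (hd t)) (hW0 t).le)
          (mul_nonneg (hW0 t).le (norm_nonneg _)) (hk0 t)
      simp only [hkdef]; linarith [norm_nonneg (h t)]
  set φ := hcontr.fixedPoint with hφ
  have hfix : ∀ x, (W x : ℝ) • φ x = P φ x := fun x => by
    have h1 : T φ = φ := hcontr.fixedPoint_isFixedPt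
    have h2 : ((W x)⁻¹ : ℝ) • P φ x = φ x := congrArg (fun f => f x) h1
    rw [← h2, smul_inv_smul₀ (hW0 x).ne']
  have e1 : ∀ x, (W x : ℂ) * (φ x).1 = u + ∫ t in a..x, (W t : ℂ) * (φ t).2 := fun x => by
    simpa [hP] using congrArg Prod.fst (hfix x)
  have e2 : ∀ x, (W x : ℂ) * (φ x).2 = v + ∫ t in a..x, (q t * ((W t : ℂ) * (φ t).1) - h t) :=
    fun x => by simpa [hP] using congrArg Prod.snd (hfix x)
  refine ⟨fun x => (W x : ℂ) * (φ x).1, fun x => (W x : ℂ) * (φ x).2, ⟨hq, hh, fun x => ?_,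
    fun x y => ?_⟩, by simp only [e1]; simp, by simp only [e2]; simp⟩
  · have hc : Continuous fun t => (W t : ℂ) * (φ t).2 := by fun_prop
    have h1 : (fun x => (W x : ℂ) * (φ x).1) = fun x => u + ∫ t in a..x, (W t : ℂ) * (φ t).2 :=
      funext e1
    rw [h1]
    exact (intervalIntegral.integral_hasDerivAt_right (hc.intervalIntegrable _ _)
      (hc.stronglyMeasurableAtFilter _ _) hc.continuousAt).const_add u
  · simp only [e2, add_sub_add_left_eq_sub]
    exact (intervalIntegral.integral_interval_sub_left ((i2 φ).intervalIntegrable' _ _)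
      ((i2 φ).intervalIntegrable' _ _)).symm

end

/-! ### Calculus of solutions on the line, and their relation to regular functions on an interval.
-/

section

theorem _root_.AbsolutelyContinuousOnInterval.integral_eq_sub_of_ae' {E : Type*}
    [NormedAddCommGroup E] [NormedSpace ℝ E] [CompleteSpace E] {f g : ℝ → E}
    {a b : ℝ} (hf : AbsolutelyContinuousOnInterval f a b) (hg : IntervalIntegrable g volume a b)
    (h : ∀ᵐ x, x ∈ uIcc a b → HasDerivAt f (g x) x) :
    ∫ x in a..b, g x = f b - f a := by
  have h1 : LocallyIntegrable ((uIcc a b).indicator g) volume := by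
    rw [intervalIntegrable_iff', ← integrable_indicator_iff measurableSet_uIcc] at hg
    exact hg.locallyIntegrable
  rw [← hf.integral_eq_sub_of_ae h1]
  · exact intervalIntegral.integral_congr fun x hx => (indicator_of_mem hx g).symm
  · filter_upwards [h] with x hx hxm
    rw [indicator_of_mem hxm]
    exact hx hxm

namespace IsSol

variable {q h h₁ h₂ F F₁ F₂ G G₁ G₂ : ℝ → ℂ}

theorem continuous (hs : IsSol q h F G) : Continuous F :=
  continuous_iff_continuousAt.2 fun x => (hs.hasDerivAt x).continuousAt

theorem locallyIntegrable (hs : IsSol q h F G) :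
    LocallyIntegrable (fun t => q t * F t - h t) volume :=
  (hs.pot.mul_continuous hs.continuous).sub hs.rhs

theorem deriv_eq (hs : IsSol q h F G) :
    G = fun x => G 0 + ∫ t in (0 : ℝ)..x, (q t * F t - h t) := by
  funext x; rw [hs.integral]; ring

theorem continuous_deriv (hs : IsSol q h F G) : Continuous G := by
  rw [hs.deriv_eq]
  exact continuous_const.add
    (intervalIntegral.continuous_primitive hs.locallyIntegrable.intervalIntegrable' 0)

theorem ac_deriv (hs : IsSol q h F G) (c d : ℝ) : AbsolutelyContinuousOnInterval G c d := by
  rw [hs.deriv_eq]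
  exact (absolutelyContinuousOnInterval_integral hs.locallyIntegrable 0 c d).of_dist_le (C := 1)
    fun x _ y _ => by simp

theorem integral_deriv (hs : IsSol q h F G) (x y : ℝ) : ∫ t in x..y, G t = F y - F x :=
  intervalIntegral.integral_eq_sub_of_hasDerivAt (fun t _ => hs.hasDerivAt t)
    (hs.continuous_deriv.intervalIntegrable _ _)

theorem ac (hs : IsSol q h F G) (c d : ℝ) : AbsolutelyContinuousOnInterval F c d := by
  have e : F = fun x => F 0 + ∫ t in (0 : ℝ)..x, G t := by
    funext x; rw [hs.integral_deriv]; ring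
  rw [e]
  exact (absolutelyContinuousOnInterval_integral hs.continuous_deriv.locallyIntegrable 0 c d
    ).of_dist_le (C := 1) fun x _ y _ => by simp

theorem ae_hasDerivAt_deriv (hs : IsSol q h F G) :
    ∀ᵐ x, HasDerivAt G (q x * F x - h x) x := by
  filter_upwards [LocallyIntegrable.ae_hasDerivAt_integral hs.locallyIntegrable] with x hx
  rw [hs.deriv_eq]
  exact (hx 0).const_add (G 0)

theorem congr_rhs (hs : IsSol q h F G) (hh : h =ᵐ[volume] h₁) : IsSol q h₁ F G :=
  ⟨hs.pot, hs.rhs.congr hh, hs.hasDerivAt, fun x y => by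
    rw [← hs.integral]
    refine intervalIntegral.integral_congr_ae ?_
    filter_upwards [hh] with t ht _
    rw [ht]⟩

theorem add (hs₁ : IsSol q h₁ F₁ G₁) (hs₂ : IsSol q h₂ F₂ G₂) :
    IsSol q (h₁ + h₂) (F₁ + F₂) (G₁ + G₂) :=
  ⟨hs₁.pot, hs₁.rhs.add hs₂.rhs, fun x => (hs₁.hasDerivAt x).add (hs₂.hasDerivAt x), fun x y => by
    simp only [Pi.add_apply]
    rw [add_sub_add_comm, ← hs₁.integral, ← hs₂.integral, ← intervalIntegral.integral_add
      (hs₁.locallyIntegrable.intervalIntegrable' _ _)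
      (hs₂.locallyIntegrable.intervalIntegrable' _ _)]
    congr 1; ext t; ring⟩

theorem const_smul (k : ℂ) (hs : IsSol q h F G) : IsSol q (k • h) (k • F) (k • G) :=
  ⟨hs.pot, hs.rhs.smul k, fun x => (hs.hasDerivAt x).const_smul k, fun x y => by
    simp only [Pi.smul_apply, smul_eq_mul]
    rw [← mul_sub, ← hs.integral, ← intervalIntegral.integral_const_mul]
    congr 1; ext t; ring⟩

theorem sub (hs₁ : IsSol q h₁ F₁ G₁) (hs₂ : IsSol q h₂ F₂ G₂) :
    IsSol q (h₁ - h₂) (F₁ - F₂) (G₁ - G₂) := by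
  have := hs₁.add (hs₂.const_smul (-1))
  simpa [sub_eq_add_neg] using this

theorem shift (z : ℂ) (hs : IsSol q h F G) :
    IsSol (fun x => q x - z) (fun x => h x - z * F x) F G :=
  ⟨hs.pot.sub (locallyIntegrable_const z),
    hs.rhs.sub (continuous_const.mul hs.continuous).locallyIntegrable, hs.hasDerivAt,
    fun x y => by rw [← hs.integral]; congr 1; ext t; ring⟩

/-- Uniqueness is local: the integral equation from `a` to a point of `K` only sees the right-hand
side between them, which lies in `K`. -/
theorem eqOn_zero (hs : IsSol q h F G) {K : Set ℝ} [hK : K.OrdConnected]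
    (hh : ∀ᵐ t, t ∈ K → h t = 0) {a : ℝ} (ha : a ∈ K) (hF : F a = 0) (hG : G a = 0) {x : ℝ}
    (hx : x ∈ K) : F x = 0 ∧ G x = 0 := by
  refine eq_zero_of_integral_eq hs.pot (a := a) (b := x) hs.continuous.continuousOn
    hs.continuous_deriv.continuousOn (fun t _ => by rw [hs.integral_deriv, hF, sub_zero])
    (fun t ht => ?_) right_mem_uIcc
  rw [← sub_zero (G t), ← hG, ← hs.integral]
  refine intervalIntegral.integral_congr_ae ?_
  filter_upwards [hh] with y hy hym
  rw [hy (hK.uIcc_subset ha hx (uIcc_subset_uIcc left_mem_uIcc ht (uIoc_subset_uIcc hym))),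
    sub_zero]

/-- Lagrange's identity. -/
theorem lagrange (hs₁ : IsSol q h₁ F₁ G₁) (hs₂ : IsSol q h₂ F₂ G₂) (x y : ℝ) :
    ∫ t in x..y, (h₁ t * F₂ t - F₁ t * h₂ t) =
      (F₁ y * G₂ y - G₁ y * F₂ y) - (F₁ x * G₂ x - G₁ x * F₂ x) := by
  have hac : AbsolutelyContinuousOnInterval (F₁ • G₂ - G₁ • F₂) x y :=
    ((hs₁.ac x y).smul (hs₂.ac_deriv x y)).sub ((hs₁.ac_deriv x y).smul (hs₂.ac x y))
  have hint : LocallyIntegrable (fun t => h₁ t * F₂ t - F₁ t * h₂ t) volume :=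
    (hs₁.rhs.mul_continuous hs₂.continuous).sub (hs₂.rhs.continuous_mul hs₁.continuous)
  rw [hac.integral_eq_sub_of_ae hint]
  · simp
  · filter_upwards [hs₁.ae_hasDerivAt_deriv, hs₂.ae_hasDerivAt_deriv] with t h1 h2 _
    convert! ((hs₁.hasDerivAt t).mul h2).sub (h1.mul (hs₂.hasDerivAt t)) using 1
    ring

theorem star (hs : IsSol q h F G) :
    IsSol (fun x => starRingEnd ℂ (q x)) (fun x => starRingEnd ℂ (h x))
      (fun x => starRingEnd ℂ (F x)) (fun x => starRingEnd ℂ (G x)) := by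
  have key : ∀ {f : ℝ → ℂ}, LocallyIntegrable f volume →
      LocallyIntegrable (fun x => starRingEnd ℂ (f x)) volume := fun hf =>
    hf.mono (Complex.continuous_conj.comp_aestronglyMeasurable hf.aestronglyMeasurable)
      (.of_forall fun t => by simp)
  refine ⟨key hs.pot, key hs.rhs, fun x => ?_, fun x y => ?_⟩
  · exact (hs.hasDerivAt x).star
  · rw [← map_sub, ← hs.integral, ← intervalIntegral.intervalIntegral_conj]
    simp

/-! Solutions on the line and regular functions on an interval -/

variable {J : Set ℝ}

theorem derivWithin_eq (hs : IsSol q h F G) (hU : UniqueDiffOn ℝ J) :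
    EqOn G (derivWithin F J) J := fun x hx =>
  ((hs.hasDerivAt x).hasDerivWithinAt.derivWithin (hU x hx)).symm

theorem regular (hs : IsSol q h F G) (hU : UniqueDiffOn ℝ J) : Regular J F :=
  ⟨fun x _ => (hs.hasDerivAt x).differentiableAt.differentiableWithinAt,
    fun c d _ _ => hs.ac c d, LocAC.congr (fun c d _ _ => hs.ac_deriv c d) (hs.derivWithin_eq hU)⟩

theorem expr_ae {V : ℝ → ℝ} (hs : IsSol (fun x => (V x : ℂ)) h F G) (hU : UniqueDiffOn ℝ J)
    (hJ : MeasurableSet J) : expr V J F =ᵐ[volume.restrict J] h := by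
  filter_upwards [ae_restrict_of_ae hs.ae_hasDerivAt_deriv, ae_restrict_mem hJ] with x hx hxJ
  rw [expr, derivWithin_congr (hs.derivWithin_eq hU).symm ((hs.derivWithin_eq hU).symm hxJ),
    hx.hasDerivWithinAt.derivWithin (hU x hxJ)]
  ring

end IsSol

/-- A regular function on an interval is the restriction of a solution on the line. -/
theorem Regular.exists_isSol {V : ℝ → ℝ} (hV : LocallyIntegrable V volume) {J : Set ℝ}
    [hJ : J.OrdConnected] {f h : ℝ → ℂ} (hf : Regular J f)
    (hh : LocallyIntegrable h volume) (he : expr V J f =ᵐ[volume.restrict J] h) {a : ℝ}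
    (ha : a ∈ J) :
    ∃ F G, IsSol (fun x => (V x : ℂ)) h F G ∧ EqOn F f J ∧ EqOn G (derivWithin f J) J := by
  have hV' : LocallyIntegrable (fun x => (V x : ℂ)) volume :=
    hV.mono (Complex.continuous_ofReal.comp_aestronglyMeasurable hV.aestronglyMeasurable)
      (.of_forall fun t => by simp)
  obtain ⟨F, G, hs, hFa, hGa⟩ := TransparentBC.exists_isSol hV' hh a (f a) (derivWithin f J a)
  have hAC : ∀ {g : ℝ → ℂ}, LocAC J g → ∀ {t}, t ∈ J → AbsolutelyContinuousOnInterval g a t := by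
    intro g hg t ht
    rcases le_total a t with h | h
    · exact hg a t h (hJ.out ha ht)
    · exact (hg t a h (hJ.out ht ha)).symm
  have key : ∀ x ∈ J, F x - f x = 0 ∧ G x - derivWithin f J x = 0 := by
    intro x hx
    have hsub : ∀ {t}, t ∈ uIcc a x → t ∈ J := fun ht => hJ.uIcc_subset ha hx ht
    have hA1 : ∀ {t}, t ∈ uIcc a x → AbsolutelyContinuousOnInterval (F - f) a t := fun ht =>
      (hs.ac a _).sub (hAC hf.locAC (hsub ht))
    have hA2 : ∀ {t}, t ∈ uIcc a x →
        AbsolutelyContinuousOnInterval (G - derivWithin f J) a t := fun ht =>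
      (hs.ac_deriv a _).sub (hAC hf.locAC_deriv (hsub ht))
    -- Away from the two end points `J` is a neighbourhood, so derivatives within `J` are true
    -- derivatives almost everywhere.
    have hnhds : ∀ t ∈ uIcc a x, ∀ᵐ y, y ∈ uIcc a t → J ∈ 𝓝 y := fun t ht => by
      filter_upwards [compl_mem_ae_iff.2 (measure_singleton a),
        compl_mem_ae_iff.2 (measure_singleton t)] with y h1 h2 hy
      have hI : Icc (min a t) (max a t) ⊆ J := hJ.uIcc_subset ha (hsub ht)
      refine mem_of_superset (Icc_mem_nhds ?_ ?_) hI
      · refine lt_of_le_of_ne hy.1 fun h => ?_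
        rcases min_choice a t with h' | h' <;> rw [h'] at h
        exacts [h1 h.symm, h2 h.symm]
      · refine lt_of_le_of_ne hy.2 fun h => ?_
        rcases max_choice a t with h' | h' <;> rw [h'] at h
        exacts [h1 h, h2 h]
    refine eq_zero_of_integral_eq hV' (F := F - f) (G := G - derivWithin f J)
      (hA1 right_mem_uIcc).continuousOn (hA2 right_mem_uIcc).continuousOn
      (fun t ht => ?_) (fun t ht => ?_) right_mem_uIcc
    · rw [(hA1 ht).integral_eq_sub_of_ae' (hA2 ht).continuousOn.intervalIntegrable]
      · simp [hFa]
      · filter_upwards [hnhds t ht] with y hy hyt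
        have h1 := (hf.differentiableOn y (mem_of_mem_nhds (hy hyt))).hasDerivWithinAt
        exact (hs.hasDerivAt y).sub (h1.hasDerivAt (hy hyt))
    · rw [(hA2 ht).integral_eq_sub_of_ae'
        ((hV'.intervalIntegrable' _ _).mul_continuousOn (hA1 ht).continuousOn)]
      · simp [hGa]
      · filter_upwards [hnhds t ht, hs.ae_hasDerivAt_deriv,
          (ae_restrict_iff' hJ.measurableSet).1 hf.locAC_deriv.ae_differentiable,
          (ae_restrict_iff' hJ.measurableSet).1 he] with y hy h1 h2 h3 hyt
        have hyJ := mem_of_mem_nhds (hy hyt)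
        have h4 := h1.sub ((h2 hyJ).hasDerivWithinAt.hasDerivAt (hy hyt))
        convert! h4 using 1
        have h5 := h3 hyJ
        rw [expr] at h5
        simp only [Pi.sub_apply]
        rw [← h5]; ring
  exact ⟨F, G, hs, fun x hx => sub_eq_zero.1 (key x hx).1, fun x hx => sub_eq_zero.1 (key x hx).2⟩

end

/-! ### The maximal operator as the adjoint of the preminimal one. -/

section

/-- The potential as a complex-valued function. -/
abbrev cpot (V : ℝ → ℝ) : ℝ → ℂ := fun x => (V x : ℂ)

theorem locallyIntegrable_cpot {V : ℝ → ℝ} (hV : LocallyIntegrable V volume) :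
    LocallyIntegrable (cpot V) volume :=
  hV.mono (Complex.continuous_ofReal.comp_aestronglyMeasurable hV.aestronglyMeasurable)
    (.of_forall fun t => by simp)

namespace IsSol

variable {q h F G : ℝ → ℂ}

theorem deriv_eq_zero (hs : IsSol q h F G) {U : Set ℝ} (hU : IsOpen U) (hF : ∀ x ∈ U, F x = 0) :
    ∀ x ∈ U, G x = 0 := fun x hx => by
  have h1 : F =ᶠ[𝓝 x] fun _ => 0 := (eventually_of_mem (hU.mem_nhds hx) hF)
  exact (hs.hasDerivAt x).unique ((hasDerivAt_const x (0 : ℂ)).congr_of_eventuallyEq h1)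

theorem rhs_eq_zero (hs : IsSol q h F G) {U : Set ℝ} (hU : IsOpen U) (hF : ∀ x ∈ U, F x = 0) :
    ∀ᵐ x, x ∈ U → h x = 0 := by
  filter_upwards [hs.ae_hasDerivAt_deriv] with x hx hxU
  have h1 : G =ᶠ[𝓝 x] fun _ => 0 :=
    (eventually_of_mem (hU.mem_nhds hxU) (hs.deriv_eq_zero hU hF))
  have := hx.unique ((hasDerivAt_const x (0 : ℂ)).congr_of_eventuallyEq h1)
  rwa [hF x hxU, mul_zero, zero_sub, neg_eq_zero] at this

theorem rhs_eq_zero_of_continuous (hs : IsSol q h F G) (hc : Continuous h) {U : Set ℝ}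
    (hU : IsOpen U) (hF : ∀ x ∈ U, F x = 0) : ∀ x ∈ U, h x = 0 :=
  Measure.eqOn_open_of_ae_eq (μ := volume) (g := fun _ => 0)
    ((ae_restrict_iff' hU.measurableSet).2 (hs.rhs_eq_zero hU hF)) hU hc.continuousOn
    continuousOn_const

/-- The product rule. For homogeneous solutions the new right-hand side is continuous and lives only
where `φ` varies, which makes cut-offs usable as test functions. -/
theorem mul_smooth (hs : IsSol q h F G) {φ : ℝ → ℝ} (hφ : ContDiff ℝ ∞ φ) :
    IsSol q (fun x => φ x * h x - 2 * (deriv φ x : ℝ) * G x - (deriv (deriv φ) x : ℝ) * F x)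
      (fun x => φ x * F x) (fun x => φ x * G x + (deriv φ x : ℝ) * F x) := by
  have hd1 : ContDiff ℝ ∞ (deriv φ) := hφ.deriv'
  have hd2 : ContDiff ℝ ∞ (deriv (deriv φ)) := hd1.deriv'
  have hder : ∀ {ψ : ℝ → ℝ}, ContDiff ℝ ∞ ψ → ∀ x, HasDerivAt (fun y => (ψ y : ℂ))
      (deriv ψ x : ℝ) x := fun hψ x =>
    ((hψ.differentiable (by simp)) x).hasDerivAt.ofReal_comp
  have hac : ∀ {ψ : ℝ → ℝ}, ContDiff ℝ ∞ ψ → ∀ x y,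
      AbsolutelyContinuousOnInterval (fun y => (ψ y : ℂ)) x y := fun hψ x y =>
    ContDiffOn.absolutelyContinuousOnInterval
      ((Complex.ofRealCLM.contDiff.comp (hψ.of_le (by simp))).contDiffOn)
  have c0 : Continuous fun x => ((φ x : ℝ) : ℂ) := Complex.continuous_ofReal.comp hφ.continuous
  have c1 : Continuous fun x => ((deriv φ x : ℝ) : ℂ) := Complex.continuous_ofReal.comp hd1.continuous
  have c2 : Continuous fun x => ((deriv (deriv φ) x : ℝ) : ℂ) :=
    Complex.continuous_ofReal.comp hd2.continuous
  have hF := hs.continuous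
  have hG := hs.continuous_deriv
  have hrhs : LocallyIntegrable (fun x => φ x * h x - 2 * (deriv φ x : ℝ) * G x
      - (deriv (deriv φ) x : ℝ) * F x) volume :=
    ((hs.rhs.continuous_mul c0).sub (Continuous.locallyIntegrable (by fun_prop))).sub
      (Continuous.locallyIntegrable (by fun_prop))
  refine ⟨hs.pot, hrhs, fun x => ?_, fun x y => ?_⟩
  · convert! (hder hφ x).mul (hs.hasDerivAt x) using 1
    ring
  · have hA : AbsolutelyContinuousOnInterval
        ((fun x => ((φ x : ℝ) : ℂ)) • G + (fun x => ((deriv φ x : ℝ) : ℂ)) • F) x y :=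
      (AbsolutelyContinuousOnInterval.smul (f := fun x => ((φ x : ℝ) : ℂ)) (hac hφ x y)
        (hs.ac_deriv x y)).add
      (AbsolutelyContinuousOnInterval.smul (f := fun x => ((deriv φ x : ℝ) : ℂ)) (hac hd1 x y)
        (hs.ac x y))
    refine (hA.integral_eq_sub_of_ae (g := fun t => q t * (φ t * F t) - (φ t * h t
      - 2 * (deriv φ t : ℝ) * G t - (deriv (deriv φ) t : ℝ) * F t))
      ((hs.pot.mul_continuous (c0.mul hF)).sub hrhs) ?_).trans ?_
    · filter_upwards [hs.ae_hasDerivAt_deriv] with t ht _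
      convert! ((hder hφ t).mul ht).add ((hder hd1 t).mul (hs.hasDerivAt t)) using 1
      ring
    · simp

end IsSol

/-! ### The maximal operator and solutions on the line -/

section MaxOp

variable {V : ℝ → ℝ} {J : Set ℝ} [hJ : J.OrdConnected]

theorem uniqueDiffOn_of_interior (hne : (interior J).Nonempty) : UniqueDiffOn ℝ J :=
  uniqueDiffOn_convex hJ.convex hne

theorem ae_mem_interior : ∀ᵐ x, x ∈ J → x ∈ interior J := by
  have h := interior_ae_eq_of_null_frontier (hJ.convex.addHaar_frontier (volume : Measure ℝ))
  filter_upwards [h.mem_iff] with x hx hxJ using hx.2 hxJ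

theorem memLp_indicator (f : L2 J) : MemLp (J.indicator f) 2 volume :=
  (memLp_indicator_iff_restrict hJ.measurableSet).2 (Lp.memLp f)

theorem locallyIntegrable_indicator (f : L2 J) : LocallyIntegrable (J.indicator f) volume :=
  (memLp_indicator f).locallyIntegrable (by norm_num)

/-- The pair `p` of functions on `J` is represented by the function `F` on the line, which has the
derivative `G`. -/
def IsRep (V : ℝ → ℝ) (J : Set ℝ) (p : L2 J × L2 J) (F G : ℝ → ℂ) : Prop :=
  ∃ h, IsSol (cpot V) h F G ∧ p.1 =ᵐ[volume.restrict J] F ∧ p.2 =ᵐ[volume.restrict J] h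

theorem mem_maxOp_of_isSol (hne : (interior J).Nonempty) {p : L2 J × L2 J} {h F G : ℝ → ℂ}
    (hs : IsSol (cpot V) h F G) (h1 : p.1 =ᵐ[volume.restrict J] F)
    (h2 : p.2 =ᵐ[volume.restrict J] h) : p ∈ maxOp V J :=
  ⟨F, hs.regular (uniqueDiffOn_of_interior hne), h1,
    h2.trans (hs.expr_ae (uniqueDiffOn_of_interior hne) hJ.measurableSet).symm⟩

theorem IsRep.mem_maxOp (hne : (interior J).Nonempty) {p : L2 J × L2 J} {F G : ℝ → ℂ}
    (hp : IsRep V J p F G) : p ∈ maxOp V J :=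
  let ⟨_, hs, h1, h2⟩ := hp
  mem_maxOp_of_isSol hne hs h1 h2

theorem indicator_ae_restrict {f g : ℝ → ℂ} (h : f =ᵐ[volume.restrict J] g) :
    J.indicator f =ᵐ[volume.restrict J] g :=
  (indicator_ae_eq_restrict hJ.measurableSet).trans h

theorem isRep_of_isSol_indicator {p : L2 J × L2 J} {F G : ℝ → ℂ}
    (hs : IsSol (cpot V) (J.indicator p.2) F G) (h1 : p.1 =ᵐ[volume.restrict J] F) :
    IsRep V J p F G :=
  ⟨_, hs, h1, (indicator_ae_restrict .rfl).symm⟩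

theorem exists_isRep (hV : LocallyIntegrable V volume) (hne : (interior J).Nonempty)
    {p : L2 J × L2 J} (hp : p ∈ maxOp V J) : ∃ F G, IsRep V J p F G := by
  obtain ⟨f, hf, h1, h2⟩ := hp
  obtain ⟨a, ha⟩ := hne
  obtain ⟨F, G, hs, hF, -⟩ := hf.exists_isSol hV (locallyIntegrable_indicator p.2)
    (indicator_ae_restrict h2).symm (interior_subset ha)
  refine ⟨F, G, isRep_of_isSol_indicator hs (h1.trans ?_)⟩
  filter_upwards [ae_restrict_mem hJ.measurableSet] with x hx using (hF hx).symm

theorem exists_Icc_of_isCompact {U K : Set ℝ} [hUo : U.OrdConnected] (hU : IsOpen U)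
    (hne : U.Nonempty) (hK : IsCompact K) (hKU : K ⊆ U) :
    ∃ l r, l < r ∧ Icc l r ⊆ U ∧ K ⊆ Ioo l r := by
  obtain ⟨x₀, hx₀⟩ := hne
  -- Adjoining a point covers the case of empty `K`.
  have hc : IsCompact (insert x₀ K) := hK.insert x₀
  have hn : (insert x₀ K).Nonempty := insert_nonempty _ _
  have hsub : insert x₀ K ⊆ U := insert_subset hx₀ hKU
  obtain ⟨m, hm, hml⟩ := hc.exists_isLeast hn
  obtain ⟨M, hM, hMg⟩ := hc.exists_isGreatest hn
  obtain ⟨ε, hε, hεU⟩ := Metric.isOpen_iff.1 hU m (hsub hm)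
  obtain ⟨δ, hδ, hδU⟩ := Metric.isOpen_iff.1 hU M (hsub hM)
  have h1 : m - ε / 2 ∈ U := hεU (by simp [abs_of_pos hε, hε])
  have h2 : M + δ / 2 ∈ U := hδU (by simp [abs_of_pos hδ, hδ])
  have hmM : m ≤ M := hml hM
  refine ⟨m - ε / 2, M + δ / 2, by linarith, hUo.out h1 h2, fun x hx => ⟨?_, ?_⟩⟩
  · have := hml (mem_insert_of_mem _ hx); linarith
  · have := hMg (mem_insert_of_mem _ hx); linarith

theorem IsSol.conj {h F G : ℝ → ℂ} (hs : IsSol (cpot V) h F G) :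
    IsSol (cpot V) (fun x => starRingEnd ℂ (h x)) (fun x => starRingEnd ℂ (F x))
      (fun x => starRingEnd ℂ (G x)) := by
  simpa [cpot] using hs.star

/-- Green's formula, when one of the functions vanishes outside a compact interval. -/
theorem IsRep.inner_sub_inner_eq {p q : L2 J × L2 J} {F G W W' : ℝ → ℂ}
    (hp : IsRep V J p F G) (hq : IsRep V J q W W')
    {l r : ℝ} (hlr : l ≤ r) (hlJ : Icc l r ⊆ J) (hW : ∀ x ∈ J, x ∉ Icc l r → W x = 0) :
    inner ℂ q.2 p.1 - inner ℂ q.1 p.2 =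
      (starRingEnd ℂ (W r) * G r - starRingEnd ℂ (W' r) * F r) -
        (starRingEnd ℂ (W l) * G l - starRingEnd ℂ (W' l) * F l) := by
  obtain ⟨h, hp, hp1, hp2⟩ := hp
  obtain ⟨k, hq, hq1, hq2⟩ := hq
  rw [← hq.conj.lagrange hp l r, intervalIntegral.integral_of_le hlr, ← integral_Icc_eq_integral_Ioc,
    L2.inner_def, L2.inner_def, ← integral_sub (L2.integrable_inner _ _) (L2.integrable_inner _ _)]
  have hU : IsOpen (interior J \ Icc l r) := isOpen_interior.sdiff isClosed_Icc
  have h0 := hq.rhs_eq_zero hU fun x hx => hW x (interior_subset hx.1) hx.2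
  rw [← setIntegral_eq_of_subset_of_ae_sdiff_eq_zero hJ.measurableSet.nullMeasurableSet hlJ]
  · refine integral_congr_ae ?_
    filter_upwards [hp1, hq1, hp2, hq2] with x h1 h2 h3 h4
    rw [h1, h2, h3, h4]
    simp only [RCLike.inner_apply]
    ring
  · filter_upwards [h0, ae_mem_interior (J := J)] with x h1 h2 hx
    rw [h1 ⟨h2 hx.1, hx.2⟩, hW x hx.1 hx.2]
    simp

/-- Green's formula is applied on a compact interval containing the support strictly inside, so that
both boundary terms vanish. -/
theorem inner_eq_of_mem_preMinOp (hV : LocallyIntegrable V volume) (hne : (interior J).Nonempty)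
    {p q : L2 J × L2 J} (hp : p ∈ maxOp V J) (hq : q ∈ preMinOp V J) :
    inner ℂ q.2 p.1 = inner ℂ q.1 p.2 := by
  obtain ⟨F, G, hF⟩ := exists_isRep hV hne hp
  obtain ⟨f, ⟨hf, hfc, hfs⟩, h1, h2⟩ := hq
  obtain ⟨a, ha⟩ := id hne
  obtain ⟨W, W', hw, hWf, -⟩ := hf.exists_isSol hV (locallyIntegrable_indicator q.2)
    (indicator_ae_restrict h2).symm (interior_subset ha)
  have : (interior J).OrdConnected := hJ.interior
  obtain ⟨l, r, hlr, hJ', hK⟩ := exists_Icc_of_isCompact isOpen_interior hne hfc hfs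
  have hW0 : ∀ x ∈ interior J \ tsupport f, W x = 0 := fun x hx => by
    rw [hWf (interior_subset hx.1), image_eq_zero_of_notMem_tsupport hx.2]
  have hW1 := hw.deriv_eq_zero (isOpen_interior.sdiff (isClosed_tsupport f)) hW0
  have hl : l ∈ interior J \ tsupport f :=
    ⟨hJ' (left_mem_Icc.2 hlr.le), fun h => lt_irrefl _ (hK h).1⟩
  have hr : r ∈ interior J \ tsupport f :=
    ⟨hJ' (right_mem_Icc.2 hlr.le), fun h => lt_irrefl _ (hK h).2⟩
  rw [← sub_eq_zero, hF.inner_sub_inner_eq (isRep_of_isSol_indicator hw (h1.trans ?_)) hlr.le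
    (hJ'.trans interior_subset) fun x hx hxI => ?_, hW0 l hl, hW0 r hr, hW1 l hl, hW1 r hr]
  · simp
  · filter_upwards [ae_restrict_mem hJ.measurableSet] with x hx using (hWf hx).symm
  · rw [hWf hx]
    exact image_eq_zero_of_notMem_tsupport fun h => hxI (Ioo_subset_Icc_self (hK h))

theorem mem_preMinOp_of_isSol (hne : (interior J).Nonempty) {p : L2 J × L2 J} {h F G : ℝ → ℂ}
    (hs : IsSol (cpot V) h F G) (h1 : p.1 =ᵐ[volume.restrict J] F)
    (h2 : p.2 =ᵐ[volume.restrict J] h) {l r : ℝ} (hlJ : Icc l r ⊆ interior J)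
    (hF : ∀ x, x ∉ Icc l r → F x = 0) : p ∈ preMinOp V J := by
  have hsup : tsupport F ⊆ Icc l r :=
    closure_minimal (fun x hx => by_contra fun h => hx (hF x h)) isClosed_Icc
  exact ⟨F, ⟨hs.regular (uniqueDiffOn_of_interior hne),
    isCompact_Icc.of_isClosed_subset (isClosed_tsupport F) hsup, hsup.trans hlJ⟩, h1,
    h2.trans (hs.expr_ae (uniqueDiffOn_of_interior hne) hJ.measurableSet).symm⟩

/-- Testing against a compactly supported function. -/
theorem integral_mul_eq_zero_of_adjoint (hne : (interior J).Nonempty) {p : L2 J × L2 J}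
    (hadj : ∀ q ∈ preMinOp V J, inner ℂ q.2 p.1 = inner ℂ q.1 p.2) {F G : ℝ → ℂ}
    (hp : IsSol (cpot V) (J.indicator p.2) F G) {h W W' : ℝ → ℂ}
    (hw : IsSol (cpot V) h W W') (hc : Continuous h) {l r : ℝ} (hlr : l ≤ r)
    (hlJ : Icc l r ⊆ interior J) (hW : ∀ x, x ∉ Icc l r → W x = 0) :
    ∫ x, h x * (J.indicator p.1 x - F x) = 0 := by
  have hU : IsOpen (Icc l r)ᶜ := isClosed_Icc.isOpen_compl
  have hh0 : ∀ x, x ∉ Icc l r → h x = 0 := hw.rhs_eq_zero_of_continuous hc hU hW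
  have hW0 : ∀ x, x ∉ Icc l r → W' x = 0 := hw.deriv_eq_zero hU hW
  have hhc : HasCompactSupport h := .intro isCompact_Icc hh0
  have hWc : HasCompactSupport W := .intro isCompact_Icc hW
  have hend : ∀ {f : ℝ → ℂ}, Continuous f → (∀ x, x ∉ Icc l r → f x = 0) → f l = 0 ∧ f r = 0 := by
    intro f hf hf0
    have e1 : ∀ x ∈ Iio l, f x = 0 := fun x hx => hf0 x fun h => not_lt.2 h.1 hx
    have e2 : ∀ x ∈ Ioi r, f x = 0 := fun x hx => hf0 x fun h => not_lt.2 h.2 hx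
    have c : IsClosed {x | f x = 0} := isClosed_eq hf continuous_const
    constructor
    · exact (closure_minimal e1 c) (by simp)
    · exact (closure_minimal e2 c) (by simp)
  have mh : MemLp (fun x => starRingEnd ℂ (h x)) 2 (volume.restrict J) :=
    (hc.memLp_of_hasCompactSupport hhc).star.restrict J
  have mW : MemLp (fun x => starRingEnd ℂ (W x)) 2 (volume.restrict J) :=
    (hw.continuous.memLp_of_hasCompactSupport hWc).star.restrict J
  have key := hadj (mW.toLp, mh.toLp) (mem_preMinOp_of_isSol hne hw.conj mW.coeFn_toLp
    mh.coeFn_toLp hlJ fun x hx => by simp [hW x hx])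
  have hpair : ∀ {f : ℝ → ℂ} (mf : MemLp (fun x => starRingEnd ℂ (f x)) 2 (volume.restrict J))
      (g : L2 J), inner ℂ mf.toLp g = ∫ x, f x * J.indicator g x := by
    intro f mf g
    rw [L2.inner_def]
    trans ∫ x in J, f x * g x
    · refine integral_congr_ae ?_
      filter_upwards [mf.coeFn_toLp] with x hx
      rw [hx, RCLike.inner_apply, Complex.conj_conj, mul_comm]
    · rw [← integral_indicator hJ.measurableSet]
      congr 1; ext x
      by_cases hx : x ∈ J <;> simp [hx]
  have e1 : inner ℂ mh.toLp p.1 = ∫ x, h x * J.indicator p.1 x :=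
    hpair mh p.1
  have e2 : inner ℂ mW.toLp p.2 = ∫ x, W x * J.indicator p.2 x :=
    hpair mW p.2
  have e3 := hw.lagrange hp l r
  rw [(hend hw.continuous hW).1, (hend hw.continuous hW).2, (hend hw.continuous_deriv hW0).1,
    (hend hw.continuous_deriv hW0).2, intervalIntegral.integral_of_le hlr,
    ← integral_Icc_eq_integral_Ioc, setIntegral_eq_integral_of_forall_compl_eq_zero
      fun x hx => by rw [hW x hx, hh0 x hx]; simp] at e3
  have i1 : Integrable (fun x => h x * J.indicator p.1 x) :=
    (locallyIntegrable_indicator p.1).integrable_smul_left_of_hasCompactSupport hc hhc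
  have i2 : Integrable (fun x => W x * J.indicator p.2 x) :=
    (locallyIntegrable_indicator p.2).integrable_smul_left_of_hasCompactSupport hw.continuous hWc
  have i3 : Integrable (fun x => h x * F x) :=
    hp.continuous.locallyIntegrable.integrable_smul_left_of_hasCompactSupport hc hhc
  rw [integral_sub i3 i2] at e3
  simp only [mul_sub]
  rw [integral_sub i1 i3, ← e1, key, e2, ← neg_eq_zero, neg_sub, e3]
  simp

theorem integral_sub_mul_add_mul {u v w : ℝ → ℂ} (hu : Integrable u) (hv : Integrable v)
    (hw : Integrable w) (α β : ℂ) :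
    ∫ x, (u x - α * v x + β * w x) = (∫ x, u x) - α * (∫ x, v x) + β * ∫ x, w x := by
  have h1 : Integrable fun x => u x - α * v x := hu.sub (hv.const_mul α)
  rw [integral_add h1 (hw.const_mul β), integral_sub hu (hv.const_mul α), integral_const_mul,
    integral_const_mul]

/-- A homogeneous solution can be cut off smoothly. -/
theorem IsSol.exists_cutoff {q f f' : ℝ → ℂ} (hf : IsSol q (fun _ => 0) f f') {e₁ e₂ : ℝ}
    (he : e₁ < e₂) :
    ∃ k W W', IsSol q k W W' ∧ Continuous k ∧ HasCompactSupport k ∧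
      (∀ x ≤ e₁, W x = 0) ∧ ∀ x, e₂ ≤ x → W x = f x := by
  set χ : ℝ → ℝ := fun x => Real.smoothTransition ((x - e₁) / (e₂ - e₁)) with hχ
  have hχd : ContDiff ℝ ∞ χ :=
    Real.smoothTransition.contDiff.comp ((contDiff_id.sub contDiff_const).div_const _)
  have hχ0 : ∀ x ≤ e₁, χ x = 0 := fun x hx =>
    Real.smoothTransition.zero_of_nonpos (div_nonpos_of_nonpos_of_nonneg (by linarith) (by linarith))
  have hχ1 : ∀ x, e₂ ≤ x → χ x = 1 := fun x hx =>
    Real.smoothTransition.one_of_one_le ((one_le_div (by linarith)).2 (by linarith))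
  have h1 := hf.mul_smooth hχd
  have hd1 : ContDiff ℝ ∞ (deriv χ) := hχd.deriv'
  have hd2 : ContDiff ℝ ∞ (deriv (deriv χ)) := hd1.deriv'
  have hk : Continuous fun x => (χ x : ℂ) * 0 - 2 * (deriv χ x : ℝ) * f' x
      - (deriv (deriv χ) x : ℝ) * f x := by
    have c0 : Continuous fun x => ((χ x : ℝ) : ℂ) :=
      Complex.continuous_ofReal.comp hχd.continuous
    have c1 : Continuous fun x => ((deriv χ x : ℝ) : ℂ) :=
      Complex.continuous_ofReal.comp hd1.continuous
    have c2 : Continuous fun x => ((deriv (deriv χ) x : ℝ) : ℂ) :=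
      Complex.continuous_ofReal.comp hd2.continuous
    exact ((c0.mul continuous_const).sub ((continuous_const.mul c1).mul hf.continuous_deriv)).sub
      (c2.mul hf.continuous)
  have hz1 := h1.rhs_eq_zero_of_continuous hk isOpen_Iio (U := Iio e₁) fun x hx => by
    simp [hχ0 x (le_of_lt hx)]
  have hz3 := (h1.sub hf).rhs_eq_zero_of_continuous (hk.sub continuous_const) isOpen_Ioi
    (U := Ioi e₂) fun x hx => by simp [hχ1 x (le_of_lt hx)]
  refine ⟨_, _, _, h1, hk, .intro (isCompact_Icc (a := e₁) (b := e₂)) fun x hx => ?_,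
    fun x hx => by simp [hχ0 x hx], fun x hx => by simp [hχ1 x hx]⟩
  rcases lt_or_ge x e₁ with h | h
  · exact hz1 x h
  · simpa using hz3 x (lt_of_not_ge fun h' => hx ⟨h, h'⟩)

/-- The fundamental lemma: the adjoint of the preminimal operator is the maximal operator. -/
theorem mem_maxOp_of_adjoint (hV : LocallyIntegrable V volume) (hne : (interior J).Nonempty)
    {p : L2 J × L2 J} (hadj : ∀ q ∈ preMinOp V J, inner ℂ q.2 p.1 = inner ℂ q.1 p.2) :
    p ∈ maxOp V J := by
  have hOC : (interior J).OrdConnected := hJ.interior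
  have hV' := locallyIntegrable_cpot hV
  obtain ⟨e₁, e₂, he, heJ, -⟩ := exists_Icc_of_isCompact isOpen_interior hne isCompact_empty
    (empty_subset _)
  obtain ⟨F, G, hp, -, -⟩ := exists_isSol hV' (locallyIntegrable_indicator p.2) e₁ 0 0
  obtain ⟨c, c', hcs, hc0, hc1⟩ := exists_isSol hV'
    (locallyIntegrable_const (X := ℝ) (μ := volume) (0 : ℂ)) e₁ 1 0
  obtain ⟨s, s', hss, hs0, hs1⟩ := exists_isSol hV'
    (locallyIntegrable_const (X := ℝ) (μ := volume) (0 : ℂ)) e₁ 0 1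
  -- The Wronskian of the fundamental system is constant.
  have hwr : ∀ x, c x * s' x - c' x * s x = 1 := fun x => by
    have := hcs.lagrange hss e₁ x
    simp only [zero_mul, mul_zero, sub_zero, intervalIntegral.integral_zero, hc0, hc1, hs0, hs1]
      at this
    linear_combination -this
  obtain ⟨kc, wf, wc, hkc, kcc, kcs, wc0, wc1⟩ := hcs.exists_cutoff he
  obtain ⟨ks, wg, ws, hks, ksc, kss, ws0, ws1⟩ := hss.exists_cutoff he
  -- `F` solves the equation with the right-hand side `p.2`. It remains to show that the deviation
  -- `y` is a homogeneous solution on `J`, namely `κc • s - κs • c`.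
  set y : ℝ → ℂ := fun x => J.indicator p.1 x - F x with hy
  have hyl : LocallyIntegrable y volume :=
    (locallyIntegrable_indicator p.1).sub hp.continuous.locallyIntegrable
  set κc := ∫ x, kc x * y x with hκc
  set κs := ∫ x, ks x * y x with hκs
  have key : ∀ g : ℝ → ℝ, ContDiff ℝ ∞ g → HasCompactSupport g → tsupport g ⊆ interior J →
      ∫ x, g x • (y x - (κc * s x - κs * c x)) = 0 := by
    intro g hg hgc hgs
    obtain ⟨l, r, hlr, hlJ, hsub⟩ := exists_Icc_of_isCompact isOpen_interior hne
      (hgc.union (isCompact_Icc (a := e₁) (b := e₂))) (union_subset hgs heJ)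
    have hle : l < e₁ := (hsub (Or.inr (left_mem_Icc.2 he.le))).1
    have hre : e₂ < r := (hsub (Or.inr (right_mem_Icc.2 he.le))).2
    have hg0 : ∀ x, x ∉ Ioo l r → g x = 0 := fun x hx =>
      image_eq_zero_of_notMem_tsupport fun h => hx (hsub (Or.inl h))
    have hgC : Continuous fun x => (g x : ℂ) := Complex.continuous_ofReal.comp hg.continuous
    have hgCs : HasCompactSupport fun x => (g x : ℂ) := hgc.mono fun x hx => by simpa using hx
    -- `W` is zero to the left of `l`, and by Lagrange's identity it equals `A • c - B • s` to the
    -- right of `r`. Subtracting the cut-off copies of `c` and `s` gives it compact support, and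
    -- adjointness can be tested against the result.
    obtain ⟨W, W', hW, hWl, hWl'⟩ := exists_isSol hV' hgC.locallyIntegrable l 0 0
    have full : ∀ {f : ℝ → ℂ}, ∫ t in l..r, ((g t : ℂ) * f t - W t * 0) = ∫ t, (g t : ℂ) * f t := by
      intro f
      rw [intervalIntegral.integral_of_le hlr.le, ← integral_Icc_eq_integral_Ioc]
      simp only [mul_zero, sub_zero]
      exact setIntegral_eq_integral_of_forall_compl_eq_zero fun x hx => by
        simp [hg0 x fun h => hx (Ioo_subset_Icc_self h)]
    have hA := hW.lagrange hss l r
    have hB := hW.lagrange hcs l r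
    rw [full, hWl, hWl'] at hA hB
    set A := ∫ t, (g t : ℂ) * s t
    set B := ∫ t, (g t : ℂ) * c t
    have hT := (hW.sub (hkc.const_smul A)).sub (hks.const_smul (-B))
    have hz : ∀ x, x ∉ Icc l r → (W - A • wf - (-B) • wg) x = 0 := by
      intro x hx
      rcases lt_or_ge x l with h | h
      · have h1 := (hW.eqOn_zero (K := Iic l) (.of_forall fun t ht => by
          simp [hg0 t fun h => not_lt.2 (mem_Iic.1 ht) h.1]) (a := l) (by simp) hWl hWl'
          (mem_Iic.2 h.le)).1
        simp [h1, wc0 x (by linarith), ws0 x (by linarith)]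
      · have hr : r < x := lt_of_not_ge fun h' => hx ⟨h, h'⟩
        have h2 := (hW.sub (hcs.const_smul A)).sub (hss.const_smul (-B))
        have h3 := (h2.eqOn_zero (K := Ici r) (.of_forall fun t ht => by
          simp [hg0 t fun h => not_lt.2 (mem_Ici.1 ht) h.2]) (a := r) (by simp) ?_ ?_
          (mem_Ici.2 hr.le)).1
        · simpa [wc1 x (by linarith), ws1 x (by linarith)] using h3
        · have := hwr r
          simp only [Pi.sub_apply, Pi.smul_apply, smul_eq_mul]
          linear_combination (-c r) * hA + s r * hB - W r * this
        · have := hwr r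
          simp only [Pi.sub_apply, Pi.smul_apply, smul_eq_mul]
          linear_combination (-c' r) * hA + s' r * hB - W' r * this
    have hI := integral_mul_eq_zero_of_adjoint hne hadj hp hT
      ((hgC.sub (kcc.const_smul A)).sub (ksc.const_smul (-B))) hlr.le hlJ hz
    have int : ∀ {f k : ℝ → ℂ}, LocallyIntegrable f volume → Continuous k → HasCompactSupport k →
        Integrable (fun x => k x * f x) := fun hf hk hks =>
      hf.integrable_smul_left_of_hasCompactSupport hk hks
    have i1 := int hyl hgC hgCs
    have i2 := int hyl kcc kcs
    have i3 := int hyl ksc kss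
    have i4 := int hcs.continuous.locallyIntegrable hgC hgCs
    have i5 := int hss.continuous.locallyIntegrable hgC hgCs
    have e1 : ∫ x, ((g x : ℂ) * y x - A * (kc x * y x) + B * (ks x * y x)) = 0 := by
      rw [← hI]
      congr 1; ext x
      simp only [hy, Pi.sub_apply, Pi.smul_apply, smul_eq_mul]
      ring
    rw [integral_sub_mul_add_mul i1 i2 i3] at e1
    have e2 : ∫ x, g x • (y x - (κc * s x - κs * c x)) =
        ∫ x, ((g x : ℂ) * y x - κc * ((g x : ℂ) * s x) + κs * ((g x : ℂ) * c x)) := by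
      congr 1; ext x
      simp only [Complex.real_smul]
      ring
    rw [e2, integral_sub_mul_add_mul i1 i5 i4]
    linear_combination e1
  have hae : ∀ᵐ x, x ∈ interior J → y x - (κc * s x - κs * c x) = 0 :=
    isOpen_interior.ae_eq_zero_of_integral_contDiff_smul_eq_zero
    (((hyl.sub (((continuous_const.mul hss.continuous).sub
      (continuous_const.mul hcs.continuous)).locallyIntegrable)).locallyIntegrableOn (interior J)))
    key
  refine mem_maxOp_of_isSol hne ((hp.add (hss.const_smul κc)).add (hcs.const_smul (-κs))) ?_ ?_
  · filter_upwards [ae_restrict_of_ae hae, ae_restrict_of_ae (ae_mem_interior (J := J)),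
      ae_restrict_mem hJ.measurableSet] with x h1 h2 hx
    have h3 := h1 (h2 hx)
    rw [hy] at h3
    simp only [indicator_of_mem hx] at h3
    simp only [Pi.add_apply, Pi.smul_apply, smul_eq_mul]
    linear_combination h3
  · filter_upwards [ae_restrict_mem hJ.measurableSet] with x hx
    simp [indicator_of_mem hx]

theorem mem_maxOp_iff (hV : LocallyIntegrable V volume) (hne : (interior J).Nonempty)
    {p : L2 J × L2 J} :
    p ∈ maxOp V J ↔ ∀ q ∈ preMinOp V J, inner ℂ q.2 p.1 = inner ℂ q.1 p.2 :=
  ⟨fun hp _ hq => inner_eq_of_mem_preMinOp hV hne hp hq, mem_maxOp_of_adjoint hV hne⟩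

/-- As an adjoint, the graph is an intersection of closed conditions. -/
theorem isClosed_maxOp (hV : LocallyIntegrable V volume) (hne : (interior J).Nonempty) :
    IsClosed (maxOp V J : Set (L2 J × L2 J)) := by
  have : (maxOp V J : Set (L2 J × L2 J)) =
      ⋂ q ∈ preMinOp V J, {p | inner ℂ q.2 p.1 = inner ℂ q.1 p.2} := by
    ext p; simp [mem_maxOp_iff hV hne]
  rw [this]
  exact isClosed_biInter fun q _ => isClosed_eq (by fun_prop) (by fun_prop)

theorem preMinOp_le_maxOp : preMinOp V J ≤ maxOp V J := fun _ ⟨f, hf, h⟩ => ⟨f, hf.1, h⟩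

theorem minOp_le_maxOp (hV : LocallyIntegrable V volume) (hne : (interior J).Nonempty) :
    minOp V J ≤ maxOp V J :=
  Submodule.topologicalClosure_minimal _ preMinOp_le_maxOp (isClosed_maxOp hV hne)

theorem inner_eq_of_mem_minOp (hV : LocallyIntegrable V volume) (hne : (interior J).Nonempty)
    {p q : L2 J × L2 J} (hp : p ∈ maxOp V J) (hq : q ∈ minOp V J) :
    inner ℂ q.2 p.1 = inner ℂ q.1 p.2 := by
  have : IsClosed {q : L2 J × L2 J | inner ℂ q.2 p.1 = inner ℂ q.1 p.2} :=
    isClosed_eq (by fun_prop) (by fun_prop)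
  exact closure_minimal (fun q hq => inner_eq_of_mem_preMinOp hV hne hp hq) this hq

end MaxOp

end

/-! ### Points of regular type, surjectivity of the maximal operator, Cauchy data. -/

section

section General

variable {V : ℝ → ℝ} {J : Set ℝ}

/-- The map `(f, h) ↦ h - z f`. -/
noncomputable def shiftMap (J : Set ℝ) (z : ℂ) : L2 J × L2 J →L[ℂ] L2 J :=
  ContinuousLinearMap.snd ℂ _ _ - z • ContinuousLinearMap.fst ℂ _ _

@[simp] theorem shiftMap_apply (z : ℂ) (p : L2 J × L2 J) : shiftMap J z p = p.2 - z • p.1 := rfl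

theorem IsRep.star {p : L2 J × L2 J} {F G : ℝ → ℂ} (hp : IsRep V J p F G) :
    IsRep V J (star p.1, star p.2) (fun x => starRingEnd ℂ (F x))
      (fun x => starRingEnd ℂ (G x)) := by
  obtain ⟨h, hs, h1, h2⟩ := hp
  refine ⟨_, hs.conj, ?_, ?_⟩
  · filter_upwards [Lp.coeFn_star p.1, h1] with x e1 e2
    rw [e1, Pi.star_apply, e2]; rfl
  · filter_upwards [Lp.coeFn_star p.2, h2] with x e1 e2
    rw [e1, Pi.star_apply, e2]; rfl

variable [hJ : J.OrdConnected]

/-- A representative solves the equation `-F'' + (V - z) F = w` on the line, where `w` agrees with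
the given function on `J`. -/
theorem IsRep.isSol_shift {p : L2 J × L2 J} {F G : ℝ → ℂ} (hp : IsRep V J p F G) {z : ℂ}
    {w : ℝ → ℂ} (hw : (p.2 - z • p.1 : L2 J) =ᵐ[volume.restrict J] w) :
    ∃ k, IsSol (fun x => cpot V x - z) k F G ∧ ∀ᵐ x, x ∈ J → k x = w x := by
  obtain ⟨h, hs, h1, h2⟩ := hp
  refine ⟨_, hs.shift z, (ae_restrict_iff' hJ.measurableSet).1 ?_⟩
  filter_upwards [h1, h2, hw, Lp.coeFn_sub p.2 (z • p.1), Lp.coeFn_smul z p.1] with x e1 e2 e3 e4 e5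
  rw [← e3, e4, Pi.sub_apply, e5, Pi.smul_apply, e1, e2, smul_eq_mul]

theorem IsRep.eq_zero {p : L2 J × L2 J} {F G : ℝ → ℂ} (hp : IsRep V J p F G) {z : ℂ}
    (hz : p.2 = z • p.1) {a : ℝ} (ha : a ∈ J) (hF : F a = 0) (hG : G a = 0) : p = 0 := by
  obtain ⟨k, hk, hk0⟩ := hp.isSol_shift (z := z) (w := 0) (by
    rw [hz, sub_self]; exact Lp.coeFn_zero _ _ _)
  obtain ⟨h, hs, h1, h2⟩ := hp
  have e : p.1 = 0 := by
    refine Lp.ext (h1.trans ?_)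
    filter_upwards [ae_restrict_mem hJ.measurableSet, Lp.coeFn_zero ℂ 2 (volume.restrict J)]
      with x hx h0
    rw [h0]
    exact (hk.eqOn_zero hk0 ha hF hG hx).1
  exact Prod.ext e (by rw [hz, e, smul_zero]; rfl)

theorem isClosed_minOp : IsClosed (minOp V J : Set (L2 J × L2 J)) :=
  Submodule.isClosed_topologicalClosure _

theorem mem_regularType_iff {z : ℂ} :
    z ∈ regularType V J ↔ IsClosed (range ((shiftMap J z).comp (minOp V J).subtypeL)) := by
  have : range ((shiftMap J z).comp (minOp V J).subtypeL) =
      {h : L2 J | ∃ p ∈ minOp V J, h = p.2 - z • p.1} := by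
    ext h
    simp only [mem_range, mem_ofPred_eq]
    exact ⟨fun ⟨p, hp⟩ => ⟨p, p.2, hp.symm⟩, fun ⟨p, hp, h⟩ => ⟨⟨p, hp⟩, h.symm⟩⟩
  rw [this]; rfl

/-- The bound controls the full graph norm, since `p.2` is recovered from `p.2 - z • p.1` and `p.1`.
So `A - z` is antilipschitz on a complete space and its range is closed. -/
theorem mem_regularType_of_bound {z : ℂ} {C : ℝ}
    (hC : ∀ p ∈ minOp V J, ‖p.1‖ ≤ C * ‖p.2 - z • p.1‖) : z ∈ regularType V J := by
  have : CompleteSpace (minOp V J) := isClosed_minOp.completeSpace_coe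
  rw [mem_regularType_iff]
  have hb : ∀ p : minOp V J, ‖p‖ ≤ (Real.toNNReal (|C| + (1 + ‖z‖ * |C|)) : ℝ) *
      ‖((shiftMap J z).comp (minOp V J).subtypeL) p‖ := by
    intro p
    set d := ‖((shiftMap J z).comp (minOp V J).subtypeL) p‖ with hd
    have hd0 : 0 ≤ d := norm_nonneg _
    have h1 : ‖(p : L2 J × L2 J).1‖ ≤ |C| * d :=
      (hC p p.2).trans (mul_le_mul_of_nonneg_right (le_abs_self C) hd0)
    have h2 : ‖(p : L2 J × L2 J).2‖ ≤ d + ‖z‖ * (|C| * d) := by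
      have : (p : L2 J × L2 J).2 = ((p : L2 J × L2 J).2 - z • (p : L2 J × L2 J).1) +
        z • (p : L2 J × L2 J).1 := by abel
      rw [this]
      refine (norm_add_le _ _).trans (add_le_add le_rfl ?_)
      rw [norm_smul]
      exact mul_le_mul_of_nonneg_left h1 (norm_nonneg _)
    rw [Real.coe_toNNReal _ (by positivity)]
    have h3 : 0 ≤ |C| * d := by positivity
    have h4 : 0 ≤ ‖z‖ * (|C| * d) := by positivity
    change max ‖(p : L2 J × L2 J).1‖ ‖(p : L2 J × L2 J).2‖ ≤ _
    refine max_le ?_ ?_ <;> nlinarith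
  exact (ContinuousLinearMap.antilipschitz_of_bound _ hb).isClosed_range
    (ContinuousLinearMap.uniformContinuous _)

/-- The minimal operator is symmetric, so the imaginary part of `⟨p, (A - z) p⟩` is `-Im z ‖p‖²`;
Cauchy-Schwarz gives the bound with constant `|Im z|⁻¹`. -/
theorem mem_regularType_of_im_ne_zero (hV : LocallyIntegrable V volume)
    (hne : (interior J).Nonempty) {z : ℂ} (hz : z.im ≠ 0) : z ∈ regularType V J := by
  refine mem_regularType_of_bound (C := |z.im|⁻¹) fun p hp => ?_
  have h1 := inner_eq_of_mem_minOp hV hne (minOp_le_maxOp hV hne hp) hp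
  have h2 : (inner ℂ p.1 (p.2 - z • p.1)).im = -z.im * ‖p.1‖ ^ 2 := by
    have h3 : (inner ℂ p.1 p.2).im = 0 := by
      rw [← Complex.conj_eq_iff_im, inner_conj_symm, h1]
    rw [inner_sub_right, inner_smul_right, inner_self_eq_norm_sq_to_K, Complex.sub_im, h3]
    simp [← Complex.ofReal_pow]
  rw [inv_mul_eq_div, le_div_iff₀ (abs_pos.2 hz)]
  rcases (norm_nonneg p.1).eq_or_lt with h0 | h0
  · rw [← h0]; simp
  · have h4 : |z.im| * ‖p.1‖ ^ 2 ≤ ‖p.1‖ * ‖p.2 - z • p.1‖ := by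
      calc |z.im| * ‖p.1‖ ^ 2 = |(inner ℂ p.1 (p.2 - z • p.1)).im| := by
            rw [h2, abs_mul, abs_neg, abs_of_nonneg (sq_nonneg ‖p.1‖)]
        _ ≤ ‖inner ℂ p.1 (p.2 - z • p.1)‖ := Complex.abs_im_le_norm _
        _ ≤ _ := norm_inner_le_norm _ _
    nlinarith

/-- If `A - z` is injective with closed range, then the range of `A* - conj z` is everything. -/
theorem exists_maxOp_of_regularType (hV : LocallyIntegrable V volume)
    (hne : (interior J).Nonempty) {z : ℂ} (hz : z ∈ regularType V J)
    (hinj : ∀ p ∈ minOp V J, p.2 = z • p.1 → p = 0) (w : L2 J) :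
    ∃ p ∈ maxOp V J, p.2 - starRingEnd ℂ z • p.1 = w := by
  have : CompleteSpace (minOp V J) := isClosed_minOp.completeSpace_coe
  set D := (shiftMap J z).comp (minOp V J).subtypeL with hD
  have hDi : Function.Injective D := by
    refine (injective_iff_map_eq_zero D).2 fun p hp => ?_
    exact Subtype.ext (hinj p p.2 (sub_eq_zero.1 hp))
  -- The functional `D p ↦ ⟨w, p.1⟩` is bounded because `D` is injective with closed range.
  -- Hahn-Banach and Riesz represent it by `y`, and the resulting identity states that `A* y - conj
  -- z • y = w`.
  set ℓ : D.range →L[ℂ] ℂ := ((innerSL ℂ w).comp (ContinuousLinearMap.fst ℂ (L2 J) (L2 J))).comp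
    ((minOp V J).subtypeL.comp
      ((D.equivRange hDi (mem_regularType_iff.1 hz)).symm : D.range →L[ℂ] minOp V J)) with hℓ
  obtain ⟨ℓ', hℓ', -⟩ := exists_extension_norm_eq _ ℓ
  set y := (InnerProductSpace.toDual ℂ (L2 J)).symm ℓ' with hy
  have key : ∀ p : minOp V J, inner ℂ y (D p) = inner ℂ w (p : L2 J × L2 J).1 := by
    intro p
    rw [hy, InnerProductSpace.toDual_symm_apply]
    rw [← Subtype.coe_mk (D p) (by simp : D p ∈ D.range), hℓ']
    simp [hℓ]
  refine ⟨(y, w + starRingEnd ℂ z • y), mem_maxOp_of_adjoint hV hne fun q hq => ?_, by simp⟩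
  have h1 := key ⟨q, Submodule.le_topologicalClosure _ hq⟩
  simp only [hD, ContinuousLinearMap.comp_apply, Submodule.subtypeL_apply, shiftMap_apply,
    inner_sub_right, inner_smul_right] at h1
  have h2 := congrArg (starRingEnd ℂ) h1
  simp only [map_sub, map_mul, inner_conj_symm] at h2
  simp only [inner_add_right, inner_smul_right]
  linear_combination h2

end General

/-! ### Half-lines -/

/-- `J` is the half-line `[a, ∞)`, with `σ = 1`, or the half-line `(-∞, a]`, with `σ = -1`. -/
inductive IsHalfLine : Set ℝ → ℝ → ℂ → Prop
  | right (a : ℝ) : IsHalfLine (Ici a) a 1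
  | left (a : ℝ) : IsHalfLine (Iic a) a (-1)

namespace IsHalfLine

variable {V : ℝ → ℝ} {J : Set ℝ} {a : ℝ} {σ : ℂ}

theorem mem (hl : IsHalfLine J a σ) : a ∈ J := by cases hl <;> simp

theorem nonempty (hl : IsHalfLine J a σ) : (interior J).Nonempty := by
  cases hl
  · rw [interior_Ici]; exact nonempty_Ioi
  · rw [interior_Iic]; exact nonempty_Iio

theorem sq (hl : IsHalfLine J a σ) : σ * σ = 1 := by cases hl <;> simp

theorem ne_zero (hl : IsHalfLine J a σ) : σ ≠ 0 := by cases hl <;> simp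

theorem conj (hl : IsHalfLine J a σ) : starRingEnd ℂ σ = σ := by cases hl <;> simp

/-- A homogeneous solution with the wanted data is multiplied by a bump equal to 1 near `a`, which
leaves the Cauchy data untouched. These pairs serve as test elements in Green's formula. -/
theorem exists_isRep_compact (hV : LocallyIntegrable V volume) (a : ℝ) (u v : ℂ) :
    ∃ q : L2 J × L2 J, ∃ W W' : ℝ → ℂ, IsRep V J q W W' ∧ W a = u ∧ W' a = v ∧
      ∃ R, ∀ x, R < |x - a| → W x = 0 := by
  obtain ⟨f, f', hf, hu, hv⟩ := exists_isSol (locallyIntegrable_cpot hV)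
    (locallyIntegrable_const (X := ℝ) (μ := volume) (0 : ℂ)) a u v
  let φ : ContDiffBump a := ⟨1, 2, one_pos, one_lt_two⟩
  have hφ : ContDiff ℝ ∞ φ := φ.contDiff
  have h1 := hf.mul_smooth hφ
  have hd1 : ContDiff ℝ ∞ (deriv φ) := hφ.deriv'
  have hd2 : ContDiff ℝ ∞ (deriv (deriv φ)) := hd1.deriv'
  have hk : Continuous fun x => (φ x : ℂ) * 0 - 2 * (deriv φ x : ℝ) * f' x
      - (deriv (deriv φ) x : ℝ) * f x := by
    have c0 : Continuous fun x => ((φ x : ℝ) : ℂ) :=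
      Complex.continuous_ofReal.comp hφ.continuous
    have c1 : Continuous fun x => ((deriv φ x : ℝ) : ℂ) :=
      Complex.continuous_ofReal.comp hd1.continuous
    have c2 : Continuous fun x => ((deriv (deriv φ) x : ℝ) : ℂ) :=
      Complex.continuous_ofReal.comp hd2.continuous
    exact ((c0.mul continuous_const).sub ((continuous_const.mul c1).mul hf.continuous_deriv)).sub
      (c2.mul hf.continuous)
  have hz : ∀ x, 2 < |x - a| → (φ x : ℂ) * f x = 0 := fun x hx => by
    rw [φ.zero_of_le_dist (by rw [Real.dist_eq]; exact hx.le)]; simp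
  have hkz := h1.rhs_eq_zero_of_continuous hk (U := {x | 2 < |x - a|})
    (isOpen_lt (by fun_prop) (by fun_prop)) hz
  have supp : ∀ {g : ℝ → ℂ}, (∀ x, 2 < |x - a| → g x = 0) → HasCompactSupport g := fun hg =>
    .intro (isCompact_closedBall a 2) fun x hx => hg x (by
      rw [Metric.mem_closedBall, Real.dist_eq] at hx; exact not_le.1 hx)
  have m1 := (h1.continuous.memLp_of_hasCompactSupport (p := 2) (μ := volume) (supp hz)).restrict J
  have m2 := (hk.memLp_of_hasCompactSupport (p := 2) (μ := volume) (supp hkz)).restrict J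
  have hφ1 : (φ : ℝ → ℝ) =ᶠ[𝓝 a] fun _ => 1 := φ.eventuallyEq_one
  have hφa : φ a = 1 := hφ1.eq_of_nhds
  have hφ' : deriv φ a = 0 := by rw [hφ1.deriv_eq]; simp
  exact ⟨(m1.toLp, m2.toLp), _, _, ⟨_, h1, m1.coeFn_toLp, m2.coeFn_toLp⟩, by simp [hφa, hu],
    by simp [hφa, hφ', hv], 2, hz⟩

variable [hJ : J.OrdConnected]

/-- Only the end point `a` contributes, because `W` vanishes far out; `σ` records whether `a` is the
lower or the upper limit of integration. -/
theorem green (hl : IsHalfLine J a σ) {p q : L2 J × L2 J} {F G W W' : ℝ → ℂ}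
    (hp : IsRep V J p F G) (hq : IsRep V J q W W') {R : ℝ}
    (hW : ∀ x, R < |x - a| → W x = 0) :
    inner ℂ q.2 p.1 - inner ℂ q.1 p.2 =
      σ * (starRingEnd ℂ (W' a) * F a - starRingEnd ℂ (W a) * G a) := by
  set S := |R| + 1
  have hS : R < S := (le_abs_self R).trans_lt (lt_add_one _)
  have hS0 : 0 < S := by positivity
  have hW' : ∀ x, R < |x - a| → W' x = 0 := by
    obtain ⟨h, hs, -⟩ := hq
    exact hs.deriv_eq_zero (U := {x | R < |x - a|}) (isOpen_lt (by fun_prop) (by fun_prop)) hW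
  cases hl with
  | right =>
    have h1 : R < |a + S - a| := by rwa [add_sub_cancel_left, abs_of_pos hS0]
    rw [hp.inner_sub_inner_eq hq (by linarith) Icc_subset_Ici_self (r := a + S) fun x hx hxI => hW x ?_,
      hW _ h1, hW' _ h1]
    · simp
    · have : a + S < x := lt_of_not_ge fun h => hxI ⟨hx, h⟩
      rw [abs_of_pos (by linarith)]; linarith
  | left =>
    have h1 : R < |a - S - a| := by
      rwa [sub_sub_cancel_left, abs_neg, abs_of_pos hS0]
    rw [hp.inner_sub_inner_eq hq (by linarith) Icc_subset_Iic_self (l := a - S) fun x hx hxI => hW x ?_,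
      hW _ h1, hW' _ h1]
    · simp
    · have : x < a - S := lt_of_not_ge fun h => hxI ⟨h, hx⟩
      rw [abs_of_neg (by linarith)]; linarith

end IsHalfLine

/-- `Γ` maps a pair in the graph of the maximal operator to the Cauchy data at `a`, and vanishes on
the minimal operator. -/
structure IsBoundaryMap (V : ℝ → ℝ) (J : Set ℝ) [J.OrdConnected] (a : ℝ)
    (Γ : L2 J × L2 J →L[ℂ] ℂ × ℂ) : Prop where
  apply_eq : ∀ {p F G}, IsRep V J p F G → Γ p = (F a, G a)
  eq_zero : ∀ {p}, p ∈ minOp V J → Γ p = 0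

variable {V : ℝ → ℝ} {J : Set ℝ} [hJ : J.OrdConnected] {a : ℝ} {σ : ℂ}

/-- Green's formula against a compactly supported `q` writes a combination of the Cauchy data as a
bounded functional on the graph. The same expression vanishes on the minimal operator because `q` is
in the maximal one. -/
theorem IsHalfLine.exists_isBoundaryMap (hl : IsHalfLine J a σ) (hV : LocallyIntegrable V volume) :
    ∃ Γ, IsBoundaryMap V J a Γ := by
  have key : ∀ u v : ℂ, ∃ ℓ : L2 J × L2 J →L[ℂ] ℂ,
      (∀ p F G, IsRep V J p F G → ℓ p = starRingEnd ℂ v * F a - starRingEnd ℂ u * G a) ∧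
      ∀ p ∈ minOp V J, ℓ p = 0 := by
    intro u v
    obtain ⟨q, W, W', hq, hu, hv, R, hR⟩ := exists_isRep_compact (J := J) hV a u v
    refine ⟨σ • ((innerSL ℂ q.2).comp (ContinuousLinearMap.fst ℂ _ _) -
      (innerSL ℂ q.1).comp (ContinuousLinearMap.snd ℂ _ _)), fun p F G hp => ?_, fun p hp => ?_⟩
    · have := hl.green hp hq hR
      simp only [smul_apply, sub_apply,
        ContinuousLinearMap.comp_apply, ContinuousLinearMap.coe_fst', ContinuousLinearMap.coe_snd',
        innerSL_apply_apply, smul_eq_mul]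
      rw [this, ← mul_assoc, hl.sq, one_mul, hu, hv]
    · have h := congrArg (starRingEnd ℂ)
        (inner_eq_of_mem_minOp hV hl.nonempty (hq.mem_maxOp hl.nonempty) hp)
      rw [inner_conj_symm, inner_conj_symm] at h
      simp [h]
  -- The data `(0, 1)` and `(-1, 0)` isolate `F a` and `G a` respectively.
  obtain ⟨ℓ₀, h0, h0'⟩ := key 0 1
  obtain ⟨ℓ₁, h1, h1'⟩ := key (-1) 0
  refine ⟨ℓ₀.prod ℓ₁, fun {p F G} hp => ?_, fun {p} hp => ?_⟩
  · simp [h0 p F G hp, h1 p F G hp]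
  · simp [h0' p hp, h1' p hp]

theorem IsHalfLine.eq_zero_of_mem_maxOp (hl : IsHalfLine J a σ) (hV : LocallyIntegrable V volume)
    {Γ : L2 J × L2 J →L[ℂ] ℂ × ℂ} (hΓ : IsBoundaryMap V J a Γ) {p : L2 J × L2 J}
    (hp : p ∈ maxOp V J) {z : ℂ} (hz : p.2 = z • p.1) (h0 : Γ p = 0) : p = 0 := by
  obtain ⟨F, G, hr⟩ := exists_isRep hV hl.nonempty hp
  rw [hΓ.apply_eq hr, Prod.mk_eq_zero] at h0
  exact hr.eq_zero hz hl.mem h0.1 h0.2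

/-- Duality solves the equation at `conj z`. As `V` is real, complex conjugation of the solution for
`star w` returns to `z`. -/
theorem IsHalfLine.exists_maxOp_sub_eq (hl : IsHalfLine J a σ) (hV : LocallyIntegrable V volume)
    {z : ℂ} (hz : z ∈ regularType V J) (w : L2 J) :
    ∃ p ∈ maxOp V J, p.2 - z • p.1 = w := by
  obtain ⟨Γ, hΓ⟩ := hl.exists_isBoundaryMap hV
  obtain ⟨p, hp, h⟩ := exists_maxOp_of_regularType hV hl.nonempty hz (fun p hp hz' =>
    hl.eq_zero_of_mem_maxOp hV hΓ (minOp_le_maxOp hV hl.nonempty hp) hz' (hΓ.eq_zero hp)) (star w)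
  obtain ⟨F, G, hr⟩ := exists_isRep hV hl.nonempty hp
  refine ⟨_, hr.star.mem_maxOp hl.nonempty, ?_⟩
  refine Lp.ext ?_
  have h' : (p.2 - starRingEnd ℂ z • p.1 : L2 J) =ᵐ[volume.restrict J] star w := by
    rw [h]; exact Lp.coeFn_star w
  filter_upwards [h', Lp.coeFn_sub p.2 (starRingEnd ℂ z • p.1), Lp.coeFn_smul (starRingEnd ℂ z) p.1,
    Lp.coeFn_sub (star p.2) (z • star p.1), Lp.coeFn_smul z (star p.1), Lp.coeFn_star p.1,
    Lp.coeFn_star p.2] with x e1 e2 e3 e4 e5 e6 e7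
  rw [e4, Pi.sub_apply, e5, Pi.smul_apply, e6, e7]
  rw [e2, Pi.sub_apply, e3, Pi.smul_apply] at e1
  have := congrArg (starRingEnd ℂ) e1
  simpa using this

end

/-! ### Analytic dependence of kernels, and the defect number at points of regular type. -/

section

/-- The kernels of a surjective affine family of operators depend analytically on the parameter. -/
theorem exists_analytic_ker {T L : Type*} [NormedAddCommGroup T] [NormedSpace ℂ T] [CompleteSpace T]
    [NormedAddCommGroup L] [NormedSpace ℂ L] [CompleteSpace L] (S N : T →L[ℂ] L) (z₀ : ℂ)
    (hsurj : Function.Surjective (S - z₀ • N)) [FiniteDimensional ℂ (S - z₀ • N).ker] :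
    ∃ Φ : ℂ → ((S - z₀ • N).ker →L[ℂ] T), AnalyticAt ℂ Φ z₀ ∧
      ∀ᶠ z in 𝓝 z₀, Function.Injective (Φ z) ∧ (Φ z).range = (S - z • N).ker := by
  set K := (S - z₀ • N).ker with hK
  obtain ⟨π, hπ⟩ := Submodule.ClosedComplemented.of_finiteDimensional K
  -- Adding the projection onto the kernel makes the operator bijective at `z₀`. The kernel for
  -- nearby `z` is then the image of `0 × K` under the inverse of `U z`.
  set U : ℂ → (T →L[ℂ] L × K) := fun z => (S - z • N).prod π with hU
  have hinj : (U z₀).ker = ⊥ := by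
    refine LinearMap.ker_eq_bot'.2 fun t ht => ?_
    have ht' : ((S - z₀ • N) t, π t) = 0 := ht
    rw [Prod.mk_eq_zero] at ht'
    have h1 : t ∈ K := ht'.1
    have h2 := hπ ⟨t, h1⟩
    rw [ht'.2] at h2
    exact congrArg Subtype.val h2.symm
  have hsur : (U z₀).range = ⊤ := by
    refine LinearMap.range_eq_top.2 fun ⟨l, k⟩ => ?_
    obtain ⟨t, ht⟩ := hsurj l
    refine ⟨t + ((k - π t : K) : T), ?_⟩
    have h1 : (S - z₀ • N) ((k - π t : K) : T) = 0 := (k - π t : K).2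
    change ((S - z₀ • N) (t + ((k - π t : K) : T)), π (t + ((k - π t : K) : T))) = (l, k)
    rw [map_add, map_add, h1, ht, hπ, add_zero, add_sub_cancel]
  set e := ContinuousLinearEquiv.ofBijective (U z₀) hinj hsur with he
  have he' : ∀ t, e t = U z₀ t := fun t => rfl
  -- Composition with the inverse of `U z₀` gives an affine family in a Banach algebra with value 1
  -- at `z₀`, where inversion is analytic.
  set A : ℂ → (T →L[ℂ] T) := fun z => (e.symm : L × K →L[ℂ] T).comp (U z) with hA
  have hA1 : A z₀ = 1 := by
    ext t
    change e.symm (U z₀ t) = t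
    rw [← he', e.symm_apply_apply]
  have hAan : AnalyticAt ℂ A z₀ := by
    have : A = fun z => (e.symm : L × K →L[ℂ] T).comp (S.prod π) -
        z • (e.symm : L × K →L[ℂ] T).comp (N.prod 0) := by
      ext z t
      change e.symm ((S - z • N) t, π t) = e.symm (S t, π t) - z • e.symm (N t, 0)
      rw [← map_smul, ← map_sub, Prod.smul_mk, Prod.mk_sub_mk, smul_zero, sub_zero]
      rfl
    rw [this]
    exact analyticAt_const.sub (analyticAt_id.smul analyticAt_const)
  have hinv1 : AnalyticAt ℂ (Ring.inverse : (T →L[ℂ] T) → (T →L[ℂ] T)) (A z₀) := by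
    rw [hA1]; exact analyticAt_inverse (1 : (T →L[ℂ] T)ˣ)
  set I : ℂ → (T →L[ℂ] T) := fun z => Ring.inverse (A z) with hI
  have hinvan : AnalyticAt ℂ I z₀ := hinv1.comp hAan
  refine ⟨fun z => (I z).comp ((e.symm : L × K →L[ℂ] T).comp
    (ContinuousLinearMap.inr ℂ L K)), ?_, ?_⟩
  · exact (((ContinuousLinearMap.compL ℂ K T T).flip _).analyticAt _).comp hinvan
  · have hunit : ∀ᶠ z in 𝓝 z₀, IsUnit (A z) :=
      hAan.continuousAt.eventually_mem (Units.isOpen.mem_nhds (by rw [hA1]; exact isUnit_one))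
    filter_upwards [hunit] with z hz
    have hUinj : Function.Injective (U z) := fun t t' h => by
      have h1 : A z t = A z t' := congrArg e.symm h
      have h2 : (I z * A z) t = (I z * A z) t' := congrArg (I z) h1
      rwa [hI, Ring.inverse_mul_cancel _ hz] at h2
    have hUΦ : ∀ k : K, U z (I z (e.symm (0, k))) = (0, k) := fun k => by
      have h1 : (A z * I z) (e.symm (0, k)) = e.symm (0, k) := by
        rw [hI, Ring.mul_inverse_cancel _ hz]; rfl
      exact e.symm.injective h1
    refine ⟨fun k k' h => ?_, ?_⟩
    · have h1 := congrArg (U z) h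
      have h2 : ((0 : L), k) = (0, k') := by
        rw [← hUΦ k, ← hUΦ k']; exact h1
      exact congrArg Prod.snd h2
    · ext t
      constructor
      · rintro ⟨k, rfl⟩
        exact congrArg Prod.fst (hUΦ k)
      · intro ht
        refine ⟨π t, hUinj ?_⟩
        refine (hUΦ (π t)).trans ?_
        exact (Prod.ext (show (S - z • N) t = 0 from ht) rfl : U z t = (0, π t)).symm

section

variable {T L : Type*} [NormedAddCommGroup T] [NormedSpace ℂ T] [CompleteSpace T]
  [NormedAddCommGroup L] [NormedSpace ℂ L] [CompleteSpace L] {S N : T →L[ℂ] L} {z₀ : ℂ}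

theorem eventually_finrank_ker_eq (hsurj : Function.Surjective (S - z₀ • N))
    [FiniteDimensional ℂ (S - z₀ • N).ker] :
    ∀ᶠ z in 𝓝 z₀, Module.finrank ℂ (S - z • N).ker = Module.finrank ℂ (S - z₀ • N).ker := by
  obtain ⟨Φ, -, h⟩ := exists_analytic_ker S N z₀ hsurj
  filter_upwards [h] with z hz
  rw [← hz.2]
  exact LinearMap.finrank_range_of_inj hz.1

theorem exists_analytic_span_ker (hsurj : Function.Surjective (S - z₀ • N))
    (hdim : Module.finrank ℂ (S - z₀ • N).ker = 1) :
    ∃ γ : ℂ → T, AnalyticAt ℂ γ z₀ ∧ ∀ᶠ z in 𝓝 z₀, γ z ≠ 0 ∧ (S - z • N) (γ z) = 0 ∧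
      ∀ t, (S - z • N) t = 0 → ∃ k : ℂ, t = k • γ z := by
  have : FiniteDimensional ℂ (S - z₀ • N).ker := .of_finrank_pos (by rw [hdim]; exact one_pos)
  obtain ⟨Φ, hΦ, h⟩ := exists_analytic_ker S N z₀ hsurj
  obtain ⟨k, hk, hspan⟩ := finrank_eq_one_iff'.1 hdim
  refine ⟨fun z => Φ z k, ((ContinuousLinearMap.apply ℂ T k).analyticAt _).comp hΦ, ?_⟩
  filter_upwards [h] with z ⟨hinj, hr⟩
  refine ⟨fun h0 => hk (hinj (by rw [map_zero]; exact h0)), ?_, fun t ht => ?_⟩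
  · have h1 : Φ z k ∈ (S - z • N).ker := by rw [← hr]; exact ⟨k, rfl⟩
    exact h1
  · have h2 : t ∈ (Φ z).range := by rw [hr]; exact ht
    obtain ⟨k', rfl⟩ := h2
    obtain ⟨c, rfl⟩ := hspan k'
    exact ⟨c, map_smul (Φ z) c k⟩

end

variable {V : ℝ → ℝ} {J : Set ℝ} [hJ : J.OrdConnected] {a : ℝ} {σ : ℂ}

/-- The operator `f ↦ A* f` on the graph of the maximal operator. -/
noncomputable def maxSnd (V : ℝ → ℝ) (J : Set ℝ) [J.OrdConnected] : maxOp V J →L[ℂ] L2 J :=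
  (ContinuousLinearMap.snd ℂ _ _).comp (maxOp V J).subtypeL

/-- The embedding of the domain of the maximal operator. -/
noncomputable def maxFst (V : ℝ → ℝ) (J : Set ℝ) [J.OrdConnected] : maxOp V J →L[ℂ] L2 J :=
  (ContinuousLinearMap.fst ℂ _ _).comp (maxOp V J).subtypeL

theorem maxShift_apply_eq_zero {z : ℂ} {p : maxOp V J} :
    (maxSnd V J - z • maxFst V J) p = 0 ↔ (p : L2 J × L2 J).2 = z • (p : L2 J × L2 J).1 :=
  sub_eq_zero

theorem finrank_defect (z : ℂ) :
    Module.finrank ℂ (maxSnd V J - z • maxFst V J).ker = Module.finrank ℂ (defect V J z) := by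
  have hmem : ∀ p : (maxSnd V J - z • maxFst V J).ker,
      ((maxFst V J).toLinearMap ∘ₗ (maxSnd V J - z • maxFst V J).ker.subtype) p ∈ defect V J z := by
    intro p
    have h : ((p : maxOp V J).1.1, z • (p : maxOp V J).1.1) = (p : maxOp V J).1 :=
      Prod.ext rfl (maxShift_apply_eq_zero.1 p.2).symm
    change ((p : maxOp V J).1.1, z • (p : maxOp V J).1.1) ∈ maxOp V J
    rw [h]; exact p.1.2
  refine (LinearEquiv.ofBijective (LinearMap.codRestrict _ _ hmem) ⟨fun p q h => ?_,
    fun f => ?_⟩).finrank_eq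
  · have h1 : (p : maxOp V J).1.1 = (q : maxOp V J).1.1 := congrArg Subtype.val h
    refine Subtype.ext (Subtype.ext (Prod.ext h1 ?_))
    rw [maxShift_apply_eq_zero.1 p.2, maxShift_apply_eq_zero.1 q.2, h1]
  · exact ⟨⟨⟨(f, z • (f : L2 J)), f.2⟩, maxShift_apply_eq_zero.2 rfl⟩, rfl⟩

namespace IsHalfLine

/-- The Cauchy data embed the kernel into `ℂ²`. -/
theorem finiteDimensional_ker (hl : IsHalfLine J a σ) (hV : LocallyIntegrable V volume) (z : ℂ) :
    FiniteDimensional ℂ (maxSnd V J - z • maxFst V J).ker := by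
  obtain ⟨Γ, hΓ⟩ := hl.exists_isBoundaryMap hV
  refine FiniteDimensional.of_injective
    ((Γ.comp (maxOp V J).subtypeL).toLinearMap ∘ₗ (maxSnd V J - z • maxFst V J).ker.subtype)
    ((injective_iff_map_eq_zero _).2 fun p hp => ?_)
  exact Subtype.ext (Subtype.ext (hl.eq_zero_of_mem_maxOp hV hΓ p.1.2
    (maxShift_apply_eq_zero.1 p.2) hp))

theorem surjective_maxShift (hl : IsHalfLine J a σ) (hV : LocallyIntegrable V volume) {z : ℂ}
    (hz : z ∈ regularType V J) : Function.Surjective (maxSnd V J - z • maxFst V J) := fun w =>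
  let ⟨p, hp, h⟩ := hl.exists_maxOp_sub_eq hV hz w
  ⟨⟨p, hp⟩, h⟩

theorem eventually_finrank_eq (hl : IsHalfLine J a σ) (hV : LocallyIntegrable V volume) {z₀ : ℂ}
    (hz₀ : z₀ ∈ regularType V J) :
    ∀ᶠ z in 𝓝 z₀, Module.finrank ℂ (defect V J z) = Module.finrank ℂ (defect V J z₀) := by
  have : CompleteSpace (maxOp V J) := (isClosed_maxOp hV hl.nonempty).completeSpace_coe
  have := hl.finiteDimensional_ker hV z₀
  simp only [← finrank_defect]
  exact eventually_finrank_ker_eq (hl.surjective_maxShift hV hz₀)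

/-- A locally constant dimension is constant on connected sets; the open half-planes then inherit
the value at `±i`. -/
theorem finrank_eq_of_isPreconnected (hl : IsHalfLine J a σ) (hV : LocallyIntegrable V volume)
    {s : Set ℂ} (hs : IsPreconnected s) (hsr : s ⊆ regularType V J) {z w : ℂ} (hz : z ∈ s)
    (hw : w ∈ s) :
    Module.finrank ℂ (defect V J z) = Module.finrank ℂ (defect V J w) :=
  hs.constant (f := fun z => Module.finrank ℂ (defect V J z))
    (fun _ hz => (ContinuousAt.continuousWithinAt
      (tendsto_nhds_of_eventually_eq (hl.eventually_finrank_eq hV (hsr hz))))) hz hw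

theorem finrank_eq_one_of_im_ne_zero (hl : IsHalfLine J a σ) (hV : LocallyIntegrable V volume)
    (hlp : LimitPoint V J) {z : ℂ} (hz : z.im ≠ 0) :
    Module.finrank ℂ (defect V J z) = 1 := by
  rcases lt_or_gt_of_ne hz with h | h
  · rw [← hlp.2]
    exact hl.finrank_eq_of_isPreconnected hV (convex_halfSpace_im_lt 0).isPreconnected
      (fun w hw => mem_regularType_of_im_ne_zero hV hl.nonempty (ne_of_lt hw)) h (by simp)
  · rw [← hlp.1]
    exact hl.finrank_eq_of_isPreconnected hV (convex_halfSpace_im_gt 0).isPreconnected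
      (fun w hw => mem_regularType_of_im_ne_zero hV hl.nonempty (ne_of_gt hw)) h (by simp)

end IsHalfLine

/-- Every point is approached by non-real points along a vertical line. This transfers facts from
non-real to real points of regular type. -/
theorem frequently_im_ne_zero (z : ℂ) : ∃ᶠ w in 𝓝[≠] z, w.im ≠ 0 := by
  have h : Tendsto (fun t : ℝ => z + t * Complex.I) (𝓝[≠] 0) (𝓝[≠] z) := by
    refine tendsto_nhdsWithin_iff.2 ⟨?_, ?_⟩
    · have : Continuous fun t : ℝ => z + t * Complex.I := by fun_prop
      simpa using (this.tendsto 0).mono_left nhdsWithin_le_nhds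
    · filter_upwards [self_mem_nhdsWithin] with t ht
      simpa using ht
  refine h.frequently (Eventually.frequently ?_)
  by_cases hz : z.im = 0
  · filter_upwards [self_mem_nhdsWithin] with t ht
    simpa [hz] using ht
  · have : Continuous fun t : ℝ => (z + t * Complex.I).im := by fun_prop
    refine (this.continuousAt (x := 0)).eventually_ne (by simpa using hz) |>.filter_mono
      nhdsWithin_le_nhds

theorem IsHalfLine.finrank_eq_one (hl : IsHalfLine J a σ) (hV : LocallyIntegrable V volume)
    (hlp : LimitPoint V J) {z : ℂ} (hz : z ∈ regularType V J) :
    Module.finrank ℂ (defect V J z) = 1 := by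
  obtain ⟨w, hw, h⟩ := ((frequently_im_ne_zero z).and_eventually
    ((hl.eventually_finrank_eq hV hz).filter_mono nhdsWithin_le_nhds)).exists
  rw [← h, hl.finrank_eq_one_of_im_ne_zero hV hlp hw]

/-- `p` spans the kernel of `A* - z`. -/
structure SpansKer (V : ℝ → ℝ) (J : Set ℝ) [J.OrdConnected] (z : ℂ) (p : L2 J × L2 J) : Prop where
  mem : p ∈ maxOp V J
  eqn : p.2 = z • p.1
  ne_zero : p ≠ 0
  span : ∀ r ∈ maxOp V J, r.2 = z • r.1 → ∃ k : ℂ, r = k • p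

/-- Near a point of regular type, the kernels of `A* - z` are spanned by an analytic family. -/
theorem IsHalfLine.exists_spansKer (hl : IsHalfLine J a σ) (hV : LocallyIntegrable V volume)
    (hlp : LimitPoint V J) {z₀ : ℂ} (hz₀ : z₀ ∈ regularType V J) :
    ∃ γ : ℂ → L2 J × L2 J, AnalyticAt ℂ γ z₀ ∧ ∀ᶠ z in 𝓝 z₀, SpansKer V J z (γ z) := by
  have : CompleteSpace (maxOp V J) := (isClosed_maxOp hV hl.nonempty).completeSpace_coe
  obtain ⟨γ, hγ, h⟩ := exists_analytic_span_ker (hl.surjective_maxShift hV hz₀)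
    ((finrank_defect z₀).trans (hl.finrank_eq_one hV hlp hz₀))
  refine ⟨fun z => (maxOp V J).subtypeL (γ z), ((maxOp V J).subtypeL.analyticAt _).comp hγ, ?_⟩
  filter_upwards [h] with z ⟨h0, h1, h2⟩
  refine ⟨(γ z).2, maxShift_apply_eq_zero.1 h1, fun h => h0 (Subtype.ext h), fun r hr hz => ?_⟩
  obtain ⟨k, hk⟩ := h2 ⟨r, hr⟩ (maxShift_apply_eq_zero.2 hz)
  exact ⟨k, congrArg Subtype.val hk⟩

end

/-! ### Von Neumann's decomposition and Green's formula in the limit point case. -/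

section

variable {V : ℝ → ℝ} {J : Set ℝ} [hJ : J.OrdConnected] {a : ℝ} {σ : ℂ}

theorem IsHalfLine.exists_spansKer' (hl : IsHalfLine J a σ) (hV : LocallyIntegrable V volume)
    (hlp : LimitPoint V J) {z : ℂ} (hz : z ∈ regularType V J) : ∃ p, SpansKer V J z p :=
  let ⟨γ, _, h⟩ := hl.exists_spansKer hV hlp hz
  ⟨γ z, h.self_of_nhds⟩

/-- Von Neumann's decomposition of the domain of the maximal operator. -/
theorem exists_minOp_add (hV : LocallyIntegrable V volume) (hne : (interior J).Nonempty)
    {γ η : L2 J × L2 J} (hγ : SpansKer V J Complex.I γ) (hη : SpansKer V J (-Complex.I) η)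
    {p : L2 J × L2 J} (hp : p ∈ maxOp V J) :
    ∃ q ∈ minOp V J, ∃ α β : ℂ, p = q + α • γ + β • η := by
  have hr : Complex.I ∈ regularType V J := mem_regularType_of_im_ne_zero hV hne (by simp)
  set D := (shiftMap J Complex.I).comp (minOp V J).subtypeL with hD
  have hcl : IsClosed (D.range : Set (L2 J)) := mem_regularType_iff.1 hr
  have : CompleteSpace D.range := hcl.completeSpace_coe
  -- `(A* - i) p` is split along the closed range of `A - i` and its orthogonal complement, which is
  -- the kernel of `A* + i`.
  obtain ⟨y, hy, e, he, hye⟩ := D.range.exists_add_mem_mem_orthogonal (p.2 - Complex.I • p.1)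
  obtain ⟨q, rfl⟩ := hy
  have hq : D q = (q : L2 J × L2 J).2 - Complex.I • (q : L2 J × L2 J).1 := rfl
  have hem : (e, -Complex.I • e) ∈ maxOp V J := by
    refine mem_maxOp_of_adjoint hV hne fun r hr => ?_
    have h1 : inner ℂ (D ⟨r, Submodule.le_topologicalClosure _ hr⟩) e = 0 :=
      he _ ⟨⟨r, Submodule.le_topologicalClosure _ hr⟩, rfl⟩
    have h2 : D ⟨r, Submodule.le_topologicalClosure _ hr⟩ = r.2 - Complex.I • r.1 := rfl
    rw [h2, inner_sub_left, inner_smul_left, Complex.conj_I, sub_eq_zero] at h1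
    rw [inner_smul_right, h1]
  obtain ⟨k, hk⟩ := hη.span _ hem rfl
  have hmin := minOp_le_maxOp hV hne
  -- On `e` the operator `A* - i` acts as `-2i`; the factor `1 / (2i)` cancels the remaining `e` and
  -- leaves an element of the kernel of `A* - i`.
  have hm : p - q + (1 / (2 * Complex.I)) • (e, -Complex.I • e) ∈ maxOp V J :=
    (maxOp V J).add_mem ((maxOp V J).sub_mem hp (hmin q.2)) ((maxOp V J).smul_mem _ hem)
  obtain ⟨α, hα⟩ := hγ.span _ hm (by
    change p.2 - (q : L2 J × L2 J).2 + (1 / (2 * Complex.I)) • (-Complex.I • e) =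
      Complex.I • (p.1 - (q : L2 J × L2 J).1 + (1 / (2 * Complex.I)) • e)
    have h3 : p.2 = Complex.I • p.1 + ((q : L2 J × L2 J).2 - Complex.I • (q : L2 J × L2 J).1 + e) := by
      rw [← hq]; exact (sub_eq_iff_eq_add'.1 hye)
    rw [h3]
    have h4 : (1 / (2 * Complex.I)) • (-Complex.I • e) = -(1 / 2 : ℂ) • e := by
      rw [smul_smul]; congr 1; field_simp
    have h5 : Complex.I • ((1 / (2 * Complex.I)) • e) = (1 / 2 : ℂ) • e := by
      rw [smul_smul]; congr 1; field_simp
    rw [smul_add, smul_sub, h4, h5]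
    have h6 : e = (1 / 2 : ℂ) • e + (1 / 2 : ℂ) • e := by rw [← add_smul]; norm_num
    nth_rewrite 1 [h6]
    rw [neg_smul]
    abel)
  refine ⟨q, q.2, α, -(1 / (2 * Complex.I) * k), ?_⟩
  have h7 : (-(1 / (2 * Complex.I) * k)) • η =
      -((1 / (2 * Complex.I)) • (e, -Complex.I • e)) := by rw [hk, smul_smul, neg_smul]
  rw [h7, ← hα]
  abel

/-- The maximal domain exceeds the minimal one by at most two dimensions, spanned by the defect
elements, while the Cauchy data already map onto `ℂ²`. So the data are injective modulo the minimal
operator. -/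
theorem IsHalfLine.mem_minOp (hl : IsHalfLine J a σ) (hV : LocallyIntegrable V volume)
    (hlp : LimitPoint V J) {Γ : L2 J × L2 J →L[ℂ] ℂ × ℂ} (hΓ : IsBoundaryMap V J a Γ)
    {p : L2 J × L2 J} (hp : p ∈ maxOp V J) (h0 : Γ p = 0) : p ∈ minOp V J := by
  have hr : ∀ z : ℂ, z.im ≠ 0 → z ∈ regularType V J := fun z hz =>
    mem_regularType_of_im_ne_zero hV hl.nonempty hz
  obtain ⟨γ, hγ⟩ := hl.exists_spansKer' hV hlp (hr Complex.I (by simp))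
  obtain ⟨η, hη⟩ := hl.exists_spansKer' hV hlp (hr (-Complex.I) (by simp))
  have key : ∀ p ∈ maxOp V J, ∃ q ∈ minOp V J, ∃ α β : ℂ, p = q + α • γ + β • η ∧
      Γ p = (α * (Γ γ).1 + β * (Γ η).1, α * (Γ γ).2 + β * (Γ η).2) := by
    intro p hp
    obtain ⟨q, hq, α, β, rfl⟩ := exists_minOp_add hV hl.nonempty hγ hη hp
    refine ⟨q, hq, α, β, rfl, ?_⟩
    rw [map_add, map_add, map_smul, map_smul, hΓ.eq_zero hq, zero_add]
    rfl
  have hsurj : ∀ u v : ℂ, ∃ α β : ℂ, α * (Γ γ).1 + β * (Γ η).1 = u ∧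
      α * (Γ γ).2 + β * (Γ η).2 = v := by
    intro u v
    obtain ⟨q, W, W', hq, hu, hv, -⟩ := exists_isRep_compact (J := J) hV a u v
    obtain ⟨-, -, α, β, -, h⟩ := key q (hq.mem_maxOp hl.nonempty)
    rw [hΓ.apply_eq hq, hu, hv, Prod.mk.injEq] at h
    exact ⟨α, β, h.1.symm, h.2.symm⟩
  obtain ⟨x₁, y₁, h1, h2⟩ := hsurj 1 0
  obtain ⟨x₂, y₂, h3, h4⟩ := hsurj 0 1
  -- Multiplicativity of the determinant: the matrix of Cauchy data of `γ` and `η` has an inverse.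
  have hdet : (x₁ * y₂ - x₂ * y₁) * ((Γ γ).1 * (Γ η).2 - (Γ γ).2 * (Γ η).1) = 1 := by
    linear_combination (x₂ * (Γ γ).2 + y₂ * (Γ η).2) * h1 - (x₂ * (Γ γ).1 + y₂ * (Γ η).1) * h2 + h4
  have hdet0 : (Γ γ).1 * (Γ η).2 - (Γ γ).2 * (Γ η).1 ≠ 0 := right_ne_zero_of_mul_eq_one hdet
  obtain ⟨q, hq, α, β, rfl, h⟩ := key p hp
  rw [h, Prod.mk_eq_zero] at h0
  have hα : α = 0 := (mul_eq_zero.1 (show α * ((Γ γ).1 * (Γ η).2 - (Γ γ).2 * (Γ η).1) = 0 by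
    linear_combination (Γ η).2 * h0.1 - (Γ η).1 * h0.2)).resolve_right hdet0
  have hβ : β = 0 := (mul_eq_zero.1 (show β * ((Γ γ).1 * (Γ η).2 - (Γ γ).2 * (Γ η).1) = 0 by
    linear_combination (Γ γ).1 * h0.2 - (Γ γ).2 * h0.1)).resolve_right hdet0
  simpa [hα, hβ] using hq

/-- Green's formula in the limit point case: there is no contribution from infinity. -/
theorem IsHalfLine.green_limitPoint (hl : IsHalfLine J a σ) (hV : LocallyIntegrable V volume)
    (hlp : LimitPoint V J) {Γ : L2 J × L2 J →L[ℂ] ℂ × ℂ} (hΓ : IsBoundaryMap V J a Γ)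
    {p q : L2 J × L2 J} (hp : p ∈ maxOp V J) (hq : q ∈ maxOp V J) :
    inner ℂ q.2 p.1 - inner ℂ q.1 p.2 =
      σ * (starRingEnd ℂ (Γ q).2 * (Γ p).1 - starRingEnd ℂ (Γ q).1 * (Γ p).2) := by
  -- A compactly supported `w` with the data of `q` differs from `q` by an element of the minimal
  -- operator, which contributes nothing.
  obtain ⟨w, W, W', hw, hu, hv, R, hR⟩ := exists_isRep_compact (J := J) hV a (Γ q).1 (Γ q).2
  obtain ⟨F, G, hr⟩ := exists_isRep hV hl.nonempty hp
  have hm : q - w ∈ minOp V J := by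
    refine hl.mem_minOp hV hlp hΓ ((maxOp V J).sub_mem hq (hw.mem_maxOp hl.nonempty)) ?_
    rw [map_sub, hΓ.apply_eq hw, hu, hv]
    exact sub_self _
  have h1 := inner_eq_of_mem_minOp hV hl.nonempty hp hm
  have h2 := hl.green hr hw hR
  rw [hu, hv] at h2
  rw [hΓ.apply_eq hr]
  simp only [Prod.fst_sub, Prod.snd_sub, inner_sub_left] at h1
  linear_combination h1 + h2

/-- The imaginary part of the boundary form of a square integrable solution. -/
theorem IsHalfLine.im_boundary (hl : IsHalfLine J a σ) (hV : LocallyIntegrable V volume)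
    (hlp : LimitPoint V J) {Γ : L2 J × L2 J →L[ℂ] ℂ × ℂ} (hΓ : IsBoundaryMap V J a Γ)
    {p : L2 J × L2 J} (hp : p ∈ maxOp V J) {z : ℂ} (hz : p.2 = z • p.1) :
    (starRingEnd ℂ (Γ p).1 * (σ * (Γ p).2)).im = z.im * ‖p.1‖ ^ 2 := by
  have h := hl.green_limitPoint hV hlp hΓ hp hp
  rw [hz, inner_smul_left, inner_smul_right, inner_self_eq_norm_sq_to_K] at h
  have h1 := congrArg Complex.im h
  have hσ : σ.im = 0 := Complex.conj_eq_iff_im.1 hl.conj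
  simp only [Complex.sub_im, Complex.mul_im, Complex.mul_re, Complex.conj_im, Complex.conj_re,
    Complex.sub_re, hσ] at h1 ⊢
  simp [← Complex.ofReal_pow] at h1 ⊢
  linarith

end

/-! ### The Weyl quotient and its boundary condition. -/

section

/-- Two functions that are meromorphic in normal form and agree off the real line agree. -/
theorem eventuallyEq_of_meromorphicNFAt {f g : ℂ → ℂ} {z : ℂ} (hf : MeromorphicNFAt f z)
    (hg : MeromorphicNFAt g z) (h : ∀ w : ℂ, w.im ≠ 0 → f w = g w) : f =ᶠ[𝓝 z] g := by
  rw [← hf.eventuallyEq_nhdsNE_iff_eventuallyEq_nhds hg]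
  have hm : MeromorphicAt (f - g) z := hf.meromorphicAt.sub hg.meromorphicAt
  rcases hm.eventually_eq_zero_or_eventually_ne_zero with h0 | h0
  · filter_upwards [h0] with w hw using sub_eq_zero.1 hw
  · obtain ⟨w, hw, hw'⟩ := ((frequently_im_ne_zero z).and_eventually h0).exists
    exact absurd (sub_eq_zero.2 (h w hw)) hw'

variable {V : ℝ → ℝ} {J : Set ℝ} [hJ : J.OrdConnected] {a : ℝ} {σ : ℂ}

open Classical in
/-- The quotient `σ f'(a) / f(a)` of a square integrable solution `f`; it is `0` if `f(a) = 0`. -/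
noncomputable def weylQuot (V : ℝ → ℝ) (J : Set ℝ) [J.OrdConnected] (σ : ℂ)
    (Γ : L2 J × L2 J →L[ℂ] ℂ × ℂ) (z : ℂ) : ℂ :=
  if h : ∃ p, SpansKer V J z p then σ * (Γ h.choose).2 / (Γ h.choose).1 else 0

theorem weylQuot_eq (σ : ℂ) (Γ : L2 J × L2 J →L[ℂ] ℂ × ℂ) {z : ℂ} {p : L2 J × L2 J}
    (hp : SpansKer V J z p) : weylQuot V J σ Γ z = σ * (Γ p).2 / (Γ p).1 := by
  have h : ∃ p, SpansKer V J z p := ⟨p, hp⟩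
  rw [weylQuot, dif_pos h]
  obtain ⟨k, hk⟩ := hp.span _ h.choose_spec.mem h.choose_spec.eqn
  have hk0 : k ≠ 0 := fun h0 => h.choose_spec.ne_zero (by rw [hk, h0, zero_smul])
  rw [hk, map_smul, Prod.smul_snd, Prod.smul_fst, smul_eq_mul, smul_eq_mul, mul_left_comm,
    mul_div_mul_left _ _ hk0]

/-- The setting of a half-line in the limit point case, with a boundary map. -/
structure Setting (V : ℝ → ℝ) (J : Set ℝ) [J.OrdConnected] (a : ℝ) (σ : ℂ)
    (Γ : L2 J × L2 J →L[ℂ] ℂ × ℂ) : Prop where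
  half : IsHalfLine J a σ
  loc : LocallyIntegrable V volume
  lp : LimitPoint V J
  bdry : IsBoundaryMap V J a Γ

namespace Setting

variable {Γ : L2 J × L2 J →L[ℂ] ℂ × ℂ} (hS : Setting V J a σ Γ)
include hS

theorem exists_spansKer {z : ℂ} (hz : z ∈ regularType V J) : ∃ p, SpansKer V J z p :=
  hS.half.exists_spansKer' hS.loc hS.lp hz

theorem mem_regularType {z : ℂ} (hz : z.im ≠ 0) : z ∈ regularType V J :=
  mem_regularType_of_im_ne_zero hS.loc hS.half.nonempty hz

theorem boundary_ne_zero {z : ℂ} {p : L2 J × L2 J} (hp : SpansKer V J z p) : Γ p ≠ 0 := fun h =>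
  hp.ne_zero (hS.half.eq_zero_of_mem_maxOp hS.loc hS.bdry hp.mem hp.eqn h)

theorem im_boundary {z : ℂ} {p : L2 J × L2 J} (hp : SpansKer V J z p) :
    (starRingEnd ℂ (Γ p).1 * (σ * (Γ p).2)).im = z.im * ‖p.1‖ ^ 2 :=
  hS.half.im_boundary hS.loc hS.lp hS.bdry hp.mem hp.eqn

/-- A vanishing boundary value would make the boundary form zero, whereas its imaginary part is `Im
z ‖p.1‖²`. -/
theorem fst_ne_zero {z : ℂ} (hz : z.im ≠ 0) {p : L2 J × L2 J} (hp : SpansKer V J z p) :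
    (Γ p).1 ≠ 0 := by
  intro h
  have h1 := hS.im_boundary hp
  rw [h, map_zero, zero_mul, Complex.zero_im, eq_comm, mul_eq_zero] at h1
  have h2 : p.1 = 0 := by simpa [hz] using h1
  exact hp.ne_zero (Prod.ext h2 (by rw [hp.eqn, h2, smul_zero]; rfl))

/-- The quotient is the boundary form divided by `|f(a)|²`, and the form has imaginary part `Im z
‖p.1‖²`. -/
theorem weylQuot_im_nonneg {z : ℂ} (hz : 0 < z.im) : 0 ≤ (weylQuot V J σ Γ z).im := by
  obtain ⟨p, hp⟩ := hS.exists_spansKer (hS.mem_regularType hz.ne')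
  have h0 := hS.fst_ne_zero hz.ne' hp
  have e : weylQuot V J σ Γ z = starRingEnd ℂ (Γ p).1 * (σ * (Γ p).2) *
      ((‖(Γ p).1‖ ^ 2)⁻¹ : ℝ) := by
    rw [weylQuot_eq σ Γ hp, div_eq_mul_inv, Complex.inv_def, Complex.normSq_eq_norm_sq]
    ring
  rw [e, Complex.im_mul_ofReal, hS.im_boundary hp]
  positivity

/-- As `V` is real, conjugation maps the kernel at `z` into the kernel at `conj z`;
one-dimensionality there turns a nonzero element into a spanning one. -/
theorem spansKer_star {z : ℂ} {p : L2 J × L2 J} (hp : SpansKer V J z p)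
    (hz : starRingEnd ℂ z ∈ regularType V J) :
    ∃ q, SpansKer V J (starRingEnd ℂ z) q ∧
      Γ q = (starRingEnd ℂ (Γ p).1, starRingEnd ℂ (Γ p).2) := by
  obtain ⟨F, G, hr⟩ := exists_isRep hS.loc hS.half.nonempty hp.mem
  have hΓ : Γ (star p.1, star p.2) = (starRingEnd ℂ (Γ p).1, starRingEnd ℂ (Γ p).2) := by
    rw [hS.bdry.apply_eq hr.star, hS.bdry.apply_eq hr]
  have hmem := hr.star.mem_maxOp hS.half.nonempty
  have heq : star p.2 = starRingEnd ℂ z • star p.1 := by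
    rw [hp.eqn]
    refine Lp.ext ?_
    filter_upwards [Lp.coeFn_star (z • p.1), Lp.coeFn_smul z p.1, Lp.coeFn_star p.1,
      Lp.coeFn_smul (starRingEnd ℂ z) (star p.1)] with x e1 e2 e3 e4
    rw [e1, e4, Pi.star_apply, e2, Pi.smul_apply, Pi.smul_apply, e3, Pi.star_apply]
    simp
  refine ⟨_, ⟨hmem, heq, fun h => hS.boundary_ne_zero hp ?_, fun r hr hre => ?_⟩, hΓ⟩
  · rw [h, map_zero] at hΓ
    have h1 := congrArg Prod.fst hΓ
    have h2 := congrArg Prod.snd hΓ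
    exact Prod.ext (by simpa using h1.symm) (by simpa using h2.symm)
  · obtain ⟨q, hq⟩ := hS.exists_spansKer hz
    obtain ⟨k, hk⟩ := hq.span _ hmem heq
    obtain ⟨l, hl⟩ := hq.span _ hr hre
    have hk0 : k ≠ 0 := fun h0 => hS.boundary_ne_zero hp (by
      rw [hk, h0, zero_smul, map_zero] at hΓ
      have h1 := congrArg Prod.fst hΓ
      have h2 := congrArg Prod.snd hΓ
      exact Prod.ext (by simpa using h1.symm) (by simpa using h2.symm))
    exact ⟨l * k⁻¹, by rw [hk, smul_smul, inv_mul_cancel_right₀ hk0, hl]⟩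

theorem weylQuot_conj {z : ℂ} (hz : z.im ≠ 0) :
    weylQuot V J σ Γ (starRingEnd ℂ z) = starRingEnd ℂ (weylQuot V J σ Γ z) := by
  obtain ⟨p, hp⟩ := hS.exists_spansKer (hS.mem_regularType hz)
  obtain ⟨q, hq, hΓ⟩ := hS.spansKer_star hp (hS.mem_regularType (by simpa using hz))
  rw [weylQuot_eq σ Γ hp, weylQuot_eq σ Γ hq, hΓ, map_div₀, map_mul, hS.half.conj]

theorem exists_quotient {z₀ : ℂ} (hz₀ : z₀ ∈ regularType V J) :
    ∃ γ : ℂ → L2 J × L2 J, (∀ᶠ z in 𝓝 z₀, SpansKer V J z (γ z)) ∧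
      AnalyticAt ℂ (fun z => σ * (Γ (γ z)).2) z₀ ∧ AnalyticAt ℂ (fun z => (Γ (γ z)).1) z₀ ∧
      weylQuot V J σ Γ =ᶠ[𝓝 z₀] (fun z => σ * (Γ (γ z)).2) / fun z => (Γ (γ z)).1 := by
  obtain ⟨γ, hγ, h⟩ := hS.half.exists_spansKer hS.loc hS.lp hz₀
  have hΓγ : AnalyticAt ℂ (fun z => Γ (γ z)) z₀ := (Γ.analyticAt _).comp hγ
  refine ⟨γ, h, analyticAt_const.mul (((ContinuousLinearMap.snd ℂ ℂ ℂ).analyticAt _).comp hΓγ),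
    ((ContinuousLinearMap.fst ℂ ℂ ℂ).analyticAt _).comp hΓγ, ?_⟩
  filter_upwards [h] with z hz using weylQuot_eq σ Γ hz

/-- Locally a quotient of analytic functions without common zero, since nonzero Cauchy data cannot
vanish in both entries. The value 0 of division by zero is the convention of the normal form at a
pole. -/
theorem meromorphicNFAt_weylQuot {z₀ : ℂ} (hz₀ : z₀ ∈ regularType V J) :
    MeromorphicNFAt (weylQuot V J σ Γ) z₀ := by
  obtain ⟨γ, h, hf, hg, he⟩ := hS.exists_quotient hz₀
  rw [meromorphicNFAt_congr he]
  refine MeromorphicNFOn.div hf hg.meromorphicNFAt ?_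
  by_contra! h0
  exact hS.boundary_ne_zero h.self_of_nhds
    (Prod.ext h0.1 ((mul_eq_zero.1 h0.2).resolve_left hS.half.ne_zero))

/-- The Weyl quotient has a pole exactly where the square integrable solution vanishes at `a`. -/
theorem order_nonneg_iff {z₀ : ℂ} (hz₀ : z₀ ∈ regularType V J) {p : L2 J × L2 J}
    (hp : SpansKer V J z₀ p) : 0 ≤ meromorphicOrderAt (weylQuot V J σ Γ) z₀ ↔ (Γ p).1 ≠ 0 := by
  obtain ⟨γ, h, hf, hg, he⟩ := hS.exists_quotient hz₀
  have hiff : (Γ p).1 ≠ 0 ↔ (Γ (γ z₀)).1 ≠ 0 := by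
    obtain ⟨k, hk⟩ := h.self_of_nhds.span _ hp.mem hp.eqn
    have hk0 : k ≠ 0 := fun h0 => hp.ne_zero (by rw [hk, h0, zero_smul])
    rw [hk, map_smul, Prod.smul_fst, smul_eq_mul, mul_ne_zero_iff]
    simp [hk0]
  rw [(hS.meromorphicNFAt_weylQuot hz₀).meromorphicOrderAt_nonneg_iff_analyticAt, hiff]
  constructor
  -- If the quotient were analytic, quotient times denominator minus numerator would vanish at
  -- non-real points accumulating at `z₀`, hence at `z₀`; then both Cauchy data would be zero.
  · intro han h0
    have h1 : AnalyticAt ℂ (fun z => weylQuot V J σ Γ z * (Γ (γ z)).1 - σ * (Γ (γ z)).2) z₀ :=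
      (han.mul hg).sub hf
    have h2 : ∃ᶠ z in 𝓝[≠] z₀, weylQuot V J σ Γ z * (Γ (γ z)).1 - σ * (Γ (γ z)).2 = 0 := by
      refine ((frequently_im_ne_zero z₀).and_eventually
        (((he.and h).filter_mono nhdsWithin_le_nhds))).mono fun z ⟨hz, hez, hsz⟩ => ?_
      rw [hez, Pi.div_apply, div_mul_cancel₀ _ (hS.fst_ne_zero hz hsz), sub_self]
    have h3 := (h1.frequently_zero_iff_eventually_zero.1 h2).self_of_nhds
    rw [h0, mul_zero, zero_sub, neg_eq_zero, mul_eq_zero] at h3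
    exact hS.boundary_ne_zero h.self_of_nhds (Prod.ext h0 (h3.resolve_left hS.half.ne_zero))
  · intro h0
    exact (hf.div hg h0).congr he.symm

/-- The boundary condition given by the Weyl quotient characterises the Cauchy data of square
integrable solutions. -/
theorem exists_smul_iff {z : ℂ} (hz : z ∈ regularType V J) {p : L2 J × L2 J}
    (hp : SpansKer V J z p) (x y : ℂ) :
    (∃ k : ℂ, (x, y) = k • Γ p) ↔
      (0 ≤ meromorphicOrderAt (weylQuot V J σ Γ) z → y - σ * weylQuot V J σ Γ z * x = 0) ∧
      (meromorphicOrderAt (weylQuot V J σ Γ) z < 0 → x = 0) := by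
  have ho := hS.order_nonneg_iff hz hp
  by_cases h0 : (Γ p).1 = 0
  · have h1 : meromorphicOrderAt (weylQuot V J σ Γ) z < 0 := by
      rw [← not_le, ho]; simpa using h0
    have h2 : (Γ p).2 ≠ 0 := fun h => hS.boundary_ne_zero hp (Prod.ext h0 h)
    constructor
    · rintro ⟨k, hk⟩
      refine ⟨fun h => absurd h (not_le.2 h1), fun _ => ?_⟩
      rw [show x = k * (Γ p).1 from congrArg Prod.fst hk, h0, mul_zero]
    · rintro ⟨-, h⟩
      exact ⟨y / (Γ p).2, Prod.ext (by simp [h0, h h1]) (by simp [h2])⟩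
  · have h1 : 0 ≤ meromorphicOrderAt (weylQuot V J σ Γ) z := ho.2 h0
    have h2 : σ * weylQuot V J σ Γ z = (Γ p).2 / (Γ p).1 := by
      rw [weylQuot_eq σ Γ hp, ← mul_div_assoc, ← mul_assoc, hS.half.sq, one_mul]
    rw [h2]
    constructor
    · rintro ⟨k, hk⟩
      refine ⟨fun _ => ?_, fun h => absurd h1 (not_le.2 h)⟩
      rw [show x = k * (Γ p).1 from congrArg Prod.fst hk,
        show y = k * (Γ p).2 from congrArg Prod.snd hk]
      field_simp
      ring
    · rintro ⟨h, -⟩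
      refine ⟨x / (Γ p).1, Prod.ext (by simp [h0]) ?_⟩
      rw [sub_eq_zero.1 (h h1)]
      simp only [Prod.smul_snd, smul_eq_mul]
      ring

end Setting

theorem Regular.exists_isRep (hV : LocallyIntegrable V volume) {f h : ℝ → ℂ} (hf : Regular J f)
    (mf : MemLp f 2 (volume.restrict J)) (mh : MemLp h 2 (volume.restrict J))
    (he : expr V J f =ᵐ[volume.restrict J] h) (ha : a ∈ J) :
    ∃ F G, IsRep V J (mf.toLp, mh.toLp) F G ∧ EqOn F f J ∧ EqOn G (derivWithin f J) J := by
  obtain ⟨F, G, hs, h1, h2⟩ := hf.exists_isSol hV (locallyIntegrable_indicator mh.toLp)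
    (he.trans (mh.coeFn_toLp.symm.trans (indicator_ae_restrict .rfl).symm)) ha
  refine ⟨F, G, isRep_of_isSol_indicator hs (mf.coeFn_toLp.trans ?_), h1, h2⟩
  filter_upwards [ae_restrict_mem hJ.measurableSet] with x hx using (h1 hx).symm

/-- The Cauchy data at `a` of a square integrable solution on the half-line. -/
theorem Setting.exists_smul_of_solution {Γ : L2 J × L2 J →L[ℂ] ℂ × ℂ} (hS : Setting V J a σ Γ)
    {z : ℂ} {p : L2 J × L2 J} (hp : SpansKer V J z p) {f : ℝ → ℂ} (hf : Regular J f)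
    (mf : MemLp f 2 (volume.restrict J)) (he : ∀ᵐ x ∂(volume.restrict J), expr V J f x = z * f x) :
    ∃ k : ℂ, (f a, derivWithin f J a) = k • Γ p := by
  obtain ⟨F, G, hr, h1, h2⟩ := hf.exists_isRep hS.loc mf (mf.const_mul z) he hS.half.mem
  obtain ⟨k, hk⟩ := hp.span _ (hr.mem_maxOp hS.half.nonempty) (MemLp.toLp_const_smul z mf)
  refine ⟨k, ?_⟩
  rw [← map_smul, ← hk, hS.bdry.apply_eq hr, h1 hS.half.mem, h2 hS.half.mem]

/-- A solution on the line whose Cauchy data at `a` are those of a square integrable solution on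
the half-line is square integrable there. -/
theorem Setting.memLp_of_smul {Γ : L2 J × L2 J →L[ℂ] ℂ × ℂ} (hS : Setting V J a σ Γ)
    {z : ℂ} {p : L2 J × L2 J} (hp : SpansKer V J z p) {h F G : ℝ → ℂ}
    (hs : IsSol (fun x => cpot V x - z) h F G) (h0 : ∀ᵐ x, x ∈ J → h x = 0) {k : ℂ}
    (hk : (F a, G a) = k • Γ p) : MemLp F 2 (volume.restrict J) := by
  obtain ⟨F₁, G₁, hr⟩ := exists_isRep hS.loc hS.half.nonempty hp.mem
  obtain ⟨h₁, hs₁, h₁0⟩ := hr.isSol_shift (z := z) (w := 0) (by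
    rw [hp.eqn, sub_self]; exact Lp.coeFn_zero _ _ _)
  rw [hS.bdry.apply_eq hr] at hk
  have hd := hs.sub (hs₁.const_smul k)
  have h2 : ∀ x ∈ J, F x = k * F₁ x := fun x hx => by
    refine sub_eq_zero.1 (hd.eqOn_zero (K := J) ?_ hS.half.mem ?_ ?_ hx).1
    · filter_upwards [h0, h₁0] with t e1 e2 ht
      simp [e1 ht, e2 ht]
    · exact sub_eq_zero.2 (congrArg Prod.fst hk)
    · exact sub_eq_zero.2 (congrArg Prod.snd hk)
  obtain ⟨_, _, h3, _⟩ := hr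
  refine ((Lp.memLp p.1).const_mul k).ae_eq ?_
  filter_upwards [h3, ae_restrict_mem hJ.measurableSet] with x e1 hx
  rw [h2 x hx, e1]

end

/-! ### Solutions of the shifted equation, and the identification of the Weyl-Titchmarsh
coefficient. -/

section

section Shift

variable {V : ℝ → ℝ} {J : Set ℝ} [hJ : J.OrdConnected] {z : ℂ} {h F G : ℝ → ℂ}

theorem IsSol.unshift (hs : IsSol (fun x => cpot V x - z) h F G) :
    IsSol (cpot V) (fun x => h x + z * F x) F G := by
  simpa using hs.shift (-z)

theorem IsSol.expr_sub_ae (hs : IsSol (fun x => cpot V x - z) h F G)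
    (hne : (interior J).Nonempty) :
    ∀ᵐ x ∂(volume.restrict J), expr V J F x - z * F x = h x := by
  filter_upwards [hs.unshift.expr_ae (uniqueDiffOn_of_interior hne) hJ.measurableSet] with x hx
  rw [hx]; ring

theorem locallyIntegrable_cpot_sub (hV : LocallyIntegrable V volume) (z : ℂ) :
    LocallyIntegrable (fun x => cpot V x - z) volume :=
  (locallyIntegrable_cpot hV).sub (locallyIntegrable_const z)

theorem IsSol.eqOn {q h₁ F₁ G₁ : ℝ → ℂ} (hs : IsSol q h F G) (hs₁ : IsSol q h₁ F₁ G₁)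
    (he : ∀ᵐ x, x ∈ J → h x = h₁ x) {a : ℝ} (ha : a ∈ J) (hF : F a = F₁ a) (hG : G a = G₁ a) :
    EqOn F F₁ J ∧ EqOn G G₁ J := by
  have key := fun x (hx : x ∈ J) => (hs.sub hs₁).eqOn_zero (K := J) (by
    filter_upwards [he] with t ht htJ using sub_eq_zero.2 (ht htJ)) ha (sub_eq_zero.2 hF)
    (sub_eq_zero.2 hG) hx
  exact ⟨fun x hx => sub_eq_zero.1 (key x hx).1, fun x hx => sub_eq_zero.1 (key x hx).2⟩

/-- The spectral term moves into the potential, so that the right-hand side is `g` on the whole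
line. With `g` an indicator, the continuation outside the interval solves the homogeneous equation.
-/
theorem Regular.exists_isSol_shift (hV : LocallyIntegrable V volume) {f g : ℝ → ℂ}
    (hf : Regular J f) (mf : MemLp f 2 (volume.restrict J)) (hg : LocallyIntegrable g volume)
    (he : ∀ᵐ x ∂(volume.restrict J), expr V J f x - z * f x = g x) {a : ℝ} (ha : a ∈ J) :
    ∃ F G, IsSol (fun x => cpot V x - z) g F G ∧ EqOn F f J ∧ EqOn G (derivWithin f J) J := by
  have hl : LocallyIntegrable (J.indicator f) volume :=
    ((memLp_indicator_iff_restrict hJ.measurableSet).2 mf).locallyIntegrable (by norm_num)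
  obtain ⟨F₁, G₁, hs, h1, h2⟩ := hf.exists_isSol hV (h := fun x => g x + z * J.indicator f x)
    (hg.add (hl.smul z)) (by
      filter_upwards [he, ae_restrict_mem hJ.measurableSet] with x hx hxJ
      rw [indicator_of_mem hxJ, ← hx]; ring) ha
  obtain ⟨F, G, hs', hF, hG⟩ := TransparentBC.exists_isSol (locallyIntegrable_cpot_sub hV z) hg a
    (F₁ a) (G₁ a)
  obtain ⟨h3, h4⟩ := hs'.eqOn (J := J) (hs.shift z) (.of_forall fun x hx => by
    rw [indicator_of_mem hx, h1 hx]; ring) ha hF hG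
  exact ⟨F, G, hs', h3.trans h1, h4.trans h2⟩

theorem memLp_of_continuous {f : ℝ → ℂ} (hf : Continuous f) (a b : ℝ) :
    MemLp f 2 (volume.restrict (Icc a b)) := by
  obtain ⟨C, hC⟩ := isCompact_Icc.exists_bound_of_continuousOn hf.continuousOn (s := Icc a b)
  exact MemLp.of_bound hf.aestronglyMeasurable C
    ((ae_restrict_iff' measurableSet_Icc).2 (.of_forall hC))

theorem memLp_of_restrict {f : ℝ → ℂ} (hf : Continuous f) {a b : ℝ} (hab : a < b)
    (h1 : MemLp f 2 (volume.restrict (Iic a))) (h2 : MemLp f 2 (volume.restrict (Ici b))) :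
    MemLp f 2 volume := by
  have h3 : MemLp f 2 (volume.restrict (Ioo a b)) :=
    (memLp_of_continuous hf a b).mono_measure (Measure.restrict_mono Ioo_subset_Icc_self le_rfl)
  rw [← memLp_indicator_iff_restrict measurableSet_Iic] at h1
  rw [← memLp_indicator_iff_restrict measurableSet_Ici] at h2
  rw [← memLp_indicator_iff_restrict measurableSet_Ioo] at h3
  convert! (h1.add h3).add h2 using 1
  ext x
  simp only [Pi.add_apply, indicator, mem_Iic, mem_Ioo, mem_Ici]
  rcases le_or_gt x a with h | h
  · simp [h, not_lt.2 h, not_le.2 (h.trans_lt hab)]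
  · rcases le_or_gt b x with h' | h'
    · simp [not_le.2 h, h', not_lt.2 h']
    · simp [not_le.2 h, h, h', not_le.2 h']

theorem solvesLine_iff (hV : LocallyIntegrable V volume) {ψ : ℝ → ℂ} (hh : MemLp h 2 volume) :
    SolvesLine V z h ψ ↔ MemLp ψ 2 volume ∧ ∃ G, IsSol (fun x => cpot V x - z) h ψ G := by
  have hne : (interior (univ : Set ℝ)).Nonempty := by simp
  constructor
  · intro hl
    obtain ⟨F, G, hs, h1, -⟩ := hl.regular.exists_isSol_shift (z := z) hV
      (by simpa using hl.memLp) (hh.locallyIntegrable (by norm_num)) (by simpa using hl.eqn)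
      (mem_univ (0 : ℝ))
    obtain rfl : F = ψ := funext fun x => h1 (mem_univ x)
    exact ⟨hl.memLp, G, hs⟩
  · rintro ⟨hψ, G, hs⟩
    have he : ∀ᵐ x, expr V univ ψ x - z * ψ x = h x := by
      simpa using hs.expr_sub_ae (J := univ) hne
    refine ⟨hs.unshift.regular uniqueDiffOn_univ, hψ, (hh.add (hψ.const_mul z)).ae_eq ?_, he⟩
    filter_upwards [he] with x hx
    rw [Pi.add_apply, ← hx]; ring

end Shift

/-! ### The Weyl-Titchmarsh coefficient -/

namespace Setting

variable {V : ℝ → ℝ} {J : Set ℝ} [hJ : J.OrdConnected] {a : ℝ} {σ : ℂ}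
  {Γ : L2 J × L2 J →L[ℂ] ℂ × ℂ} (hS : Setting V J a σ Γ) {m : ℂ → ℂ}
include hS

/-- The solution `c + σ m(z) s` is square integrable with Cauchy data `(1, σ m(z))`, and these are
proportional to the data of the spanning element. -/
theorem weylTitchmarsh_eq (hm : IsWeylTitchmarsh V J a σ m) {z : ℂ} (hz : z.im ≠ 0) :
    m z = weylQuot V J σ Γ z := by
  obtain ⟨c, s, hc, hs, hL⟩ := hm.weyl z hz
  obtain ⟨p, hp⟩ := hS.exists_spansKer (hS.mem_regularType hz)
  set k := σ * m z with hk
  have hreg : Regular J (c + k • s) := hc.regular.add (hs.regular.const_smul k)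
  obtain ⟨l, hl⟩ := hS.exists_smul_of_solution hp hreg hL (by
    filter_upwards [expr_add V hc.regular (hs.regular.const_smul k), expr_smul V k hs.regular,
      hc.eqn, hs.eqn] with x e1 e2 e3 e4
    rw [e1, Pi.add_apply, e2, Pi.smul_apply, e3, e4, Pi.add_apply, Pi.smul_apply, smul_eq_mul,
      smul_eq_mul]
    ring)
  have hd : derivWithin (c + k • s) J a = k := by
    rw [← hc.regular.derivWithin_add (hs.regular.const_smul k) hS.half.mem, Pi.add_apply,
      ← hs.regular.derivWithin_smul k hS.half.mem, Pi.smul_apply, hc.deriv_value, hs.deriv_value]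
    simp
  have h1 : 1 = l * (Γ p).1 := by
    simpa [hc.value, hs.value] using congrArg Prod.fst hl
  have h2 : k = l * (Γ p).2 := by
    simpa [hd] using congrArg Prod.snd hl
  have h0 := hS.fst_ne_zero hz hp
  have h3 : m z = σ * k := by rw [hk, ← mul_assoc, hS.half.sq, one_mul]
  rw [weylQuot_eq σ Γ hp, h3, h2, eq_div_iff h0]
  linear_combination (-σ * (Γ p).2) * h1

theorem weylTitchmarsh_eventuallyEq (hm : IsWeylTitchmarsh V J a σ m) {z : ℂ}
    (hz : z ∈ regularType V J) : m =ᶠ[𝓝 z] weylQuot V J σ Γ :=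
  eventuallyEq_of_meromorphicNFAt (hm.meromorphic hz) (hS.meromorphicNFAt_weylQuot hz)
    fun _ hw => hS.weylTitchmarsh_eq hm hw

theorem isWeylTitchmarsh_weylQuot : IsWeylTitchmarsh V J a σ (weylQuot V J σ Γ) := by
  refine ⟨fun z hz => ?_, fun z hz => hS.meromorphicNFAt_weylQuot hz⟩
  have hU := uniqueDiffOn_of_interior (hJ := hJ) hS.half.nonempty
  have h0 : LocallyIntegrable (fun _ : ℝ => (0 : ℂ)) volume := locallyIntegrable_const 0
  have key : ∀ u v : ℂ, ∃ F G, IsSol (fun x => cpot V x - z) (fun _ => 0) F G ∧ F a = u ∧ G a = v ∧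
      SolvesIVP V J a z u v F := by
    intro u v
    obtain ⟨F, G, hs, hu, hv⟩ := exists_isSol (locallyIntegrable_cpot_sub hS.loc z) h0 a u v
    refine ⟨F, G, hs, hu, hv, hs.unshift.regular hU, ?_, hu, ?_⟩
    · filter_upwards [hs.expr_sub_ae (J := J) hS.half.nonempty] with x hx
      exact sub_eq_zero.1 hx
    · rw [← hs.derivWithin_eq hU hS.half.mem, hv]
  obtain ⟨c, c', hc, hc0, hc1, hci⟩ := key 1 0
  obtain ⟨s, s', hs, hs0, hs1, hsi⟩ := key 0 1
  refine ⟨c, s, hci, hsi, ?_⟩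
  obtain ⟨p, hp⟩ := hS.exists_spansKer (hS.mem_regularType hz)
  obtain ⟨k, hk⟩ := (hS.exists_smul_iff (hS.mem_regularType hz) hp 1
    (σ * weylQuot V J σ Γ z)).2 ⟨fun _ => by ring, fun h => absurd
      ((hS.order_nonneg_iff (hS.mem_regularType hz) hp).2 (hS.fst_ne_zero hz hp)) (not_le.2 h)⟩
  exact hS.memLp_of_smul hp (hc.add (hs.const_smul (σ * weylQuot V J σ Γ z)))
    (.of_forall fun x _ => by simp) (k := k) (by rw [← hk]; simp [hc0, hc1, hs0, hs1])

theorem analyticAt_weylQuot {z : ℂ} (hz : z.im ≠ 0) : AnalyticAt ℂ (weylQuot V J σ Γ) z := by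
  obtain ⟨p, hp⟩ := hS.exists_spansKer (hS.mem_regularType hz)
  rw [← (hS.meromorphicNFAt_weylQuot (hS.mem_regularType hz)
    ).meromorphicOrderAt_nonneg_iff_analyticAt, hS.order_nonneg_iff (hS.mem_regularType hz) hp]
  exact hS.fst_ne_zero hz hp

theorem herglotzOn (hm : IsWeylTitchmarsh V J a σ m) {Ω : Set ℂ} (hΩ : Ω ⊆ regularType V J) :
    HerglotzOn Ω m := by
  refine ⟨fun z hz => ?_, fun z hz => ?_, fun z hz => ?_, fun z hz => hm.meromorphic (hΩ hz)⟩
  · exact ((hS.analyticAt_weylQuot hz).congr (hS.weylTitchmarsh_eventuallyEq hm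
      (hS.mem_regularType hz)).symm).differentiableAt.differentiableWithinAt
  · rw [hS.weylTitchmarsh_eq hm hz, hS.weylTitchmarsh_eq hm (by simpa using hz), hS.weylQuot_conj hz]
  · rw [hS.weylTitchmarsh_eq hm hz.ne']
    exact hS.weylQuot_im_nonneg hz

/-- The boundary condition given by a Weyl-Titchmarsh coefficient, for solutions on the line. -/
theorem boundaryCondition_iff (hm : IsWeylTitchmarsh V J a σ m) {z : ℂ} (hz : z ∈ regularType V J)
    {h F G : ℝ → ℂ} (hs : IsSol (fun x => cpot V x - z) h F G) (h0 : ∀ᵐ x, x ∈ J → h x = 0) :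
    (0 ≤ meromorphicOrderAt m z → G a - σ * m z * F a = 0) ∧
      (meromorphicOrderAt m z < 0 → F a = 0) ↔ MemLp F 2 (volume.restrict J) := by
  have he := hS.weylTitchmarsh_eventuallyEq hm hz
  obtain ⟨p, hp⟩ := hS.exists_spansKer hz
  rw [meromorphicOrderAt_congr (he.filter_mono nhdsWithin_le_nhds), he.self_of_nhds,
    ← hS.exists_smul_iff hz hp]
  constructor
  · rintro ⟨k, hk⟩
    exact hS.memLp_of_smul hp hs h0 hk
  · intro hF
    have hU := uniqueDiffOn_of_interior (hJ := hJ) hS.half.nonempty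
    rw [hs.derivWithin_eq hU hS.half.mem]
    refine hS.exists_smul_of_solution hp (hs.unshift.regular hU) hF ?_
    filter_upwards [hs.expr_sub_ae (J := J) hS.half.nonempty,
      (ae_restrict_iff' hJ.measurableSet).2 h0] with x h1 h2
    rw [h2] at h1
    exact sub_eq_zero.1 h1

end Setting

end

section

variable {V : ℝ → ℝ} {z : ℂ}

/-! ### The resolvent set of the operator on the line -/

/-- The graph of the maximal operator is complete, so the bounded inverse theorem applies to `H - z`
on it. -/
theorem mem_resolventH_of_bijective (hV : LocallyIntegrable V volume)
    (hinj : ∀ p ∈ maxOp V univ, p.2 = z • p.1 → p = 0)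
    (hsurj : ∀ w : L2 univ, ∃ p ∈ maxOp V univ, p.2 - z • p.1 = w) : z ∈ resolventH V := by
  have : CompleteSpace (maxOp V univ) :=
    (isClosed_maxOp hV (by simp)).completeSpace_coe
  set D : maxOp V univ →L[ℂ] L2 univ := maxSnd V univ - z • maxFst V univ with hD
  have hDa : ∀ p, D p = (p : L2 univ × L2 univ).2 - z • (p : L2 univ × L2 univ).1 := fun p => rfl
  have h1 : D.ker = ⊥ := LinearMap.ker_eq_bot'.2 fun p hp =>
    Subtype.ext (hinj p p.2 (sub_eq_zero.1 hp))
  have h2 : D.range = ⊤ := LinearMap.range_eq_top.2 fun w => by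
    obtain ⟨p, hp, h⟩ := hsurj w
    exact ⟨⟨p, hp⟩, h⟩
  set e := ContinuousLinearEquiv.ofBijective D h1 h2 with he
  have he' : ∀ t, e t = D t := fun t => rfl
  refine ⟨(maxFst V univ).comp (e.symm : L2 univ →L[ℂ] maxOp V univ), fun h => ?_, fun p hp => ?_⟩
  · have h3 : (e.symm h : L2 univ × L2 univ).2 - z • (e.symm h : L2 univ × L2 univ).1 = h := by
      rw [← hDa, ← he', e.apply_symm_apply]
    have h4 : ((e.symm h : L2 univ × L2 univ).1, h + z • (e.symm h : L2 univ × L2 univ).1) =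
        (e.symm h : L2 univ × L2 univ) := Prod.ext rfl (sub_eq_iff_eq_add.1 h3).symm
    change ((e.symm h : L2 univ × L2 univ).1, h + z • (e.symm h : L2 univ × L2 univ).1) ∈ _
    rw [h4]
    exact (e.symm h).2
  · have h3 : e.symm (p.2 - z • p.1) = ⟨p, hp⟩ := by
      rw [ContinuousLinearEquiv.symm_apply_eq]; rfl
    change (e.symm (p.2 - z • p.1) : L2 univ × L2 univ).1 = p.1
    rw [h3]

/-- The resolvent set in terms of square integrable solutions on the line. -/
theorem mem_resolventH_iff (hV : LocallyIntegrable V volume) : z ∈ resolventH V ↔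
    (∀ F G, IsSol (fun x => cpot V x - z) (fun _ => 0) F G → MemLp F 2 volume → ∀ x, F x = 0) ∧
    ∀ h, MemLp h 2 volume → ∃ F G, IsSol (fun x => cpot V x - z) h F G ∧ MemLp F 2 volume := by
  have hne : (interior (univ : Set ℝ)).Nonempty := by simp
  constructor
  · rintro ⟨R, hR, hR'⟩
    refine ⟨fun F G hs mf => ?_, fun h mh => ?_⟩
    · have mf' : MemLp F 2 (volume.restrict univ) := by rwa [Measure.restrict_univ]
      have hr : IsRep V univ (mf'.toLp, z • mf'.toLp) F G := by
        refine ⟨_, hs.unshift, mf'.coeFn_toLp, ?_⟩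
        filter_upwards [Lp.coeFn_smul z mf'.toLp, mf'.coeFn_toLp] with x e1 e2
        rw [e1, Pi.smul_apply, e2, zero_add, smul_eq_mul]
      have h1 := hR' _ (hr.mem_maxOp hne)
      rw [sub_self, map_zero] at h1
      have h2 : F =ᵐ[volume] fun _ => 0 := by
        rw [← Measure.restrict_univ (μ := (volume : Measure ℝ))]
        filter_upwards [mf'.coeFn_toLp, Lp.coeFn_zero ℂ 2 (volume.restrict (univ : Set ℝ))]
          with x e1 e2
        rw [← e1, ← show 0 = mf'.toLp from h1, e2]; rfl
      exact congrFun (hs.continuous.ae_eq_iff_eq volume continuous_const |>.1 h2)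
    · have mh' : MemLp h 2 (volume.restrict univ) := by rwa [Measure.restrict_univ]
      obtain ⟨F, G, hr⟩ := exists_isRep hV hne (hR mh'.toLp)
      obtain ⟨k, hk, he⟩ := hr.isSol_shift (z := z) (w := h)
        (by rw [add_sub_cancel_right]; exact mh'.coeFn_toLp)
      obtain ⟨_, -, h1, -⟩ := hr
      refine ⟨F, G, hk.congr_rhs (he.mono fun x hx => hx (mem_univ x)), ?_⟩
      have := (Lp.memLp (R mh'.toLp)).ae_eq h1
      rwa [Measure.restrict_univ] at this
  · rintro ⟨h1, h2⟩
    refine mem_resolventH_of_bijective hV (fun p hp hz => ?_) fun w => ?_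
    · obtain ⟨F, G, hr⟩ := exists_isRep hV hne hp
      obtain ⟨k, hk, hk0⟩ := hr.isSol_shift (z := z) (w := 0) (by
        rw [hz, sub_self]; exact Lp.coeFn_zero _ _ _)
      have hs : IsSol (fun x => cpot V x - z) (fun _ => 0) F G :=
        hk.congr_rhs (hk0.mono fun x hx => hx (mem_univ x))
      have mF : MemLp F 2 volume := by
        obtain ⟨_, -, h3, -⟩ := hr
        simpa using (Lp.memLp p.1).ae_eq h3
      have hF := h1 F G hs mF
      have hF' : F = fun _ => 0 := funext hF
      refine hr.eq_zero hz (mem_univ 0) (hF 0) ?_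
      have := hs.hasDerivAt 0
      rw [hF'] at this
      exact this.unique (hasDerivAt_const _ _)
    · have mw : MemLp w 2 volume := by simpa using Lp.memLp w
      obtain ⟨F, G, hs, mF⟩ := h2 w mw
      have mF' : MemLp F 2 (volume.restrict univ) := by rwa [Measure.restrict_univ]
      have hr : IsRep V univ (mF'.toLp, w + z • mF'.toLp) F G := by
        refine ⟨_, hs.unshift, mF'.coeFn_toLp, ?_⟩
        filter_upwards [Lp.coeFn_add w (z • mF'.toLp), Lp.coeFn_smul z mF'.toLp, mF'.coeFn_toLp]
          with x e1 e2 e3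
        rw [e1, Pi.add_apply, e2, Pi.smul_apply, e3, smul_eq_mul]
      exact ⟨_, hr.mem_maxOp hne, add_sub_cancel_right _ _⟩

section HalfLine

variable {J : Set ℝ} [hJ : J.OrdConnected] {a : ℝ} {σ : ℂ}

theorem norm_toLp_indicator (f : L2 J) (hf : MemLp (J.indicator f) 2 (volume.restrict univ)) :
    ‖hf.toLp‖ = ‖f‖ := by
  rw [Lp.norm_toLp, Lp.norm_def, Measure.restrict_univ,
    eLpNorm_indicator_eq_eLpNorm_restrict hJ.measurableSet]

theorem IsHalfLine.exists_compl (hl : IsHalfLine J a σ) :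
    ∃ K : Set ℝ, K.OrdConnected ∧ a ∈ K ∧ (∀ x, x ∉ J → x ∈ K) ∧ ∀ x ∈ K, x ∈ J → x = a := by
  cases hl with
  | right => exact ⟨Iic a, ordConnected_Iic, self_mem_Iic, fun x hx => (not_le.1 hx : x < a).le,
      fun x h1 h2 => le_antisymm h1 h2⟩
  | left => exact ⟨Ici a, ordConnected_Ici, self_mem_Ici, fun x hx => (not_le.1 hx : a < x).le,
      fun x h1 h2 => le_antisymm h2 h1⟩

/-- Elements of the minimal operator have zero Cauchy data at `a`, so their extension by zero lies
in the domain of `H`. The norm of the resolvent then bounds the inverse of `A - z`. -/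
theorem IsHalfLine.resolventH_subset (hl : IsHalfLine J a σ) (hV : LocallyIntegrable V volume) :
    resolventH V ⊆ regularType V J := by
  rintro z ⟨R, -, hR⟩
  obtain ⟨Γ, hΓ⟩ := hl.exists_isBoundaryMap hV
  refine mem_regularType_of_bound (C := ‖R‖) fun p hp => ?_
  obtain ⟨F₁, G₁, hr⟩ := exists_isRep hV hl.nonempty (minOp_le_maxOp hV hl.nonempty hp)
  have h0 := hΓ.eq_zero hp
  rw [hΓ.apply_eq hr, Prod.mk_eq_zero] at h0
  obtain ⟨h₁, hs₁, e1, e2⟩ := hr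
  obtain ⟨F, G, hs, hF, hG⟩ := exists_isSol (locallyIntegrable_cpot hV)
    (locallyIntegrable_indicator p.2) a 0 0
  have m : ∀ f : L2 J, MemLp (J.indicator f) 2 (volume.restrict univ) := fun f => by
    rw [Measure.restrict_univ]; exact memLp_indicator f
  have hFJ : EqOn F F₁ J := (hs.eqOn (J := J) hs₁ (by
    filter_upwards [(ae_restrict_iff' hJ.measurableSet).1 e2] with x hx hxJ
    rw [indicator_of_mem hxJ, hx hxJ]) hl.mem (by rw [hF, h0.1]) (by rw [hG, h0.2])).1
  have hFJ' : ∀ x, x ∉ J → F x = 0 := by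
    obtain ⟨K, hK, haK, h1, h2⟩ := hl.exists_compl
    refine fun x hx => (hs.eqOn_zero (K := K) ?_ haK hF hG (h1 x hx)).1
    filter_upwards [(countable_singleton a).ae_notMem volume] with t ht htK
    exact indicator_of_notMem (fun htJ => ht (h2 t htK htJ)) _
  have hrep : IsRep V univ ((m p.1).toLp, (m p.2).toLp) F G := by
    refine ⟨_, hs, (m p.1).coeFn_toLp.trans ?_, (m p.2).coeFn_toLp⟩
    rw [Measure.restrict_univ]
    filter_upwards [(ae_restrict_iff' hJ.measurableSet).1 e1] with x hx
    by_cases hxJ : x ∈ J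
    · rw [indicator_of_mem hxJ, hx hxJ, hFJ hxJ]
    · rw [indicator_of_notMem hxJ, hFJ' x hxJ]
  have h3 := hR _ (hrep.mem_maxOp (by simp))
  have h4 : (m p.2).toLp - z • (m p.1).toLp = (m (p.2 - z • p.1)).toLp := by
    rw [← MemLp.toLp_const_smul, ← MemLp.toLp_sub]
    refine MemLp.toLp_congr _ _ ?_
    rw [Measure.restrict_univ]
    filter_upwards [(ae_restrict_iff' hJ.measurableSet).1 (Lp.coeFn_sub p.2 (z • p.1)),
      (ae_restrict_iff' hJ.measurableSet).1 (Lp.coeFn_smul z p.1)] with x e3 e4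
    by_cases hxJ : x ∈ J
    · rw [Pi.sub_apply, Pi.smul_apply, indicator_of_mem hxJ, indicator_of_mem hxJ,
        indicator_of_mem hxJ, e3 hxJ, Pi.sub_apply, e4 hxJ, Pi.smul_apply]
    · simp [hxJ]
  calc ‖p.1‖ = ‖R (m (p.2 - z • p.1)).toLp‖ := by rw [← h4, h3, norm_toLp_indicator]
    _ ≤ ‖R‖ * ‖(m (p.2 - z • p.1)).toLp‖ := R.le_opNorm _
    _ = _ := by rw [norm_toLp_indicator]

/-- Surjectivity of `A* - z` gives a solution on the half-line; the initial value problem at `a`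
continues it to the line. -/
theorem IsHalfLine.exists_isSol_memLp (hl : IsHalfLine J a σ) (hV : LocallyIntegrable V volume)
    (hz : z ∈ regularType V J) {h : ℝ → ℂ} (mh : MemLp h 2 volume) :
    ∃ F G, IsSol (fun x => cpot V x - z) h F G ∧ MemLp F 2 (volume.restrict J) := by
  obtain ⟨p, hp, he⟩ := hl.exists_maxOp_sub_eq hV hz (mh.restrict J).toLp
  obtain ⟨F₁, G₁, hr⟩ := exists_isRep hV hl.nonempty hp
  obtain ⟨k, hk, hkh⟩ := hr.isSol_shift (z := z) (w := h) (by rw [he]; exact MemLp.coeFn_toLp _)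
  obtain ⟨F, G, hs, hF, hG⟩ := exists_isSol (locallyIntegrable_cpot_sub hV z)
    (mh.locallyIntegrable (by norm_num)) a (F₁ a) (G₁ a)
  have h1 := (hk.eqOn (J := J) hs hkh hl.mem hF.symm hG.symm).1
  obtain ⟨_, -, h2, -⟩ := hr
  refine ⟨F, G, hs, (Lp.memLp p.1).ae_eq (h2.trans ?_)⟩
  filter_upwards [ae_restrict_mem hJ.measurableSet] with x hx using h1 hx

theorem Setting.exists_isSol_zero {Γ : L2 J × L2 J →L[ℂ] ℂ × ℂ} (hS : Setting V J a σ Γ)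
    (hz : z ∈ regularType V J) :
    ∃ F G, IsSol (fun x => cpot V x - z) (fun _ => 0) F G ∧ MemLp F 2 (volume.restrict J) ∧
      (F a, G a) ≠ 0 := by
  obtain ⟨p, hp⟩ := hS.exists_spansKer hz
  obtain ⟨F, G, hs, hF, hG⟩ := exists_isSol (locallyIntegrable_cpot_sub hS.loc z)
    (locallyIntegrable_const 0) a (Γ p).1 (Γ p).2
  have h : (F a, G a) = Γ p := Prod.ext hF hG
  exact ⟨F, G, hs, hS.memLp_of_smul hp hs (.of_forall fun _ _ => rfl) (k := 1) (by rw [h, one_smul]),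
    by rw [h]; exact hS.boundary_ne_zero hp⟩

end HalfLine

end

section

/-! ### The interval problem -/

section Interval

variable {V : ℝ → ℝ} {a b : ℝ} {z : ℂ} {τm τp : ℂ → ℂ} {g φ F G : ℝ → ℂ}

theorem ae_indicator_Icc_eq_zero (a b : ℝ) (g : ℝ → ℂ) :
    (∀ᵐ x, x ∈ Iic a → (Icc a b).indicator g x = 0) ∧
      ∀ᵐ x, x ∈ Ici b → (Icc a b).indicator g x = 0 := by
  constructor
  · filter_upwards [(countable_singleton a).ae_notMem volume] with t ht hta
    exact indicator_of_notMem (fun h => ht (le_antisymm hta h.1)) _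
  · filter_upwards [(countable_singleton b).ae_notMem volume] with t ht htb
    exact indicator_of_notMem (fun h => ht (le_antisymm h.2 htb)) _

theorem interior_Icc_nonempty (hab : a < b) : (interior (Icc a b)).Nonempty := by
  rw [interior_Icc]; exact nonempty_Ioo.2 hab

theorem memLp_indicator_Icc (mg : MemLp g 2 (volume.restrict (Icc a b))) :
    MemLp ((Icc a b).indicator g) 2 volume :=
  (memLp_indicator_iff_restrict measurableSet_Icc).2 mg

/-- The two conditions are written with `σ = -1` and `σ = 1`, the form of `boundaryCondition_iff`.
-/
theorem solvesInterval_iff_of_isSol (hab : a < b)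
    (hs : IsSol (fun x => cpot V x - z) ((Icc a b).indicator g) F G) :
    SolvesInterval V a b τm τp z g F ↔
      ((0 ≤ meromorphicOrderAt τm z → G a - -1 * τm z * F a = 0) ∧
        (meromorphicOrderAt τm z < 0 → F a = 0)) ∧
      (0 ≤ meromorphicOrderAt τp z → G b - 1 * τp z * F b = 0) ∧
        (meromorphicOrderAt τp z < 0 → F b = 0) := by
  have hU := uniqueDiffOn_Icc hab
  have e1 := hs.derivWithin_eq hU (left_mem_Icc.2 hab.le)
  have e2 := hs.derivWithin_eq hU (right_mem_Icc.2 hab.le)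
  rw [e1, e2, neg_one_mul, neg_mul, sub_neg_eq_add, one_mul]
  refine ⟨fun h => ⟨⟨h.left, h.left_pole⟩, h.right, h.right_pole⟩, fun h =>
    ⟨hs.unshift.regular hU, memLp_of_continuous hs.continuous a b, ?_, h.1.1, h.1.2, h.2.1, h.2.2⟩⟩
  filter_upwards [hs.expr_sub_ae (J := Icc a b) (interior_Icc_nonempty hab),
    ae_restrict_mem measurableSet_Icc] with x hx hxI
  rw [hx, indicator_of_mem hxI]

theorem SolvesInterval.exists_isSol (hV : LocallyIntegrable V volume) (hab : a < b)
    (mg : MemLp g 2 (volume.restrict (Icc a b))) (h : SolvesInterval V a b τm τp z g φ) :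
    ∃ F G, IsSol (fun x => cpot V x - z) ((Icc a b).indicator g) F G ∧ EqOn F φ (Icc a b) ∧
      SolvesInterval V a b τm τp z g F := by
  have ha := left_mem_Icc.2 hab.le
  have hb := right_mem_Icc.2 hab.le
  obtain ⟨F, G, hs, h1, h2⟩ := h.regular.exists_isSol_shift (z := z) hV h.memLp
    ((memLp_indicator_Icc mg).locallyIntegrable (by norm_num)) (by
      filter_upwards [h.eqn, ae_restrict_mem measurableSet_Icc] with x hx hxI
      rw [hx, indicator_of_mem hxI]) ha
  refine ⟨F, G, hs, h1, (solvesInterval_iff_of_isSol hab hs).2 ?_⟩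
  rw [h1 ha, h1 hb, h2 ha, h2 hb, neg_one_mul, neg_mul, sub_neg_eq_add, one_mul]
  exact ⟨⟨h.left, h.left_pole⟩, h.right, h.right_pole⟩

theorem IsSol.eq_of_eqOn_Icc {q h F G F₁ G₁ : ℝ → ℂ} (hab : a < b) (hs : IsSol q h F G)
    (hs₁ : IsSol q h F₁ G₁) (he : EqOn F F₁ (Icc a b)) : F = F₁ := by
  have hU := uniqueDiffOn_Icc hab
  have ha := left_mem_Icc.2 hab.le
  have h1 : G a = G₁ a := by
    rw [hs.derivWithin_eq hU ha, hs₁.derivWithin_eq hU ha, derivWithin_congr he (he ha)]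
  exact funext fun x => (hs.eqOn (J := univ) hs₁ (.of_forall fun _ _ => rfl) (mem_univ a)
    (he ha) h1).1 (mem_univ x)

theorem HerglotzOn.meromorphicOrderAt_nonneg {τ : ℂ → ℂ} {Ω : Set ℂ} (hτ : HerglotzOn Ω τ)
    (hz : z.im ≠ 0) : 0 ≤ meromorphicOrderAt τ z := by
  have hO : IsOpen {w : ℂ | w.im ≠ 0} := isOpen_ne_fun Complex.continuous_im continuous_const
  exact (hτ.holomorphic.analyticAt (hO.mem_nhds hz)).meromorphicOrderAt_nonneg

/-- A function on the line with prescribed homogeneous solutions near the end points. -/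
theorem IsSol.exists_glue {q f f' p p' : ℝ → ℂ} (hab : a < b) (hf : IsSol q (fun _ => 0) f f')
    (hp : IsSol q (fun _ => 0) p p') : ∃ k F G, Continuous k ∧ IsSol q k F G ∧
      F a = f a ∧ G a = f' a ∧ F b = p b ∧ G b = p' b := by
  obtain ⟨e₁, h₁, h₁'⟩ := exists_between hab
  obtain ⟨e₂, h₂, h₂'⟩ := exists_between h₁'
  have hd := (hp.sub hf).congr_rhs (h₁ := fun _ => 0) (.of_forall fun x => sub_self _)
  obtain ⟨k, W, W', hW, ck, -, hW0, hW1⟩ := hd.exists_cutoff h₂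
  have h0 : W' a = 0 := hW.deriv_eq_zero isOpen_Iio (fun x hx => hW0 x (le_of_lt hx)) a h₁
  have h1 : W' b - (p' b - f' b) = 0 := (hW.sub hd).deriv_eq_zero isOpen_Ioi
    (fun x hx => sub_eq_zero.2 (hW1 x (le_of_lt hx))) b h₂'
  refine ⟨k, _, _, ck, (hf.add hW).congr_rhs (.of_forall fun x => zero_add _), ?_, ?_, ?_, ?_⟩
  · simp [hW0 a h₁.le]
  · simp [h0]
  · simp [hW1 b h₂'.le]
  · simp [sub_eq_zero.1 h1]

/-- The half-lines adjacent to the interval, both in the limit point case, with their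
Weyl-Titchmarsh coefficients. -/
structure LineSetting (V : ℝ → ℝ) (a b : ℝ) (Γm : L2 (Iic a) × L2 (Iic a) →L[ℂ] ℂ × ℂ)
    (Γp : L2 (Ici b) × L2 (Ici b) →L[ℂ] ℂ × ℂ) (mm mp : ℂ → ℂ) : Prop where
  lt : a < b
  left : Setting V (Iic a) a (-1) Γm
  right : Setting V (Ici b) b 1 Γp
  weyl_left : IsWeylTitchmarsh V (Iic a) a (-1) mm
  weyl_right : IsWeylTitchmarsh V (Ici b) b 1 mp

namespace LineSetting

variable {Γm : L2 (Iic a) × L2 (Iic a) →L[ℂ] ℂ × ℂ} {Γp : L2 (Ici b) × L2 (Ici b) →L[ℂ] ℂ × ℂ}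
  {mm mp : ℂ → ℂ} (hL : LineSetting V a b Γm Γp mm mp)
include hL

/-- The Weyl-Titchmarsh boundary conditions select the solutions that are square integrable on the
line. -/
theorem solvesInterval_iff (hz : z ∈ commonRegularType V a b)
    (hs : IsSol (fun x => cpot V x - z) ((Icc a b).indicator g) F G) :
    SolvesInterval V a b mm mp z g F ↔ MemLp F 2 volume := by
  obtain ⟨h1, h2⟩ := ae_indicator_Icc_eq_zero a b g
  rw [solvesInterval_iff_of_isSol hL.lt hs, hL.left.boundaryCondition_iff hL.weyl_left hz.1 hs h1,
    hL.right.boundaryCondition_iff hL.weyl_right hz.2 hs h2]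
  exact ⟨fun h => memLp_of_restrict hs.continuous hL.lt h.1 h.2, fun h =>
    ⟨h.restrict _, h.restrict _⟩⟩

theorem solvesInterval_of_solvesLine (hz : z ∈ commonRegularType V a b)
    (mg : MemLp g 2 (volume.restrict (Icc a b)))
    (h : SolvesLine V z ((Icc a b).indicator g) φ) : SolvesInterval V a b mm mp z g φ := by
  obtain ⟨h1, G, hs⟩ := (solvesLine_iff hL.left.loc (memLp_indicator_Icc mg)).1 h
  exact (hL.solvesInterval_iff hz hs).2 h1

theorem exists_solvesLine (hz : z ∈ commonRegularType V a b)
    (mg : MemLp g 2 (volume.restrict (Icc a b))) (h : SolvesInterval V a b mm mp z g φ) :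
    ∃ ψ, SolvesLine V z ((Icc a b).indicator g) ψ ∧ EqOn ψ φ (Icc a b) := by
  obtain ⟨F, G, hs, h1, h2⟩ := h.exists_isSol hL.left.loc hL.lt mg
  exact ⟨F, (solvesLine_iff hL.left.loc (memLp_indicator_Icc mg)).2
    ⟨(hL.solvesInterval_iff hz hs).1 h2, G, hs⟩, h1⟩

/-- Solutions of the interval problem correspond to square integrable solutions on the line with `g`
extended by zero, and the resolvent provides exactly one of these. -/
theorem resolventH_subset_regularPoints : resolventH V ⊆ regularPoints V a b mm mp := by
  intro z hz
  have hV := hL.left.loc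
  have hΩ : z ∈ commonRegularType V a b :=
    ⟨hL.left.half.resolventH_subset hV hz, hL.right.half.resolventH_subset hV hz⟩
  obtain ⟨h1, h2⟩ := (mem_resolventH_iff hV).1 hz
  refine ⟨hΩ, fun g mg => ?_⟩
  obtain ⟨F, G, hs, mF⟩ := h2 _ (memLp_indicator_Icc mg)
  refine ⟨F, (hL.solvesInterval_iff hΩ hs).2 mF, fun χ hχ => ?_⟩
  obtain ⟨F₁, G₁, hs₁, he, hχ'⟩ := hχ.exists_isSol hV hL.lt mg
  have h3 := (hs₁.sub hs).congr_rhs (h₁ := fun _ => 0) (.of_forall fun x => sub_self _)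
  refine fun x hx => (he hx).symm.trans (sub_eq_zero.1 (h1 _ _ h3 ?_ x))
  exact ((hL.solvesInterval_iff hΩ hs₁).1 hχ').sub mF

/-- Injectivity of `H - z` comes from uniqueness for `g = 0`. For surjectivity the right-hand side
need not live on the interval, so solutions square integrable at `-∞` and at `+∞` are matched at `b`
by means of the Weyl solutions `u` and `v`. -/
theorem regularPoints_subset_resolventH : regularPoints V a b mm mp ⊆ resolventH V := by
  rintro z ⟨hz, hreg⟩
  have hV := hL.left.loc
  have hinj : ∀ F G, IsSol (fun x => cpot V x - z) (fun _ => 0) F G → MemLp F 2 volume →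
      ∀ x, F x = 0 := by
    intro F G hs mF
    have h0 : IsSol (fun x => cpot V x - z) (fun _ => 0) 0 0 :=
      by simpa using (hs.const_smul 0).congr_rhs (h₁ := fun _ => 0) (.of_forall fun x => by simp)
    have hi : (Icc a b).indicator (0 : ℝ → ℂ) = fun _ => 0 := indicator_zero' _
    obtain ⟨φ, -, hu⟩ := hreg 0 MemLp.zero
    have e1 := hu F ((hL.solvesInterval_iff hz (by rwa [hi])).2 mF)
    have e2 := hu 0 ((hL.solvesInterval_iff hz (by rwa [hi])).2 MemLp.zero)
    exact congrFun (hs.eq_of_eqOn_Icc hL.lt h0 (e1.trans e2.symm))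
  refine (mem_resolventH_iff hV).2 ⟨hinj, fun h mh => ?_⟩
  obtain ⟨F, F', hF, mF⟩ := hL.left.half.exists_isSol_memLp hV hz.1 mh
  obtain ⟨P, P', hP, mP⟩ := hL.right.half.exists_isSol_memLp hV hz.2 mh
  obtain ⟨u, u', hu, mu, hu0⟩ := hL.left.exists_isSol_zero hz.1
  obtain ⟨v, v', hv, mv, hv0⟩ := hL.right.exists_isSol_zero hz.2
  -- Proportional Weyl solutions would be square integrable at both ends, contradicting injectivity.
  have hW : u b * v' b - u' b * v b ≠ 0 := by
    intro hW
    obtain ⟨c, hc, hc'⟩ : ∃ c : ℂ, u b = c * v b ∧ u' b = c * v' b := by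
      by_cases h0 : v b = 0
      · have h1 : v' b ≠ 0 := fun h1 => hv0 (Prod.ext h0 h1)
        rw [h0, mul_zero, sub_zero, mul_eq_zero] at hW
        exact ⟨u' b / v' b, by rw [h0, mul_zero]; exact hW.resolve_right h1, by field_simp⟩
      · refine ⟨u b / v b, by field_simp, ?_⟩
        field_simp
        linear_combination -hW
    have h1 := (hu.eqOn (J := univ) (hv.const_smul c) (.of_forall fun x _ => by simp) (mem_univ b)
      hc hc').1
    have mu' : MemLp u 2 (volume.restrict (Ici b)) := by
      have : u = c • v := funext fun x => h1 (mem_univ x)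
      rw [this]; exact mv.const_smul c
    have h2 := hinj u u' hu (memLp_of_restrict hu.continuous hL.lt mu mu')
    refine hu0 (Prod.ext (h2 a) ((hu.hasDerivAt a).unique ?_))
    rw [show u = fun _ => 0 from funext h2]
    exact hasDerivAt_const _ _
  -- Cramer's rule for `F + α u = P + β v` in value and derivative at `b`.
  obtain ⟨α, hα⟩ : ∃ α, α * (u b * v' b - u' b * v b) =
      (P b - F b) * v' b - (P' b - F' b) * v b := ⟨_, div_mul_cancel₀ _ hW⟩
  obtain ⟨β, hβ⟩ : ∃ β, β * (u b * v' b - u' b * v b) =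
      (P b - F b) * u' b - (P' b - F' b) * u b := ⟨_, div_mul_cancel₀ _ hW⟩
  have hY := (hF.add (hu.const_smul α)).congr_rhs (h₁ := h) (.of_forall fun x => by simp)
  have h1 := (hY.eqOn (J := univ) (hP.add (hv.const_smul β)) (.of_forall fun x _ => by simp)
    (mem_univ b) (mul_right_cancel₀ hW (by
      simp only [Pi.add_apply, Pi.smul_apply, smul_eq_mul]
      linear_combination u b * hα - v b * hβ)) (mul_right_cancel₀ hW (by
      simp only [Pi.add_apply, Pi.smul_apply, smul_eq_mul]
      linear_combination u' b * hα - v' b * hβ))).1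
  refine ⟨_, _, hY, memLp_of_restrict hY.continuous hL.lt (mF.add (mu.const_smul α)) ?_⟩
  rw [show F + α • u = P + β • v from funext fun x => h1 (mem_univ x)]
  exact mP.add (mv.const_smul β)

theorem transparent : Transparent V a b mm mp where
  herglotz_left := hL.left.herglotzOn hL.weyl_left inter_subset_left
  herglotz_right := hL.right.herglotzOn hL.weyl_right inter_subset_right
  restrict _ hz _ mg _ h := hL.solvesInterval_of_solvesLine hz mg h
  extend _ hz _ mg _ h := hL.exists_solvesLine hz mg h
  regular_eq := hL.regularPoints_subset_resolventH.antisymm hL.resolventH_subset_regularPoints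

/-- Away from the real line, transparent boundary conditions are given by the Weyl-Titchmarsh
coefficients. -/
theorem eq_of_transparent (hT : Transparent V a b τm τp) (hz : z.im ≠ 0) :
    τm z = mm z ∧ τp z = mp z := by
  have hV := hL.left.loc
  have hΩ : z ∈ commonRegularType V a b := ⟨hL.left.mem_regularType hz, hL.right.mem_regularType hz⟩
  have c0 := locallyIntegrable_const (X := ℝ) (μ := volume) (0 : ℂ)
  -- `f` and `p` satisfy the given conditions at `a` and `b` with boundary value 1. Gluing them
  -- produces a right-hand side `k` whose interval problem has a solution with both sets of data.
  obtain ⟨f, f', hf, hfa, hfa'⟩ := exists_isSol (locallyIntegrable_cpot_sub hV z) c0 a 1 (-τm z)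
  obtain ⟨p, p', hp, hpb, hpb'⟩ := exists_isSol (locallyIntegrable_cpot_sub hV z) c0 b 1 (τp z)
  obtain ⟨k, W, W', ck, hW, hWa, hWa', hWb, hWb'⟩ := hf.exists_glue hL.lt hp
  have mk := memLp_of_continuous ck a b
  obtain ⟨F, G, hF, hFa, hGa⟩ := exists_isSol (locallyIntegrable_cpot_sub hV z)
    ((memLp_indicator_Icc mk).locallyIntegrable (by norm_num)) a (W a) (W' a)
  obtain ⟨e1, e2⟩ := hF.eqOn (J := Icc a b) hW (.of_forall fun x hx => indicator_of_mem hx _)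
    (left_mem_Icc.2 hL.lt.le) hFa hGa
  have hb := right_mem_Icc.2 hL.lt.le
  rw [hWa, hfa] at hFa
  rw [hWa', hfa'] at hGa
  have hFb : F b = 1 := by rw [e1 hb, hWb, hpb]
  have hGb : G b = τp z := by rw [e2 hb, hWb', hpb']
  have hsol : SolvesInterval V a b τm τp z k F := by
    rw [solvesInterval_iff_of_isSol hL.lt hF, hFa, hGa, hFb, hGb]
    exact ⟨⟨fun _ => by ring, fun h => absurd (hT.herglotz_left.meromorphicOrderAt_nonneg hz)
      (not_le.2 h)⟩, fun _ => by ring, fun h => absurd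
        (hT.herglotz_right.meromorphicOrderAt_nonneg hz) (not_le.2 h)⟩
  obtain ⟨ψ, hψ, he⟩ := hT.extend z hΩ k mk F hsol
  obtain ⟨mψ, ψ', hψ'⟩ := (solvesLine_iff hV (memLp_indicator_Icc mk)).1 hψ
  -- The extension coincides with `F`, so `F` is square integrable on the line and satisfies the
  -- Weyl conditions too; with boundary values 1 the coefficients can be compared directly.
  rw [hψ'.eq_of_eqOn_Icc hL.lt hF he] at mψ
  have h := (solvesInterval_iff_of_isSol hL.lt hF).1 ((hL.solvesInterval_iff hΩ hF).2 mψ)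
  have hl := h.1.1 (hL.transparent.herglotz_left.meromorphicOrderAt_nonneg hz)
  have hr := h.2.1 (hL.transparent.herglotz_right.meromorphicOrderAt_nonneg hz)
  rw [hFa, hGa] at hl
  rw [hFb, hGb] at hr
  exact ⟨by linear_combination -hl, by linear_combination hr⟩

/-- Non-real points accumulate at every point, and the meromorphic normal form fixes the values at
real points, including poles. -/
theorem eqOn_of_transparent (hT : Transparent V a b τm τp) :
    EqOn τm mm (commonRegularType V a b) ∧ EqOn τp mp (commonRegularType V a b) :=
  ⟨fun _ hz => (eventuallyEq_of_meromorphicNFAt (hT.herglotz_left.meromorphic hz)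
      (hL.weyl_left.meromorphic hz.1) fun _ hw => (hL.eq_of_transparent hT hw).1).self_of_nhds,
    fun _ hz => (eventuallyEq_of_meromorphicNFAt (hT.herglotz_right.meromorphic hz)
      (hL.weyl_right.meromorphic hz.2) fun _ hw => (hL.eq_of_transparent hT hw).2).self_of_nhds⟩

end LineSetting

end Interval

end

end TransparentBC

theorem mainTheorem1 (V : ℝ → ℝ) (hV : LocallyIntegrable V volume) (a b : ℝ) (hab : a < b)
    (hlpm : TransparentBC.LimitPoint V (Iic a)) (hlpp : TransparentBC.LimitPoint V (Ici b)) :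
    (∃ m : ℂ → ℂ, TransparentBC.IsWeylTitchmarsh V (Iic a) a (-1) m) ∧
    (∃ m : ℂ → ℂ, TransparentBC.IsWeylTitchmarsh V (Ici b) b 1 m) ∧
    ∀ mm mp : ℂ → ℂ,
      TransparentBC.IsWeylTitchmarsh V (Iic a) a (-1) mm →
      TransparentBC.IsWeylTitchmarsh V (Ici b) b 1 mp →
      TransparentBC.Transparent V a b mm mp ∧
      ∀ τm τp : ℂ → ℂ, TransparentBC.Transparent V a b τm τp →
        EqOn τm mm (TransparentBC.commonRegularType V a b) ∧
        EqOn τp mp (TransparentBC.commonRegularType V a b) := by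
  have hlm := TransparentBC.IsHalfLine.left a
  have hlp := TransparentBC.IsHalfLine.right b
  obtain ⟨Γm, hΓm⟩ := hlm.exists_isBoundaryMap hV
  obtain ⟨Γp, hΓp⟩ := hlp.exists_isBoundaryMap hV
  have hSm : TransparentBC.Setting V (Iic a) a (-1) Γm := ⟨hlm, hV, hlpm, hΓm⟩
  have hSp : TransparentBC.Setting V (Ici b) b 1 Γp := ⟨hlp, hV, hlpp, hΓp⟩
  refine ⟨⟨_, hSm.isWeylTitchmarsh_weylQuot⟩, ⟨_, hSp.isWeylTitchmarsh_weylQuot⟩,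
    fun mm mp hm hp => ?_⟩
  have hL : TransparentBC.LineSetting V a b Γm Γp mm mp := ⟨hab, hSm, hSp, hm, hp⟩
  exact ⟨hL.transparent, fun _ _ hT => hL.eqOn_of_transparent hT⟩
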